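/- Let $d\ge 2$ and $\langle\xi\rangle=(1+|\xi|^2)^{1/2}$ for $\xi\in\mathbb{R}^{d-1}$. For $0<h\le 1$ and a symbol $a$ on $\mathbb{R}^{d-1}\times\mathbb{R}^{d-1}$ let $$(\mathrm{Op}_h(a)f)(x)=(2\pi h)^{-d+1}\int_{\mathbb{R}^{d-1}}\int_{\mathbb{R}^{d-1}}e^{-\frac ih\langle x-y,\xi\rangle}a(x,\xi)f(y)\,dy\,d\xi ,$$ and let $H^k_h$, $k\in\mathbb{R}$, be the space of tempered distributions $u$ on $\mathbb{R}^{d-1}$ with finite norm $\|u\|_{H^k_h}=\|\mathrm{Op}_h(\langle\xi\rangle^k)u\|_{L^2}$. Operators between these spaces are defined by the formula above on Schwartz functions and extended by continuity. Given constants $C_{\alpha,\beta}$, consider for $a\in C^\infty(\mathbb{R}^{d-1}\times\mathbb{R}^{d-1};\mathbb{C})$ the condition $$|\partial_\xi^\alpha\partial_x^\beta a(x,\xi)|\le C_{\alpha,\beta}\langle\xi\rangle^k\quad\text{for all }x,\xi\text{ and all multi-indices }\alpha,\beta.\qquad(*)_k$$ Call an integer $s_d\ge 0$ admissible if for every $k\in\mathbb{R}$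 there is a constant $A$ such that, for all $0<h\le1$ and all $a$ satisfying $(*)_k$ with constants $C_{\alpha,\beta}$, the operator $\mathrm{Op}_h(a):H^k_h\to L^2$ is bounded and $$\|\mathrm{Op}_h(a)\|_{H^k_h\to L^2}\le A\sum_{|\alpha|+|\beta|\le s_d}h^{\frac{|\alpha|+|\beta|}2}C_{\alpha,\beta}.$$ **Proposition 2.2.** Admissible integers $s_d$ exist. For every admissible $s_d$, with $s'_d=2d+5+s_d$, and every $k\in\mathbb{R}$ there is a constant $A$ such that the following holds for all $0<h\le1$. If $a_1$ satisfies $(*)_0$ with constants $C^{(1)}_{\alpha,\beta}$ and $a_2$ satisfies $(*)_k$ with constants $C^{(2)}_{\alpha,\beta}$, then $\mathrm{Op}_h(a_1):L^2\to L^2$ and $\mathrm{Op}_h(a_2),\mathrm{Op}_h(a_1a_2):H^k_h\to L^2$ are bounded and $$\left\|\mathrm{Op}_h(a_1)\mathrm{Op}_h(a_2)-\mathrm{Op}_h(a_1a_2)\right\|_{H^k_h\to L^2}\le A\sum h^{\frac{|\alpha_1|+|\beta_1|+|\alpha_2|+|\beta_2|}2}\,C^{(1)}_{\alpha_1,\beta_1}C^{(2)}_{\alpha_2,\beta_2},$$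 where the sum is over all multi-indices with $|\alpha_1|+|\beta_1|+|\alpha_2|+|\beta_2|\le s'_d$, $|\alpha_1|+|\beta_1|\ge1$ and $|\alpha_2|+|\beta_2|\ge1$. -/

import Mathlib

open MeasureTheory Real
open scoped SchwartzMap FourierTransform TemperedDistribution ContDiff

namespace SemiclassicalPDO

noncomputable section

/-- The Euclidean space `ℝⁿ`. -/
abbrev Rn (n : ℕ) : Type := EuclideanSpace ℝ (Fin n)

/-- The Hilbert space `L²(ℝⁿ; ℂ)`. -/
abbrev L2 (n : ℕ) : Type := Lp ℂ 2 (volume : Measure (Rn n))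

/-! ### Symbols and their derivatives -/

/-- The weight `⟨ξ⟩ = (1 + |ξ|²)^(1/2)`. -/
def japBr {n : ℕ} (ξ : Rn n) : ℝ := Real.sqrt (1 + ‖ξ‖ ^ 2)

/-- The length `|α| = α₁ + ⋯ + αₙ` of a multi-index. -/
def len {n : ℕ} (α : Fin n → ℕ) : ℕ := ∑ i, α i

/-- The partial derivative `∂a/∂xᵢ` of `a(x, ξ)`. -/
def pdX {n : ℕ} (i : Fin n) (a : Rn n → Rn n → ℂ) : Rn n → Rn n → ℂ :=
  fun x ξ => lineDeriv ℝ (fun y => a y ξ) x (EuclideanSpace.single i (1 : ℝ))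

/-- The partial derivative `∂a/∂ξᵢ` of `a(x, ξ)`. -/
def pdXi {n : ℕ} (i : Fin n) (a : Rn n → Rn n → ℂ) : Rn n → Rn n → ℂ :=
  fun x ξ => lineDeriv ℝ (fun η => a x η) ξ (EuclideanSpace.single i (1 : ℝ))

/-- `∂ₓ^β a = (∂/∂x₁)^β₁ ⋯ (∂/∂xₙ)^βₙ a`. -/
def multiX {n : ℕ} (β : Fin n → ℕ) (a : Rn n → Rn n → ℂ) : Rn n → Rn n → ℂ :=
  (List.finRange n).foldr (fun i b => (pdX i)^[β i] b) a

/-- `∂_ξ^α a = (∂/∂ξ₁)^α₁ ⋯ (∂/∂ξₙ)^αₙ a`. -/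
def multiXi {n : ℕ} (α : Fin n → ℕ) (a : Rn n → Rn n → ℂ) : Rn n → Rn n → ℂ :=
  (List.finRange n).foldr (fun i b => (pdXi i)^[α i] b) a

/-- `a` is a `C^∞` function on `ℝⁿ × ℝⁿ` such that, for all multi-indices `α, β`,
`|∂_ξ^α ∂ₓ^β a(x, ξ)| ≤ C_{α,β} ⟨ξ⟩^k`. -/
structure SymbolBound {n : ℕ} (k : ℝ) (a : Rn n → Rn n → ℂ)
    (C : (Fin n → ℕ) → (Fin n → ℕ) → ℝ) : Prop where
  smooth : ContDiff ℝ ∞ (fun p : Rn n × Rn n => a p.1 p.2)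
  bound : ∀ (α β : Fin n → ℕ) (x ξ : Rn n),
    ‖multiXi α (multiX β a) x ξ‖ ≤ C α β * japBr ξ ^ k

/-- The finite set of all multi-indices of length at most `N`. -/
def multiIdx (n N : ℕ) : Finset (Fin n → ℕ) :=
  (Fintype.piFinset fun _ => Finset.range (N + 1)).filter fun α => len α ≤ N

lemma mem_multiIdx {n N : ℕ} (α : Fin n → ℕ) : α ∈ multiIdx n N ↔ len α ≤ N := by
  simp only [multiIdx, Finset.mem_filter, Fintype.mem_piFinset, Finset.mem_range,
    and_iff_right_iff_imp]
  intro h i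
  have : α i ≤ len α := Finset.single_le_sum (f := α) (fun _ _ => Nat.zero_le _) (Finset.mem_univ i)
  omega

/-! ### The operators on Schwartz functions -/

/-- `(Op_h(a) f)(x) = (2πh)^{-n} ∫∫ e^{-(i/h)⟨x-y, ξ⟩} a(x, ξ) f(y) dy dξ`. -/
def opFun {n : ℕ} (h : ℝ) (a : Rn n → Rn n → ℂ) (f : Rn n → ℂ) (x : Rn n) : ℂ :=
  (((2 * π * h) ^ n : ℝ) : ℂ)⁻¹ *
    ∫ ξ : Rn n, ∫ y : Rn n,
      Complex.exp (-(Complex.I / h) * (inner ℝ (x - y) ξ : ℝ)) * a x ξ * f y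

/-! ### Semiclassical Sobolev spaces -/

/-- The weight `⟨2πhη⟩^k`. With Mathlib's normalisation of the Fourier transform (the character is
`e^{-2πi⟨y, η⟩}`) this is the Fourier multiplier of `Op_h(⟨ξ⟩^k)`, see `opFun_japBr`. -/
def weight {n : ℕ} (h k : ℝ) (η : Rn n) : ℂ := ((japBr ((2 * π * h) • η) ^ k : ℝ) : ℂ)

lemma weight_eq {n : ℕ} (h k : ℝ) :
    (weight h k : Rn n → ℂ) =
      fun η => (((1 + ‖(2 * π * h) • η‖ ^ 2) ^ (k / 2) : ℝ) : ℂ) := by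
  ext η
  have : (0 : ℝ) ≤ 1 + ‖(2 * π * h) • η‖ ^ 2 := by positivity
  simp only [weight, japBr]
  rw [Real.sqrt_eq_rpow, ← Real.rpow_mul this]
  congr 2
  ring

lemma weight_hasTemperateGrowth {n : ℕ} (h k : ℝ) :
    (weight h k : Rn n → ℂ).HasTemperateGrowth := by
  rw [weight_eq]
  have h1 : Function.HasTemperateGrowth
      (fun η : Rn n => ((1 + ‖η‖ ^ 2) ^ (k / 2) : ℝ)) := by fun_prop
  have h2 : Function.HasTemperateGrowth (fun η : Rn n => (2 * π * h) • η) := by fun_prop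
  have h3 := h1.comp h2
  have h4 : Function.HasTemperateGrowth (fun η : Rn n =>
      (((fun η : Rn n => ((1 + ‖η‖ ^ 2) ^ (k / 2) : ℝ)) ((2 * π * h) • η) : ℝ) : ℂ)) := by
    fun_prop
  exact h4

lemma weight_mul_weight_neg {n : ℕ} (h k : ℝ) :
    (weight h k : Rn n → ℂ) * weight h (-k) = fun _ => 1 := by
  ext η
  have : 0 < japBr ((2 * π * h) • η) := Real.sqrt_pos.2 (by positivity)
  simp only [Pi.mul_apply, weight]
  rw [← Complex.ofReal_mul, ← Real.rpow_add this]
  simp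

/-- `Op_h(⟨ξ⟩^k)` on tempered distributions. -/
def bessel (n : ℕ) (h k : ℝ) : 𝓢'(Rn n, ℂ) →L[ℂ] 𝓢'(Rn n, ℂ) :=
  TemperedDistribution.fourierMultiplierCLM ℂ (weight h k)

/-- `Op_h(⟨ξ⟩^k)` on Schwartz functions. -/
def besselS (n : ℕ) (h k : ℝ) : 𝓢(Rn n, ℂ) →L[ℂ] 𝓢(Rn n, ℂ) :=
  SchwartzMap.fourierMultiplierCLM ℂ (weight h k)

lemma bessel_neg_bessel (n : ℕ) (h k : ℝ) (u : 𝓢'(Rn n, ℂ)) :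
    bessel n h (-k) (bessel n h k u) = u := by
  simp only [bessel]
  rw [TemperedDistribution.fourierMultiplierCLM_fourierMultiplierCLM_apply
    (weight_hasTemperateGrowth h k) (weight_hasTemperateGrowth h (-k)),
    mul_comm, mul_comm, weight_mul_weight_neg]
  simp

lemma besselS_besselS_neg (n : ℕ) (h k : ℝ) (f : 𝓢(Rn n, ℂ)) :
    besselS n h k (besselS n h (-k) f) = f := by
  simp only [besselS]
  rw [SchwartzMap.fourierMultiplierCLM_fourierMultiplierCLM_apply
    (weight_hasTemperateGrowth h k) (weight_hasTemperateGrowth h (-k)), weight_mul_weight_neg]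
  simp

/-- The inclusion of `L²` in the tempered distributions. -/
def inclL2 (n : ℕ) : L2 n →ₗ[ℂ] 𝓢'(Rn n, ℂ) :=
  (Lp.toTemperedDistributionCLM ℂ (volume : Measure (Rn n)) 2).toLinearMap

lemma inclL2_injective (n : ℕ) : Function.Injective (inclL2 n) := by
  rw [← LinearMap.ker_eq_bot]
  exact Lp.ker_toTemperedDistributionCLM_eq_bot

/-- The tempered distributions `u` with `Op_h(⟨ξ⟩^k) u ∈ L²`. -/
def sobolevSubmodule (n : ℕ) (h k : ℝ) : Submodule ℂ 𝓢'(Rn n, ℂ) :=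
  Submodule.comap (bessel n h k).toLinearMap (LinearMap.range (inclL2 n))

/-- The semiclassical Sobolev space `H_h^k(ℝⁿ)`. It is a type of its own since it carries the
topology of its norm rather than that of the tempered distributions. -/
def Hsc (n : ℕ) (h k : ℝ) : Type := ↥(sobolevSubmodule n h k)

instance (n : ℕ) (h k : ℝ) : AddCommGroup (Hsc n h k) :=
  inferInstanceAs (AddCommGroup ↥(sobolevSubmodule n h k))

instance (n : ℕ) (h k : ℝ) : Module ℂ (Hsc n h k) :=
  inferInstanceAs (Module ℂ ↥(sobolevSubmodule n h k))

/-- The map `u ↦ Op_h(⟨ξ⟩^k) u` from `H_h^k` to `L²`. -/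
def toL2 (n : ℕ) (h k : ℝ) : Hsc n h k →ₗ[ℂ] L2 n :=
  (LinearEquiv.ofInjective (inclL2 n) (inclL2_injective n)).symm.toLinearMap ∘ₗ
    ((bessel n h k).toLinearMap.restrict (p := sobolevSubmodule n h k)
      (q := LinearMap.range (inclL2 n)) fun _ hu => hu)

lemma inclL2_toL2 (n : ℕ) (h k : ℝ) (u : Hsc n h k) :
    inclL2 n (toL2 n h k u) = bessel n h k u.1 := by
  have := (LinearEquiv.ofInjective (inclL2 n) (inclL2_injective n)).apply_symm_apply
    ((bessel n h k).toLinearMap.restrict (p := sobolevSubmodule n h k)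
      (q := LinearMap.range (inclL2 n)) (fun _ hu => hu) u)
  exact congrArg Subtype.val this

lemma toL2_injective (n : ℕ) (h k : ℝ) : Function.Injective (toL2 n h k) := by
  intro u v huv
  have h1 : bessel n h k u.1 = bessel n h k v.1 := by
    rw [← inclL2_toL2, ← inclL2_toL2, huv]
  have h2 := congrArg (bessel n h (-k)) h1
  rw [bessel_neg_bessel, bessel_neg_bessel] at h2
  exact Subtype.ext h2

/-- The norm `‖u‖_{H_h^k} = ‖Op_h(⟨ξ⟩^k) u‖_{L²}`. -/
instance (n : ℕ) (h k : ℝ) : NormedAddCommGroup (Hsc n h k) :=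
  NormedAddCommGroup.induced (Hsc n h k) (L2 n) (toL2 n h k) (toL2_injective n h k)

instance (n : ℕ) (h k : ℝ) : NormedSpace ℂ (Hsc n h k) :=
  NormedSpace.induced ℂ (Hsc n h k) (L2 n) (toL2 n h k)

lemma norm_eq (n : ℕ) (h k : ℝ) (u : Hsc n h k) : ‖u‖ = ‖toL2 n h k u‖ := rfl

lemma bessel_schwartz (n : ℕ) (h k : ℝ) (f : 𝓢(Rn n, ℂ)) :
    bessel n h k (f : 𝓢'(Rn n, ℂ)) = inclL2 n ((besselS n h k f).toLp 2) := by
  have h1 := TemperedDistribution.fourierMultiplierCLM_toTemperedDistributionCLM_eq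
    (weight_hasTemperateGrowth (n := n) h k) f
  have h2 : inclL2 n ((besselS n h k f).toLp 2) = ((besselS n h k f : 𝓢(Rn n, ℂ)) : 𝓢'(Rn n, ℂ)) :=
    Lp.toTemperedDistribution_toLp_eq _
  rw [h2]
  exact h1

lemma schwartz_mem (n : ℕ) (h k : ℝ) (f : 𝓢(Rn n, ℂ)) :
    (f : 𝓢'(Rn n, ℂ)) ∈ sobolevSubmodule n h k := by
  change bessel n h k (f : 𝓢'(Rn n, ℂ)) ∈ LinearMap.range (inclL2 n)
  rw [bessel_schwartz]
  exact LinearMap.mem_range_self _ _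

/-- A Schwartz function, as an element of `H_h^k`. -/
def schwartzToHsc (n : ℕ) (h k : ℝ) (f : 𝓢(Rn n, ℂ)) : Hsc n h k :=
  ⟨(f : 𝓢'(Rn n, ℂ)), schwartz_mem n h k f⟩

lemma toL2_schwartzToHsc (n : ℕ) (h k : ℝ) (f : 𝓢(Rn n, ℂ)) :
    toL2 n h k (schwartzToHsc n h k f) = (besselS n h k f).toLp 2 := by
  apply inclL2_injective n
  rw [inclL2_toL2, ← bessel_schwartz]
  rfl

/-- Schwartz functions are dense in `H_h^k`. -/
lemma denseRange_schwartzToHsc (n : ℕ) (h k : ℝ) : DenseRange (schwartzToHsc n h k) := by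
  have hd : DenseRange (SchwartzMap.toLpCLM ℝ ℂ 2 (volume : Measure (Rn n))) :=
    SchwartzMap.denseRange_toLpCLM (by simp)
  rw [Metric.denseRange_iff] at hd ⊢
  intro u ε hε
  obtain ⟨g, hg⟩ := hd (toL2 n h k u) ε hε
  refine ⟨besselS n h (-k) g, ?_⟩
  rw [dist_eq_norm] at hg ⊢
  rw [norm_eq, map_sub, toL2_schwartzToHsc, besselS_besselS_neg]
  exact hg

/-- On Schwartz functions the Fourier multiplier that defines `H_h^k` is the operator with the
symbol `⟨ξ⟩^k`. -/
lemma opFun_japBr {n : ℕ} {h : ℝ} (hh : 0 < h) (k : ℝ) (f : 𝓢(Rn n, ℂ)) (x : Rn n) :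
    opFun h (fun _ ξ => ((japBr ξ ^ k : ℝ) : ℂ)) f x = besselS n h k f x := by
  have hc : (2 * π * h) ≠ 0 := by positivity
  have hR : besselS n h k f x
      = ∫ η : Rn n, Complex.exp (2 * π * (inner ℝ η x : ℝ) * Complex.I) *
          (weight h k η * ∫ y : Rn n, Complex.exp (-(2 * π * (inner ℝ y η : ℝ)) * Complex.I) * f y) := by
    rw [besselS, SchwartzMap.fourierMultiplierCLM_apply, SchwartzMap.fourierInv_coe,
      Real.fourierInv_eq']
    refine integral_congr_ae (Filter.Eventually.of_forall fun η => ?_)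
    simp only [SchwartzMap.smulLeftCLM_apply_apply (weight_hasTemperateGrowth h k),
      SchwartzMap.fourier_coe, smul_eq_mul]
    rw [Real.fourier_eq']
    simp only [smul_eq_mul]
    push_cast
    congr 3
    ext y
    congr 2
    ring
  have hL := Measure.integral_comp_smul (volume : Measure (Rn n))
    (fun ξ : Rn n => ∫ y : Rn n, Complex.exp (-(Complex.I / h) * (inner ℝ (x - y) ξ : ℝ)) *
      ((japBr ξ ^ k : ℝ) : ℂ) * f y) (-(2 * π * h))
  have habs : |((-(2 * π * h)) ^ Module.finrank ℝ (Rn n))⁻¹| = ((2 * π * h) ^ n)⁻¹ := by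
    rw [abs_inv, abs_pow, abs_neg, abs_of_pos (by positivity), finrank_euclideanSpace_fin]
  rw [habs, Complex.real_smul, Complex.ofReal_inv] at hL
  rw [opFun, ← hL, hR]
  refine integral_congr_ae (Filter.Eventually.of_forall fun η => ?_)
  simp only []
  rw [← mul_assoc, ← integral_const_mul]
  refine integral_congr_ae (Filter.Eventually.of_forall fun y => ?_)
  have hw : ((japBr (-(2 * π * h) • η) ^ k : ℝ) : ℂ) = weight h k η := by
    simp [weight, japBr, norm_smul]
  have hh' : (h : ℂ) ≠ 0 := by exact_mod_cast hh.ne'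
  have he : Complex.exp (-(Complex.I / h) * (inner ℝ (x - y) (-(2 * π * h) • η) : ℝ))
      = Complex.exp (2 * π * (inner ℝ η x : ℝ) * Complex.I) *
        Complex.exp (-(2 * π * (inner ℝ y η : ℝ)) * Complex.I) := by
    rw [← Complex.exp_add, inner_smul_right, inner_sub_left, real_inner_comm x η]
    congr 1
    push_cast
    field_simp
    ring
  simp only [hw, he]
  ring

/-! ### The operators on Sobolev spaces -/

/-- `T : H_h^k → L²` is the operator `Op_h(a)`: a bounded operator that acts on Schwartz functions
by the defining integral. There is at most one, see `IsOp.unique`. -/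
def IsOp {n : ℕ} (h k : ℝ) (a : Rn n → Rn n → ℂ) (T : Hsc n h k →L[ℂ] L2 n) : Prop :=
  ∀ f : 𝓢(Rn n, ℂ), T (schwartzToHsc n h k f) =ᵐ[volume] opFun h a f

lemma IsOp.unique {n : ℕ} {h k : ℝ} {a : Rn n → Rn n → ℂ} {T T' : Hsc n h k →L[ℂ] L2 n}
    (hT : IsOp h k a T) (hT' : IsOp h k a T') : T = T' := by
  have : (T : Hsc n h k → L2 n) = T' := by
    refine (denseRange_schwartzToHsc n h k).equalizer T.continuous T'.continuous ?_
    ext1 f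
    exact Lp.ext ((hT f).trans (hT' f).symm)
  exact DFunLike.coe_injective this

/-- `T : L² → L²` is the operator `Op_h(a)`: a bounded operator that acts on Schwartz functions
by the defining integral. There is at most one, see `IsOpL2.unique`. -/
def IsOpL2 {n : ℕ} (h : ℝ) (a : Rn n → Rn n → ℂ) (T : L2 n →L[ℂ] L2 n) : Prop :=
  ∀ f : 𝓢(Rn n, ℂ), T (f.toLp 2) =ᵐ[volume] opFun h a f

lemma IsOpL2.unique {n : ℕ} {h : ℝ} {a : Rn n → Rn n → ℂ} {T T' : L2 n →L[ℂ] L2 n}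
    (hT : IsOpL2 h a T) (hT' : IsOpL2 h a T') : T = T' := by
  have hd : DenseRange (SchwartzMap.toLpCLM ℝ ℂ 2 (volume : Measure (Rn n))) :=
    SchwartzMap.denseRange_toLpCLM (by simp)
  have : (T : L2 n → L2 n) = T' := by
    refine hd.equalizer T.continuous T'.continuous ?_
    ext1 f
    exact Lp.ext ((hT f).trans (hT' f).symm)
  exact DFunLike.coe_injective this

/-! ### The bounds -/

/-- `∑_{|α|+|β| ≤ s} h^{(|α|+|β|)/2} C_{α,β}`. -/
def boundSum {n : ℕ} (s : ℕ) (h : ℝ) (C : (Fin n → ℕ) → (Fin n → ℕ) → ℝ) : ℝ :=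
  ∑ p ∈ (multiIdx n s ×ˢ multiIdx n s).filter (fun p => len p.1 + len p.2 ≤ s),
    h ^ (((len p.1 + len p.2 : ℕ) : ℝ) / 2) * C p.1 p.2

/-- The sum of `h^{(|α₁|+|β₁|+|α₂|+|β₂|)/2} C⁽¹⁾_{α₁,β₁} C⁽²⁾_{α₂,β₂}` over all multi-indices with
`|α₁|+|β₁|+|α₂|+|β₂| ≤ s`, `|α₁|+|β₁| ≥ 1` and `|α₂|+|β₂| ≥ 1`. The first pair of `p` is
`(α₁, β₁)`, the second one is `(α₂, β₂)`. -/
def compSum {n : ℕ} (s : ℕ) (h : ℝ) (C₁ C₂ : (Fin n → ℕ) → (Fin n → ℕ) → ℝ) : ℝ :=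
  ∑ p ∈ ((multiIdx n s ×ˢ multiIdx n s) ×ˢ (multiIdx n s ×ˢ multiIdx n s)).filter
      (fun p => len p.1.1 + len p.1.2 + len p.2.1 + len p.2.2 ≤ s ∧
        1 ≤ len p.1.1 + len p.1.2 ∧ 1 ≤ len p.2.1 + len p.2.2),
    h ^ (((len p.1.1 + len p.1.2 + len p.2.1 + len p.2.2 : ℕ) : ℝ) / 2) *
      C₁ p.1.1 p.1.2 * C₂ p.2.1 p.2.2

/-- `s` can serve as the number of derivatives in the boundedness theorem on `ℝⁿ`: for every `k`
there is a constant `A` such that `‖Op_h(a)‖_{H_h^k → L²} ≤ A ∑_{|α|+|β| ≤ s} h^{(|α|+|β|)/2} C_{α,β}`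
for all `0 < h ≤ 1` and all symbols `a` with `|∂_ξ^α ∂ₓ^β a(x, ξ)| ≤ C_{α,β} ⟨ξ⟩^k`. -/
def BoundednessOrder (n s : ℕ) : Prop :=
  ∀ k : ℝ, ∃ A : ℝ, ∀ h : ℝ, 0 < h → h ≤ 1 →
    ∀ (a : Rn n → Rn n → ℂ) (C : (Fin n → ℕ) → (Fin n → ℕ) → ℝ), SymbolBound k a C →
      ∃ T : Hsc n h k →L[ℂ] L2 n, IsOp h k a T ∧ ‖T‖ ≤ A * boundSum s h C

end

end SemiclassicalPDO

open SemiclassicalPDO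

open SemiclassicalPDO

/-! Write n = d - 1. Substituting ξ = -2πhη turns `Op_h(a) f` into ∫ e^{2πi⟨x,η⟩} a(x, -2πhη) 𝓕f(η)
dη, so everything reduces to the operators `knOp b` acting on Fourier transforms. Two facts are
needed: a Calderón–Vaillancourt bound, and an exact formula for the symbol of a composition.

Boundedness (`exists_calderon_vaillancourt`, `boundednessOrder_two_mul`). By duality one bounds ∫∫
v(x) U(η) e^{2πi⟨x,η⟩} q(x,η). The identity G(0) = ∫₀¹ (G(s) + (s-1) G'(s)) ds, used once in each of
the 2n coordinates, writes q as a sum of averages over the unit cube of translated derivatives of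
order at most 2n. Moving the translation to the kernel leaves the cube averages of v(x-τ) U(η-θ)
e^{2πi⟨x-τ,η-θ⟩}. The only term coupling τ and θ is e^{2πi⟨τ,θ⟩}, which on the cube is two chirps
times a superposition of e^{2πi⟨τ+θ,y⟩} with an integrable density in y. For each y there remains a
product of two windowed Fourier transforms, integrable in (x,η) by Cauchy–Schwarz and Plancherel.
The dilation (x,η) ↦ (√h x, η/√h) preserves the bilinear form up to unitary changes of v and U and
makes every derivative of the symbol gain a factor √h. The weight is removed by passing from a to
a⟨ξ⟩^{-k}. Hence 2n is admissible.

Composition (`integral_mul_fourier_eq_expansion`, `comp_ae_eq`). If the second symbol B has compact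
support in x, the composition has symbol ∫ b(x, η+θ) 𝓕[z ↦ B(x+z, η)](θ) dθ. A first-order Taylor
formula in θ gives the product bB plus a remainder in which b has one derivative in the frequency
and B one in the space variable. Inserting (1-Δ)^M on both Fourier sides, with 2M > n, makes the
remainder an absolutely convergent integral with kernel independent of the symbols. Translation in
frequency acts only on b, which has order 0, and translation in space does not change ⟨ξ⟩, so the
remainder is again a symbol of order k. Cutoffs in x are removed by a limit.

Counting: each factor receives between 1 and 2M+1 ≤ n+3 derivatives. The remainder is then inserted
in the given boundedness theorem, which takes at most s further derivatives, distributed by Leibniz.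
The total is at most 2n+6+s, within the allowed 2n+7+s = 2d+5+s. Since the expansion is carried out
in coordinates dilated by √h, each of these derivatives brings a factor √h; returning to the
original coordinates costs √h for each of the at most s outer ones, which the powers of h in the
boundedness theorem restore. -/

namespace SemiclassicalPDO

/-! ### Iterated directional derivatives -/

section DirD

variable {P Q : Type*} [NormedAddCommGroup P] [NormedSpace ℝ P]
  [NormedAddCommGroup Q] [NormedSpace ℝ Q]

/-- Iterated directional derivatives; the head of the list is the outermost derivative. -/
noncomputable def dirD : List P → (P → ℂ) → P → ℂ
  | [], f => f
  | v :: l, f => fun p => fderiv ℝ (dirD l f) p v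

@[simp] lemma dirD_nil (f : P → ℂ) : dirD [] f = f := rfl

lemma dirD_cons (v : P) (l : List P) (f : P → ℂ) :
    dirD (v :: l) f = fun p => fderiv ℝ (dirD l f) p v := rfl

lemma contDiff_fderiv_dir {f : P → ℂ} (hf : ContDiff ℝ ∞ f) (v : P) :
    ContDiff ℝ ∞ fun p => fderiv ℝ f p v :=
  (hf.fderiv_right (m := ∞) (by simp)).clm_apply contDiff_const

lemma contDiff_dirD {f : P → ℂ} (hf : ContDiff ℝ ∞ f) (l : List P) :
    ContDiff ℝ ∞ (dirD l f) := by
  induction l with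
  | nil => exact hf
  | cons v l ih => exact contDiff_fderiv_dir ih v

lemma differentiable_dirD {f : P → ℂ} (hf : ContDiff ℝ ∞ f) (l : List P) :
    Differentiable ℝ (dirD l f) := (contDiff_dirD hf l).differentiable (by simp)

lemma continuous_dirD {f : P → ℂ} (hf : ContDiff ℝ ∞ f) (l : List P) :
    Continuous (dirD l f) := (contDiff_dirD hf l).continuous

lemma dirD_append (l l' : List P) (f : P → ℂ) : dirD (l ++ l') f = dirD l (dirD l' f) := by
  induction l with
  | nil => rfl
  | cons v l ih => simp only [List.cons_append, dirD_cons, ih]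

lemma dirD_swap {f : P → ℂ} (hf : ContDiff ℝ ∞ f) (u v : P) :
    dirD [u, v] f = dirD [v, u] f := by
  funext p
  have hd : DifferentiableAt ℝ (fderiv ℝ f) p :=
    ((hf.fderiv_right (m := ∞) (by simp)).differentiable (by simp)) p
  have hs : IsSymmSndFDerivAt ℝ f p := by
    refine (hf.contDiffAt (x := p)).isSymmSndFDerivAt ?_
    rw [minSmoothness_of_isRCLikeNormedField]
    exact WithTop.coe_le_coe.2 le_top
  have h1 : ∀ a b : P, dirD [a, b] f p = fderiv ℝ (fderiv ℝ f) p a b := by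
    intro a b
    simp only [dirD_cons, dirD_nil]
    rw [fderiv_clm_apply hd (differentiableAt_const b)]
    simp
  rw [h1, h1]
  exact hs.eq u v

/-- Symmetry of second derivatives, one adjacent transposition at a time. This is what makes the
derivative along a word depend only on its multi-index. -/
lemma dirD_perm {f : P → ℂ} (hf : ContDiff ℝ ∞ f) {l l' : List P} (h : l.Perm l') :
    dirD l f = dirD l' f := by
  induction h with
  | nil => rfl
  | cons v _ ih => simp only [dirD_cons, ih]
  | swap u v l =>
    have := dirD_swap (contDiff_dirD hf l) v u
    simpa only [dirD_cons, dirD_nil] using this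
  | trans _ _ h1 h2 => exact h1.trans h2

/-- The chain rule has no higher-order terms for affine maps. Translations, dilations and
restrictions to sections x = const or ξ = const are all instances. -/
lemma dirD_comp_affine {f : P → ℂ} (hf : ContDiff ℝ ∞ f) (L : Q →L[ℝ] P) (c : P)
    (l : List Q) :
    dirD l (fun q => f (L q + c)) = fun q => dirD (l.map L) f (L q + c) := by
  induction l with
  | nil => rfl
  | cons v l ih =>
    funext q
    simp only [dirD_cons, ih, List.map_cons]
    have h1 : HasFDerivAt (fun q => L q + c) (L : Q →L[ℝ] P) q := L.hasFDerivAt.add_const c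
    have h2 := ((differentiable_dirD hf (l.map L)) (L q + c)).hasFDerivAt
    have h3 : HasFDerivAt (fun q => dirD (l.map L) f (L q + c)) _ q := HasFDerivAt.comp q h2 h1
    rw [h3.fderiv]
    simp

lemma dirD_sum {ι : Type*} (s : Finset ι) {f : ι → P → ℂ} (hf : ∀ i ∈ s, ContDiff ℝ ∞ (f i))
    (l : List P) :
    dirD l (fun p => ∑ i ∈ s, f i p) = fun p => ∑ i ∈ s, dirD l (f i) p := by
  induction l with
  | nil => rfl
  | cons v l ih =>
    funext p
    simp only [dirD_cons, ih]
    rw [fderiv_fun_sum fun i hi => differentiable_dirD (hf i hi) l p]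
    simp

lemma dirD_const_mul {f : P → ℂ} (hf : ContDiff ℝ ∞ f) (c : ℂ) (l : List P) :
    dirD l (fun p => c * f p) = fun p => c * dirD l f p := by
  induction l with
  | nil => rfl
  | cons v l ih =>
    funext p
    simp only [dirD_cons, ih]
    rw [fderiv_const_mul (differentiable_dirD hf l p)]
    simp

/-- All ways to split a list in two complementary sublists. -/
def splits {J : Type*} : List J → List (List J × List J)
  | [] => [([], [])]
  | j :: l => (splits l).map (fun s => (j :: s.1, s.2)) ++ (splits l).map (fun s => (s.1, j :: s.2))

lemma length_splits {J : Type*} (l : List J) : (splits l).length = 2 ^ l.length := by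
  induction l with
  | nil => rfl
  | cons j l ih => simp [splits, ih, pow_succ]; ring

lemma perm_of_mem_splits {J : Type*} {l : List J} {s : List J × List J} (hs : s ∈ splits l) :
    (s.1 ++ s.2).Perm l := by
  induction l generalizing s with
  | nil => simp [splits] at hs; simp [hs]
  | cons j l ih =>
    simp only [splits, List.mem_append, List.mem_map] at hs
    rcases hs with ⟨t, ht, rfl⟩ | ⟨t, ht, rfl⟩
    · exact (ih ht).cons j
    · exact List.perm_middle.trans ((ih ht).cons j)

lemma length_of_mem_splits {J : Type*} {l : List J} {s : List J × List J} (hs : s ∈ splits l) :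
    s.1.length + s.2.length = l.length := by
  simpa using (perm_of_mem_splits hs).length_eq

lemma splits_map {J K : Type*} (b : J → K) (l : List J) :
    splits (l.map b) = (splits l).map fun s => (s.1.map b, s.2.map b) := by
  induction l with
  | nil => rfl
  | cons j l ih => simp [splits, ih, Function.comp_def]

/-- Leibniz rule: each letter of the word goes to one of the two factors. Keeping words instead of
multi-indices avoids binomial coefficients. -/
lemma dirD_mul {f g : P → ℂ} (hf : ContDiff ℝ ∞ f) (hg : ContDiff ℝ ∞ g) (l : List P) :
    dirD l (fun p => f p * g p) =
      fun p => ((splits l).map fun s => dirD s.1 f p * dirD s.2 g p).sum := by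
  induction l with
  | nil => funext p; simp [splits]
  | cons v l ih =>
    -- An arbitrary list replaces `splits l`, since the induction removes its head and the tail need
    -- not be of the form `splits`.
    have key : ∀ (m : List (List P × List P)) (p : P),
        HasFDerivAt (fun p => (m.map fun s => dirD s.1 f p * dirD s.2 g p).sum)
          ((m.map fun s => dirD s.1 f p • fderiv ℝ (dirD s.2 g) p
            + dirD s.2 g p • fderiv ℝ (dirD s.1 f) p).sum) p := by
      intro m p
      induction m with
      | nil => simpa using hasFDerivAt_const (0 : ℂ) p
      | cons s m ihm =>
        simp only [List.map_cons, List.sum_cons]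
        exact (((differentiable_dirD hf s.1 p).hasFDerivAt).mul
          ((differentiable_dirD hg s.2 p).hasFDerivAt)).add ihm
    funext p
    simp only [dirD_cons, ih]
    rw [(key (splits l) p).fderiv]
    simp only [splits, List.map_append, List.sum_append, List.map_map, Function.comp_def]
    generalize splits l = m
    induction m with
    | nil => simp
    | cons s m ihm =>
      simp only [List.map_cons, List.sum_cons, add_apply, ihm, dirD_cons]
      simp
      ring

lemma norm_dirD_mul_le {J : Type*} (b : J → P) {f g : P → ℂ} (hf : ContDiff ℝ ∞ f)
    (hg : ContDiff ℝ ∞ g) (l : List J) (p : P) {A : ℝ}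
    (h : ∀ s ∈ splits l, ‖dirD (s.1.map b) f p‖ * ‖dirD (s.2.map b) g p‖ ≤ A) :
    ‖dirD (l.map b) (fun p => f p * g p) p‖ ≤ 2 ^ l.length * A := by
  simp only [dirD_mul hf hg, splits_map, List.map_map]
  have hl : ((splits l).length : ℝ) = 2 ^ l.length := by exact_mod_cast length_splits l
  rw [← hl]
  clear hl
  revert h
  generalize splits l = m
  intro h
  induction m with
  | nil => simp
  | cons s m ih =>
    simp only [List.map_cons, List.sum_cons, List.length_cons, Nat.cast_add, Nat.cast_one]
    refine (norm_add_le _ _).trans ?_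
    have h1 := h s (by simp)
    have h2 := ih fun t ht => h t (by simp [ht])
    simp only [Function.comp, norm_mul] at h1 h2 ⊢
    linarith

lemma dirD_eventuallyEq {f g : P → ℂ} {p : P} (h : f =ᶠ[nhds p] g) (l : List P) :
    dirD l f =ᶠ[nhds p] dirD l g := by
  induction l with
  | nil => exact h
  | cons v l ih =>
    filter_upwards [ih.eventuallyEq_nhds] with q hq
    simp only [dirD_cons, hq.fderiv_eq]

end DirD

/-! ### Smooth dependence of integrals on parameters -/

section Parametric

variable {P : Type*} [NormedAddCommGroup P] [NormedSpace ℝ P]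

/-- The family is closed under differentiation, so C^m for all members at once gives C^{m+1} for all
members. -/
lemma contDiff_of_hasFDerivAt_family {ι W : Type*} [Fintype ι] (c : ι → P →L[ℝ] ℝ)
    (next : ι → W → W) (φ : W → P → ℂ)
    (h : ∀ w p, HasFDerivAt (φ w) (∑ i, (c i).smulRight (φ (next i w) p)) p) (w : W) :
    ContDiff ℝ ∞ (φ w) := by
  have key : ∀ m : ℕ, ∀ w, ContDiff ℝ m (φ w) := by
    intro m
    induction m with
    | zero =>
      intro w
      exact contDiff_zero.2 (continuous_iff_continuousAt.2 fun p => (h w p).continuousAt)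
    | succ m ih =>
      intro w
      have hd : fderiv ℝ (φ w) = fun p => ∑ i, (c i).smulRight (φ (next i w) p) :=
        funext fun p => (h w p).fderiv
      have : ContDiff ℝ ((m : WithTop ℕ∞) + 1) (φ w) := by
        rw [contDiff_succ_iff_fderiv]
        refine ⟨fun p => (h w p).differentiableAt, by simp, ?_⟩
        rw [hd]
        exact ContDiff.sum fun i _ => contDiff_const.smulRight (ih _)
      exact_mod_cast this
  exact contDiff_infty.2 fun m => key m w

variable {ι : Type*} [Fintype ι] [FiniteDimensional ℝ P] (b : Module.Basis ι ℝ P)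
  {Y : Type*} [MeasurableSpace Y] (μ : Measure Y)

/-- The coordinates in a basis, as continuous linear forms. -/
noncomputable def coordL (i : ι) : P →L[ℝ] ℝ := LinearMap.toContinuousLinearMap (b.coord i)

lemma coordL_self_apply [DecidableEq ι] (i j : ι) : coordL b i (b j) = if j = i then 1 else 0 := by
  simp [coordL, Finsupp.single_apply]

lemma clm_eq_sum_coord (T : P →L[ℝ] ℂ) :
    T = ∑ i, (coordL b i).smulRight (T (b i)) := by
  ext p
  conv_lhs => rw [← b.sum_repr p]
  simp only [map_sum, map_smul, sum_apply, ContinuousLinearMap.smulRight_apply]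
  rfl

/-- A family of smooth functions, all of whose derivatives in the directions of the basis are
locally dominated by integrable functions. -/
structure Dominated (K : P → Y → ℂ) : Prop where
  smooth : ∀ y, ContDiff ℝ ∞ fun p => K p y
  meas : ∀ (w : List ι) p, AEStronglyMeasurable (fun y => dirD (w.map b) (fun q => K q y) p) μ
  dom : ∀ (w : List ι) p₀, ∃ s ∈ nhds p₀, ∃ B : Y → ℝ, Integrable B μ ∧
    ∀ᵐ y ∂μ, ∀ p ∈ s, ‖dirD (w.map b) (fun q => K q y) p‖ ≤ B y

variable {b μ}

lemma Dominated.integrable {K : P → Y → ℂ} (hK : Dominated b μ K) (w : List ι) (p : P) :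
    Integrable (fun y => dirD (w.map b) (fun q => K q y) p) μ := by
  obtain ⟨s, hs, B, hB, h⟩ := hK.dom w p
  exact hB.mono' (hK.meas w p) (h.mono fun y hy => hy p (mem_of_mem_nhds hs))

lemma integrable_smulRight (c : P →L[ℝ] ℝ) {g : Y → ℂ} (hg : Integrable g μ) :
    Integrable (fun y => c.smulRight (g y)) μ := by
  have h := (ContinuousLinearMap.smulRightL ℝ P ℂ c).integrable_comp hg
  simpa only [ContinuousLinearMap.smulRightL_apply_apply] using h

lemma integral_smulRight (c : P →L[ℝ] ℝ) {g : Y → ℂ} (hg : Integrable g μ) :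
    ∫ y, c.smulRight (g y) ∂μ = c.smulRight (∫ y, g y ∂μ) := by
  have h := (ContinuousLinearMap.smulRightL ℝ P ℂ c).integral_comp_comm hg
  simpa only [ContinuousLinearMap.smulRightL_apply_apply] using h

/-- Differentiation under the integral sign, with the derivative assembled from its components in
the basis, so that only scalar functions have to be dominated. The finitely many neighbourhoods are
intersected and the dominating functions added. -/
lemma Dominated.hasFDerivAt {K : P → Y → ℂ} (hK : Dominated b μ K) (w : List ι) (p : P) :
    HasFDerivAt (fun p => ∫ y, dirD (w.map b) (fun q => K q y) p ∂μ)
      (∑ i, (coordL b i).smulRight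
        (∫ y, dirD ((i :: w).map b) (fun q => K q y) p ∂μ)) p := by
  choose s hs B hB h using fun i => hK.dom (i :: w) p
  have hint : ∀ i, Integrable
      (fun y => (coordL b i).smulRight (dirD ((i :: w).map b) (fun q => K q y) p)) μ := fun i =>
    integrable_smulRight _ (hK.integrable (i :: w) p)
  have hsum : Integrable (fun y => ∑ i, (coordL b i).smulRight
      (dirD ((i :: w).map b) (fun q => K q y) p)) μ :=
    integrable_finsetSum (f := fun i y => (coordL b i).smulRight
      (dirD ((i :: w).map b) (fun q => K q y) p)) Finset.univ fun i _ => hint i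
  have heq : ∑ i, (coordL b i).smulRight (∫ y, dirD ((i :: w).map b) (fun q => K q y) p ∂μ)
      = ∫ y, ∑ i, (coordL b i).smulRight (dirD ((i :: w).map b) (fun q => K q y) p) ∂μ := by
    rw [integral_finsetSum (f := fun i y => (coordL b i).smulRight
      (dirD ((i :: w).map b) (fun q => K q y) p)) Finset.univ fun i _ => hint i]
    refine Finset.sum_congr rfl fun i _ => ?_
    exact (integral_smulRight _ (hK.integrable (i :: w) p)).symm
  rw [heq]
  clear heq
  have hbd : ∀ᵐ y ∂μ, ∀ q ∈ ⋂ i, s i, ‖∑ i, (coordL b i).smulRight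
      (dirD ((i :: w).map b) (fun q => K q y) q)‖ ≤ ∑ i, ‖coordL b i‖ * B i y := by
    have : ∀ᵐ y ∂μ, ∀ i, ∀ p ∈ s i,
        ‖dirD ((i :: w).map b) (fun q => K q y) p‖ ≤ B i y := ae_all_iff.2 h
    filter_upwards [this] with y hy p hp
    refine (norm_sum_le _ _).trans (Finset.sum_le_sum fun i _ => ?_)
    rw [ContinuousLinearMap.norm_smulRight_apply]
    exact mul_le_mul_of_nonneg_left (hy i p (Set.mem_iInter.1 hp i)) (norm_nonneg _)
  have hdiff : ∀ y q, HasFDerivAt (fun p => dirD (w.map b) (fun q => K q y) p)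
      (∑ i, (coordL b i).smulRight (dirD ((i :: w).map b) (fun q => K q y) q)) q := by
    intro y q
    have := (differentiable_dirD (hK.smooth y) (w.map b) q).hasFDerivAt
    rw [clm_eq_sum_coord b (fderiv ℝ _ q)] at this
    exact this
  exact hasFDerivAt_integral_of_dominated_of_fderiv_le (𝕜 := ℝ) (μ := μ)
    (F := fun p y => dirD (w.map b) (fun q => K q y) p)
    (bound := fun y => ∑ i, ‖coordL b i‖ * B i y)
    (F' := fun q y => ∑ i, (coordL b i).smulRight (dirD ((i :: w).map b) (fun q => K q y) q))
    (Filter.iInter_mem.2 hs) (Filter.Eventually.of_forall fun p => hK.meas w p) (hK.integrable w p)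
    hsum.aestronglyMeasurable hbd (integrable_finsetSum _ fun i _ => (hB i).const_mul _)
    (Filter.Eventually.of_forall fun y q _ => hdiff y q)

lemma Dominated.contDiff {K : P → Y → ℂ} (hK : Dominated b μ K) :
    ContDiff ℝ ∞ fun p => ∫ y, K p y ∂μ :=
  contDiff_of_hasFDerivAt_family (coordL b)
    (fun i w => i :: w) (fun w p => ∫ y, dirD (w.map b) (fun q => K q y) p ∂μ)
    (fun w p => hK.hasFDerivAt w p) []

lemma Dominated.dirD_integral {K : P → Y → ℂ} (hK : Dominated b μ K) (w : List ι) :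
    dirD (w.map b) (fun p => ∫ y, K p y ∂μ) =
      fun p => ∫ y, dirD (w.map b) (fun q => K q y) p ∂μ := by
  classical
  induction w with
  | nil => rfl
  | cons i w ih =>
    funext p
    rw [List.map_cons, dirD_cons, ih]
    simp only [(hK.hasFDerivAt w p).fderiv]
    simp only [sum_apply, ContinuousLinearMap.smulRight_apply, coordL_self_apply]
    simp

end Parametric

/-! ### Plancherel's inequality for integrable functions -/

section Plancherel

variable {V : Type*} [NormedAddCommGroup V] [InnerProductSpace ℝ V] [FiniteDimensional ℝ V]
  [MeasurableSpace V] [BorelSpace V]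

lemma integral_fourier_mul_eq_of_integrable {f g : V → ℂ} (hf : Integrable f)
    (hg : Integrable g) : ∫ ξ, 𝓕 f ξ * g ξ = ∫ x, f x * 𝓕 g x := by
  have := VectorFourier.integral_fourierIntegral_smul_eq_flip (L := innerₗ V) (μ := volume)
    (ν := volume) Real.continuous_fourierChar continuous_inner hf hg
  simp only [flip_innerₗ, smul_eq_mul] at this
  exact this

/-- Both transforms have the same pairing with every test function: one because the transform on L²
is compatible with that of tempered distributions, the other by Fubini. This carries Plancherel's
identity over to the integral transform on L¹ ∩ L². -/
lemma fourier_toLp_ae_eq {f : V → ℂ} (hf : Integrable f) (hf2 : MemLp f 2) :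
    (𝓕 (hf2.toLp f) : Lp ℂ 2 (volume : Measure V)) =ᵐ[volume] 𝓕 f := by
  have hc : Continuous (𝓕 f) := VectorFourier.fourierIntegral_continuous
    Real.continuous_fourierChar (by exact continuous_inner) hf
  refine ae_eq_of_integral_contDiff_smul_eq ?_ hc.locallyIntegrable ?_
  · exact (Lp.memLp _).locallyIntegrable (by norm_num)
  intro g hg hgs
  have hgs' : HasCompactSupport (fun x => (g x : ℂ)) := hgs.comp_left (g := fun r : ℝ => (r : ℂ)) rfl
  have hg' : ContDiff ℝ ∞ (fun x => (g x : ℂ)) := Complex.ofRealCLM.contDiff.comp hg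
  set φ : 𝓢(V, ℂ) := hgs'.toSchwartzMap hg' with hφ
  have hφg : ∀ x, φ x = (g x : ℂ) := fun x => rfl
  have h1 := congrArg (fun u => u φ) (Lp.fourier_toTemperedDistribution_eq (hf2.toLp f))
  simp only [TemperedDistribution.fourier_apply, Lp.toTemperedDistribution_apply] at h1
  have h2 := integral_fourier_mul_eq_of_integrable hf φ.integrable
  calc ∫ x, g x • (𝓕 (hf2.toLp f) : Lp ℂ 2 (volume : Measure V)) x
      = ∫ x, φ x • (𝓕 (hf2.toLp f) : Lp ℂ 2 (volume : Measure V)) x := by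
        simp [hφg]
    _ = ∫ x, 𝓕 φ x • (hf2.toLp f) x := h1.symm
    _ = ∫ x, f x * 𝓕 (φ : V → ℂ) x := by
        refine integral_congr_ae ?_
        filter_upwards [hf2.coeFn_toLp] with x hx
        rw [hx, SchwartzMap.fourier_coe, smul_eq_mul, mul_comm]
    _ = ∫ x, 𝓕 f x * φ x := h2.symm
    _ = ∫ x, g x • 𝓕 f x := by
        simp [hφg, mul_comm]

lemma eLpNorm_fourier_eq {f : V → ℂ} (hf : Integrable f) (hf2 : MemLp f 2) :
    eLpNorm (𝓕 f) 2 volume = eLpNorm f 2 volume := by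
  rw [← eLpNorm_congr_ae (fourier_toLp_ae_eq hf hf2), ← eLpNorm_congr_ae hf2.coeFn_toLp]
  have := Lp.norm_fourier_eq (hf2.toLp f)
  rw [Lp.norm_def, Lp.norm_def, ENNReal.toReal_eq_toReal_iff' (Lp.eLpNorm_ne_top _)
    (Lp.eLpNorm_ne_top _)] at this
  exact this

lemma lintegral_fourier_sq_eq {f : V → ℂ} (hf : Integrable f) (hf2 : MemLp f 2) :
    ∫⁻ ξ, ‖𝓕 f ξ‖ₑ ^ 2 = ∫⁻ x, ‖f x‖ₑ ^ 2 := by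
  have := eLpNorm_fourier_eq hf hf2
  simp only [eLpNorm_eq_lintegral_rpow_enorm_toReal (p := 2) (by norm_num) (by norm_num)] at this
  have h2 := congrArg (fun t : ENNReal => t ^ (2 : ℝ)) this
  simp only [← ENNReal.rpow_mul] at h2
  simpa using h2

end Plancherel

/-! ### Words of directions and multi-indices -/

section Words

variable {n : ℕ}

/-- The standard basis of `ℝⁿ × ℝⁿ`. -/
noncomputable def dir (n : ℕ) : Module.Basis (Fin n ⊕ Fin n) ℝ (Rn n × Rn n) :=
  (EuclideanSpace.basisFun (Fin n) ℝ).toBasis.prod (EuclideanSpace.basisFun (Fin n) ℝ).toBasis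

@[simp] lemma dir_inl (i : Fin n) : dir n (Sum.inl i) = (EuclideanSpace.single i (1 : ℝ), 0) := by
  ext <;> simp [dir]

@[simp] lemma dir_inr (i : Fin n) : dir n (Sum.inr i) = (0, EuclideanSpace.single i (1 : ℝ)) := by
  ext <;> simp [dir]

/-- A function of two variables as a function of the pair. -/
def unc (a : Rn n → Rn n → ℂ) : Rn n × Rn n → ℂ := fun p => a p.1 p.2

lemma unc_pdX {a : Rn n → Rn n → ℂ} (ha : ContDiff ℝ ∞ (unc a)) (i : Fin n) :
    unc (pdX i a) = dirD [dir n (Sum.inl i)] (unc a) := by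
  funext p
  have h1 : HasFDerivAt (fun y => unc a (y, p.2)) _ p.1 :=
    HasFDerivAt.comp (g := unc a) p.1 (ha.differentiable (by simp) (p.1, p.2)).hasFDerivAt
      (hasFDerivAt_prodMk_left (𝕜 := ℝ) p.1 p.2)
  simp only [dirD_cons, dirD_nil, dir_inl]
  change lineDeriv ℝ (fun y => unc a (y, p.2)) p.1 _ = _
  rw [h1.differentiableAt.lineDeriv_eq_fderiv, h1.fderiv]
  simp

lemma unc_pdXi {a : Rn n → Rn n → ℂ} (ha : ContDiff ℝ ∞ (unc a)) (i : Fin n) :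
    unc (pdXi i a) = dirD [dir n (Sum.inr i)] (unc a) := by
  funext p
  have h1 : HasFDerivAt (fun y => unc a (p.1, y)) _ p.2 :=
    HasFDerivAt.comp (g := unc a) p.2 (ha.differentiable (by simp) (p.1, p.2)).hasFDerivAt
      (hasFDerivAt_prodMk_right (𝕜 := ℝ) p.1 p.2)
  simp only [dirD_cons, dirD_nil, dir_inr]
  change lineDeriv ℝ (fun y => unc a (p.1, y)) p.2 _ = _
  rw [h1.differentiableAt.lineDeriv_eq_fderiv, h1.fderiv]
  simp

/-- Stated for an abstract family `D` so as to serve both ∂ₓ and ∂_ξ. Smoothness has to be carried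
along, because line derivatives are identified with Fréchet derivatives only for differentiable
functions. -/
lemma unc_foldr (D : Fin n → (Rn n → Rn n → ℂ) → Rn n → Rn n → ℂ) (v : Fin n → Rn n × Rn n)
    (hD : ∀ i a, ContDiff ℝ ∞ (unc a) → unc (D i a) = dirD [v i] (unc a)) (β : Fin n → ℕ)
    {a : Rn n → Rn n → ℂ} (ha : ContDiff ℝ ∞ (unc a)) (L : List (Fin n)) :
    unc (L.foldr (fun i b => (D i)^[β i] b) a) =
      dirD (L.flatMap fun i => List.replicate (β i) (v i)) (unc a) := by
  have h1 : ∀ i m {b : Rn n → Rn n → ℂ}, ContDiff ℝ ∞ (unc b) →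
      unc ((D i)^[m] b) = dirD (List.replicate m (v i)) (unc b) := by
    intro i m b hb
    induction m with
    | zero => rfl
    | succ m ih =>
      rw [Function.iterate_succ_apply', hD _ _ (by rw [ih]; exact contDiff_dirD hb _), ih]
      rfl
  induction L with
  | nil => rfl
  | cons i L ih =>
    rw [List.foldr_cons, h1 _ _ (by rw [ih]; exact contDiff_dirD ha _), ih, ← dirD_append,
      List.flatMap_cons]

/-- The word of a pair of multi-indices. -/
def wordOf (α β : Fin n → ℕ) : List (Fin n ⊕ Fin n) :=
  ((List.finRange n).flatMap fun i => List.replicate (α i) (Sum.inr i)) ++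
    ((List.finRange n).flatMap fun i => List.replicate (β i) (Sum.inl i))

lemma multi_eq_dirD {a : Rn n → Rn n → ℂ} (ha : ContDiff ℝ ∞ (unc a)) (α β : Fin n → ℕ)
    (x ξ : Rn n) :
    multiXi α (multiX β a) x ξ = dirD ((wordOf α β).map (dir n)) (unc a) (x, ξ) := by
  have h1 := unc_foldr pdX (fun i => dir n (Sum.inl i)) (fun i a ha => unc_pdX ha i) β ha
    (List.finRange n)
  change unc (multiX β a) = _ at h1
  have h2 := unc_foldr pdXi (fun i => dir n (Sum.inr i)) (fun i a ha => unc_pdXi ha i) α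
    (a := multiX β a) (by rw [h1]; exact contDiff_dirD ha _) (List.finRange n)
  change unc (multiXi α (multiX β a)) = _ at h2
  rw [h1, ← dirD_append] at h2
  have h3 := congrFun h2 (x, ξ)
  simp only [unc] at h3
  rw [h3, wordOf, List.map_append, List.map_flatMap, List.map_flatMap]
  simp [List.map_replicate]

/-- The multi-index of the derivatives in `x` of a word. -/
def cntX (w : List (Fin n ⊕ Fin n)) : Fin n → ℕ := fun i =>
  @List.count _ instBEqOfDecidableEq (Sum.inl i) w

/-- The multi-index of the derivatives in `ξ` of a word. -/
def cntXi (w : List (Fin n ⊕ Fin n)) : Fin n → ℕ := fun i =>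
  @List.count _ instBEqOfDecidableEq (Sum.inr i) w

lemma wordOf_perm (w : List (Fin n ⊕ Fin n)) : (wordOf (cntXi w) (cntX w)).Perm w := by
  rw [@List.perm_iff_count _ instBEqOfDecidableEq]
  rintro (i | i) <;>
  simp [wordOf, List.count_append, List.count_flatMap, Function.comp_def, List.count_replicate,
    cntX, cntXi, ← Fin.sum_univ_def]

lemma length_wordOf (α β : Fin n → ℕ) : (wordOf α β).length = len α + len β := by
  simp [wordOf, len, List.length_flatMap, Fin.sum_univ_def]

lemma len_cnt (w : List (Fin n ⊕ Fin n)) : len (cntXi w) + len (cntX w) = w.length := by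
  rw [← length_wordOf, (wordOf_perm w).length_eq]

/-! ### Symbol estimates in terms of words -/

lemma SymbolBound.contDiff {k : ℝ} {a : Rn n → Rn n → ℂ} {C : (Fin n → ℕ) → (Fin n → ℕ) → ℝ}
    (h : SymbolBound k a C) : ContDiff ℝ ∞ (unc a) := h.smooth

lemma SymbolBound.norm_dirD_le {k : ℝ} {a : Rn n → Rn n → ℂ}
    {C : (Fin n → ℕ) → (Fin n → ℕ) → ℝ} (h : SymbolBound k a C) (w : List (Fin n ⊕ Fin n))
    (p : Rn n × Rn n) :
    ‖dirD (w.map (dir n)) (unc a) p‖ ≤ C (cntXi w) (cntX w) * japBr p.2 ^ k := by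
  have := h.bound (cntXi w) (cntX w) p.1 p.2
  rwa [multi_eq_dirD h.contDiff, dirD_perm h.contDiff ((wordOf_perm w).map _)] at this

lemma SymbolBound.of_dirD {k : ℝ} {a : Rn n → Rn n → ℂ} {C : (Fin n → ℕ) → (Fin n → ℕ) → ℝ}
    (ha : ContDiff ℝ ∞ (unc a))
    (h : ∀ α β p, ‖dirD ((wordOf α β).map (dir n)) (unc a) p‖ ≤ C α β * japBr p.2 ^ k) :
    SymbolBound k a C := by
  refine ⟨ha, fun α β x ξ => ?_⟩
  rw [multi_eq_dirD ha]
  exact h α β (x, ξ)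

lemma one_le_japBr (ξ : Rn n) : 1 ≤ japBr ξ := by
  rw [japBr, Real.one_le_sqrt]
  nlinarith [sq_nonneg ‖ξ‖]

lemma japBr_pos (ξ : Rn n) : 0 < japBr ξ := zero_lt_one.trans_le (one_le_japBr ξ)

lemma norm_le_japBr (ξ : Rn n) : ‖ξ‖ ≤ japBr ξ :=
  Real.le_sqrt_of_sq_le (by linarith)

lemma SymbolBound.nonneg {k : ℝ} {a : Rn n → Rn n → ℂ} {C : (Fin n → ℕ) → (Fin n → ℕ) → ℝ}
    (h : SymbolBound k a C) (α β : Fin n → ℕ) : 0 ≤ C α β := by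
  have h1 := (norm_nonneg _).trans (h.bound α β 0 0)
  exact nonneg_of_mul_nonneg_left h1 (Real.rpow_pos_of_pos (japBr_pos _) _)

/-- A single summand of a sum with nonnegative terms; the half-integral power of h is a power of √h.
-/
lemma term_le_boundSum {s : ℕ} {h : ℝ} (hh : 0 ≤ h) {C : (Fin n → ℕ) → (Fin n → ℕ) → ℝ}
    (hC : ∀ α β, 0 ≤ C α β) (w : List (Fin n ⊕ Fin n)) (hw : w.length ≤ s) :
    √h ^ w.length * C (cntXi w) (cntX w) ≤ boundSum s h C := by
  have hl := len_cnt w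
  have h1 : √h ^ w.length = h ^ (((len (cntXi w) + len (cntX w) : ℕ) : ℝ) / 2) := by
    rw [hl, Real.sqrt_eq_rpow, ← Real.rpow_mul_natCast hh]
    congr 1
    ring
  rw [h1, boundSum]
  refine Finset.single_le_sum
    (f := fun p : (Fin n → ℕ) × (Fin n → ℕ) => h ^ (((len p.1 + len p.2 : ℕ) : ℝ) / 2) * C p.1 p.2)
    (fun p _ => mul_nonneg (Real.rpow_nonneg hh _) (hC _ _)) (a := (cntXi w, cntX w)) ?_
  simp only [Finset.mem_filter, Finset.mem_product, mem_multiIdx]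
  omega

lemma term_le_compSum {s : ℕ} {h : ℝ} (hh : 0 ≤ h) {C₁ C₂ : (Fin n → ℕ) → (Fin n → ℕ) → ℝ}
    (hC₁ : ∀ α β, 0 ≤ C₁ α β) (hC₂ : ∀ α β, 0 ≤ C₂ α β) (w₁ w₂ : List (Fin n ⊕ Fin n))
    (h₁ : 1 ≤ w₁.length) (h₂ : 1 ≤ w₂.length) (hw : w₁.length + w₂.length ≤ s) :
    √h ^ (w₁.length + w₂.length) * C₁ (cntXi w₁) (cntX w₁) * C₂ (cntXi w₂) (cntX w₂)
      ≤ compSum s h C₁ C₂ := by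
  have hl₁ := len_cnt w₁
  have hl₂ := len_cnt w₂
  have h1 : √h ^ (w₁.length + w₂.length) = h ^ (((len (cntXi w₁) + len (cntX w₁)
      + len (cntXi w₂) + len (cntX w₂) : ℕ) : ℝ) / 2) := by
    rw [hl₁, add_assoc, hl₂, Real.sqrt_eq_rpow, ← Real.rpow_mul_natCast hh]
    congr 1
    ring
  rw [h1, compSum]
  refine Finset.single_le_sum
    (f := fun p : ((Fin n → ℕ) × (Fin n → ℕ)) × ((Fin n → ℕ) × (Fin n → ℕ)) =>
      h ^ (((len p.1.1 + len p.1.2 + len p.2.1 + len p.2.2 : ℕ) : ℝ) / 2) *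
        C₁ p.1.1 p.1.2 * C₂ p.2.1 p.2.2)
    (fun p _ => mul_nonneg (mul_nonneg (Real.rpow_nonneg hh _) (hC₁ _ _)) (hC₂ _ _))
    (a := ((cntXi w₁, cntX w₁), (cntXi w₂, cntX w₂))) ?_
  simp only [Finset.mem_filter, Finset.mem_product, mem_multiIdx]
  omega

end Words

/-! ### Powers of the weight -/

section Weight

variable {n : ℕ}

/-- The function `⟨ξ⟩^r`. -/
noncomputable def japPow (n : ℕ) (r : ℝ) : Rn n → ℂ := fun ξ => ((japBr ξ ^ r : ℝ) : ℂ)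

lemma japPow_eq (r : ℝ) : japPow n r = fun ξ => (((1 + ‖ξ‖ ^ 2) ^ (r / 2) : ℝ) : ℂ) := by
  funext ξ
  rw [japPow, japBr, Real.sqrt_eq_rpow, ← Real.rpow_mul (by positivity)]
  congr 2
  ring

lemma norm_japPow (r : ℝ) (ξ : Rn n) : ‖japPow n r ξ‖ = japBr ξ ^ r := by
  rw [japPow, Complex.norm_real, Real.norm_of_nonneg (Real.rpow_nonneg (japBr_pos ξ).le _)]

lemma japPow_mul (r s : ℝ) (ξ : Rn n) : japPow n r ξ * japPow n s ξ = japPow n (r + s) ξ := by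
  simp only [japPow]
  rw [Real.rpow_add (japBr_pos ξ)]
  push_cast
  rfl

lemma contDiff_japPow (r : ℝ) : ContDiff ℝ ∞ (japPow n r) := by
  rw [japPow_eq]
  refine Complex.ofRealCLM.contDiff.comp ?_
  refine ContDiff.rpow_const_of_ne ?_ fun ξ => by positivity
  exact contDiff_const.add (contDiff_norm_sq ℝ)

lemma dirD_japPow (r : ℝ) (v : Rn n) :
    dirD [v] (japPow n r) = fun ξ => (r : ℂ) * (((inner ℝ v ξ : ℝ) : ℂ) * japPow n (r - 2) ξ) := by
  funext ξ
  have hpos : (0 : ℝ) < 1 + ‖ξ‖ ^ 2 := by positivity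
  have h1 : HasFDerivAt (fun ξ : Rn n => 1 + ‖ξ‖ ^ 2) (2 • innerSL ℝ ξ) ξ :=
    ((hasStrictFDerivAt_norm_sq ξ).hasFDerivAt).const_add 1
  have h2 := HasFDerivAt.comp ξ (Complex.ofRealCLM.hasFDerivAt (x := (1 + ‖ξ‖ ^ 2) ^ (r / 2)))
    (h1.rpow_const (p := r / 2) (Or.inl hpos.ne'))
  change HasFDerivAt (fun ξ : Rn n => (((1 + ‖ξ‖ ^ 2) ^ (r / 2) : ℝ) : ℂ)) _ ξ at h2
  rw [← japPow_eq] at h2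
  simp only [dirD_cons, dirD_nil]
  rw [h2.fderiv, japPow_eq]
  simp only [ContinuousLinearMap.comp_apply, smul_apply, innerSL_apply_apply,
    Complex.ofRealCLM_apply, smul_eq_mul, nsmul_eq_mul]
  rw [real_inner_comm, show (r - 2) / 2 = r / 2 - 1 by ring]
  push_cast
  ring

/-- A linear form becomes constant after one derivative. The induction is from the end of the word
because the last letter is the derivative applied first. -/
lemma norm_dirD_inner_le {J : Type*} (b : J → Rn n) {R : ℝ} (hb : ∀ j, ‖b j‖ ≤ R) (hR : 1 ≤ R)
    (v : Rn n) (hv : ‖v‖ ≤ R) (w : List J) (ξ : Rn n) :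
    ‖dirD (w.map b) (fun ξ : Rn n => ((inner ℝ v ξ : ℝ) : ℂ)) ξ‖ ≤ R ^ 2 * japBr ξ := by
  have hR2 : 0 ≤ R ^ 2 := sq_nonneg R
  have hRR : R ≤ R ^ 2 := by nlinarith
  have hlin : ∀ ξ, HasFDerivAt (fun ξ : Rn n => ((inner ℝ v ξ : ℝ) : ℂ))
      (Complex.ofRealCLM.comp (innerSL ℝ v)) ξ := fun ξ =>
    (Complex.ofRealCLM.comp (innerSL ℝ v)).hasFDerivAt
  induction w using List.reverseRecOn generalizing ξ with
  | nil =>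
    simp only [List.map_nil, dirD_nil, Complex.norm_real]
    refine (norm_inner_le_norm v ξ).trans ?_
    exact mul_le_mul (hv.trans hRR) (norm_le_japBr ξ) (norm_nonneg _) hR2
  | append_singleton w j ih =>
    rw [List.map_append, dirD_append, List.map_singleton]
    have : dirD [b j] (fun ξ : Rn n => ((inner ℝ v ξ : ℝ) : ℂ)) = fun _ => ((inner ℝ v (b j) : ℝ) : ℂ) := by
      funext ξ
      simp [dirD_cons, (hlin ξ).fderiv]
    rw [this]
    have hc : ∀ (w : List J) (c : ℂ), ‖dirD (w.map b) (fun _ : Rn n => c) ξ‖ ≤ ‖c‖ := by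
      intro w c
      rcases w with _ | ⟨i, w⟩
      · simp
      · suffices h : dirD ((i :: w).map b) (fun _ : Rn n => c) = fun _ => 0 by
          rw [h]; simp
        induction w generalizing i with
        | nil => funext; simp [dirD_cons]
        | cons i' w ihw =>
          funext ξ
          rw [List.map_cons, dirD_cons, ihw]
          simp
    refine (hc w _).trans ?_
    rw [Complex.norm_real]
    refine (norm_inner_le_norm v (b j)).trans ?_
    calc ‖v‖ * ‖b j‖ ≤ R * R := mul_le_mul hv (hb j) (norm_nonneg _) (by linarith)
      _ ≤ R ^ 2 * japBr ξ := by nlinarith [one_le_japBr ξ]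

/-- Induction on the number of derivatives, for all exponents at once: the first derivative of ⟨ξ⟩^r
is r⟨v,ξ⟩⟨ξ⟩^{r-2}, of growth r-1, and Leibniz handles the others. The gain of a power of ⟨ξ⟩ is
discarded, as the symbol classes here do not see it. -/
lemma exists_norm_dirD_japPow_le {J : Type*} (b : J → Rn n) {R : ℝ} (hb : ∀ j, ‖b j‖ ≤ R)
    (N : ℕ) (r : ℝ) :
    ∃ C : ℝ, 0 ≤ C ∧ ∀ w : List J, w.length ≤ N → ∀ ξ,
      ‖dirD (w.map b) (japPow n r) ξ‖ ≤ C * japBr ξ ^ r := by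
  wlog hR : 1 ≤ R generalizing R
  · exact this (R := max R 1) (fun j => (hb j).trans (le_max_left _ _)) (le_max_right _ _)
  induction N generalizing r with
  | zero =>
    refine ⟨1, zero_le_one, fun w hw ξ => ?_⟩
    rw [List.length_eq_zero_iff.1 (Nat.le_zero.1 hw)]
    simp [norm_japPow]
  | succ N ih =>
    obtain ⟨C, hC0, hC⟩ := ih (r - 2)
    -- The 1 serves the empty word. In the other term 2^N bounds the number of splittings, R² comes
    -- from the linear form and C from the exponent r-2.
    refine ⟨max 1 (|r| * (2 ^ N * (R ^ 2 * C))), by positivity, fun w hw ξ => ?_⟩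
    have hp : 0 ≤ japBr ξ ^ r := Real.rpow_nonneg (japBr_pos ξ).le _
    rcases List.eq_nil_or_concat w with rfl | ⟨w, j, rfl⟩
    · simp only [List.map_nil, dirD_nil, norm_japPow]
      exact le_mul_of_one_le_left hp (le_max_left _ _)
    · have hwN : w.length ≤ N := by simpa using hw
      have hcd : ContDiff ℝ ∞ (fun ξ : Rn n => ((inner ℝ (b j) ξ : ℝ) : ℂ)) :=
        (Complex.ofRealCLM.comp (innerSL ℝ (b j))).contDiff
      rw [List.concat_eq_append, List.map_append, dirD_append, List.map_singleton, dirD_japPow,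
        dirD_const_mul (hcd.mul (contDiff_japPow _)), norm_mul, Complex.norm_real, Real.norm_eq_abs]
      have hprod := norm_dirD_mul_le b hcd (contDiff_japPow (n := n) (r - 2)) w ξ
        (A := R ^ 2 * C * japBr ξ ^ r) ?_
      · calc |r| * _ ≤ |r| * (2 ^ w.length * (R ^ 2 * C * japBr ξ ^ r)) :=
              mul_le_mul_of_nonneg_left hprod (abs_nonneg _)
          _ ≤ |r| * (2 ^ N * (R ^ 2 * C * japBr ξ ^ r)) := by gcongr; norm_num
          _ = |r| * (2 ^ N * (R ^ 2 * C)) * japBr ξ ^ r := by ring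
          _ ≤ _ := mul_le_mul_of_nonneg_right (le_max_right _ _) hp
      · intro s hs
        have hl := length_of_mem_splits hs
        calc _ ≤ (R ^ 2 * japBr ξ) * (C * japBr ξ ^ (r - 2)) :=
              mul_le_mul (norm_dirD_inner_le b hb hR _ (hb j) _ ξ) (hC _ (by omega) ξ)
                (norm_nonneg _) (mul_nonneg (sq_nonneg R) (japBr_pos ξ).le)
          _ = R ^ 2 * C * japBr ξ ^ (r - 1) := by
              rw [show r - 1 = 1 + (r - 2) by ring, Real.rpow_add (japBr_pos ξ), Real.rpow_one]
              ring
          _ ≤ _ := by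
              refine mul_le_mul_of_nonneg_left ?_ (by positivity)
              exact Real.rpow_le_rpow_of_exponent_le (one_le_japBr ξ) (by linarith)

end Weight

/-! ### Localisation to unit cubes -/

section Localisation

variable {ι : Type*} [Fintype ι] [DecidableEq ι]

/-- Resampling one coordinate independently does not change a product of probability measures. It
lets a one-dimensional identity in the coordinate i be used under an integral over the whole cube.
-/
lemma measurePreserving_update (μ : ι → Measure ℝ) [∀ i, IsProbabilityMeasure (μ i)] (i : ι) :
    MeasurePreserving (fun p : (ι → ℝ) × ℝ => Function.update p.1 i p.2)
      ((Measure.pi μ).prod (μ i)) (Measure.pi μ) := by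
  have hm : Measurable (fun p : (ι → ℝ) × ℝ => Function.update p.1 i p.2) := by
    refine measurable_pi_iff.2 fun j => ?_
    by_cases hj : j = i
    · subst hj; simpa using measurable_snd
    · simpa [Function.update_of_ne hj, Function.comp_def] using
        (measurable_pi_apply j).comp measurable_fst
  refine ⟨hm, (Measure.pi_eq fun s hs => ?_).symm⟩
  rw [Measure.map_apply hm (MeasurableSet.univ_pi hs)]
  have hpre : (fun p : (ι → ℝ) × ℝ => Function.update p.1 i p.2) ⁻¹' (Set.univ.pi s)
      = (Set.univ.pi (Function.update s i Set.univ)) ×ˢ (s i) := by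
    ext p
    simp only [Set.mem_preimage, Set.mem_univ_pi, Set.mem_prod]
    constructor
    · intro h
      refine ⟨fun j => ?_, by simpa using h i⟩
      by_cases hj : j = i
      · subst hj; simp
      · simpa [Function.update_of_ne hj] using h j
    · rintro ⟨h1, h2⟩ j
      by_cases hj : j = i
      · subst hj; simpa using h2
      · simpa [Function.update_of_ne hj] using h1 j
  rw [hpre, Measure.prod_prod, Measure.pi_pi, ← Finset.mul_prod_erase Finset.univ _ (Finset.mem_univ i),
    ← Finset.mul_prod_erase Finset.univ (fun j => μ j (s j)) (Finset.mem_univ i)]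
  rw [Function.update_self, measure_univ, one_mul, mul_comm]
  congr 1
  refine Finset.prod_congr rfl fun j hj => ?_
  rw [Function.update_of_ne (Finset.ne_of_mem_erase hj)]

/-- The uniform measure on the unit cube. -/
noncomputable def cubeMeasure (ι : Type*) [Fintype ι] : Measure (ι → ℝ) :=
  Measure.pi fun _ => volume.restrict (Set.Icc (0 : ℝ) 1)

instance : IsProbabilityMeasure (volume.restrict (Set.Icc (0 : ℝ) 1)) := ⟨by simp⟩

instance : IsProbabilityMeasure (cubeMeasure ι) := by unfold cubeMeasure; infer_instance

lemma cubeMeasure_eq :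
    cubeMeasure ι = volume.restrict (Set.univ.pi fun _ => Set.Icc (0 : ℝ) 1) := by
  rw [cubeMeasure, volume_pi, Measure.restrict_pi_pi]

lemma integrable_cubeMeasure {H : (ι → ℝ) → ℂ} (hH : Continuous H) :
    Integrable H (cubeMeasure ι) := by
  rw [cubeMeasure_eq]
  exact hH.continuousOn.integrableOn_compact (isCompact_univ_pi fun _ => isCompact_Icc)

lemma integral_update {H : (ι → ℝ) → ℂ} (hH : Continuous H) (i : ι) :
    ∫ t, (∫ s in Set.Icc (0 : ℝ) 1, H (Function.update t i s)) ∂cubeMeasure ι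
      = ∫ t, H t ∂cubeMeasure ι := by
  have hmp := measurePreserving_update (fun _ : ι => volume.restrict (Set.Icc (0 : ℝ) 1)) i
  have hi : Integrable H (Measure.pi fun _ : ι => volume.restrict (Set.Icc (0 : ℝ) 1)) :=
    integrable_cubeMeasure hH
  have h1 := integral_map (φ := fun p : (ι → ℝ) × ℝ => Function.update p.1 i p.2)
    hmp.measurable.aemeasurable (f := H) (by rw [hmp.map_eq]; exact hi.aestronglyMeasurable)
  rw [hmp.map_eq, integral_prod] at h1
  · exact h1.symm
  · exact hmp.integrable_comp_of_integrable hi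

/-- The integrand is the derivative of (s-1) G(q + sv), which vanishes at s = 1 and equals -G(q) at
s = 0. -/
lemma eq_integral_Icc {P : Type*} [NormedAddCommGroup P] [NormedSpace ℝ P] {G : P → ℂ}
    (hG : ContDiff ℝ ∞ G) (q v : P) :
    G q = ∫ s in Set.Icc (0 : ℝ) 1, (G (q + s • v) + ((s : ℂ) - 1) * dirD [v] G (q + s • v)) := by
  have hd : ∀ s : ℝ, HasDerivAt (fun s : ℝ => ((s : ℂ) - 1) * G (q + s • v))
      (G (q + s • v) + ((s : ℂ) - 1) * dirD [v] G (q + s • v)) s := by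
    intro s
    have h1 : HasDerivAt (fun s : ℝ => q + s • v) v s := by
      simpa using ((hasDerivAt_id s).smul_const v).const_add q
    have h2 := (hG.differentiable (by simp) (q + s • v)).hasFDerivAt.comp_hasDerivAt s h1
    have h3 : HasDerivAt (fun s : ℝ => ((s : ℂ) - 1)) 1 s :=
      (Complex.ofRealCLM.hasDerivAt (x := s)).sub_const 1
    have h4 := h3.mul h2
    rw [one_mul] at h4
    exact h4
  have hcont : Continuous fun s : ℝ => G (q + s • v) + ((s : ℂ) - 1) * dirD [v] G (q + s • v) := by
    have hl : Continuous fun s : ℝ => q + s • v := by fun_prop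
    exact (hG.continuous.comp hl).add ((Complex.continuous_ofReal.sub continuous_const).mul
      ((continuous_dirD hG [v]).comp hl))
  have := intervalIntegral.integral_eq_sub_of_hasDerivAt (a := 0) (b := 1) (fun s _ => hd s)
    (hcont.intervalIntegrable 0 1)
  rw [integral_Icc_eq_integral_Ioc, ← intervalIntegral.integral_of_le zero_le_one, this]
  simp

/-- The one-dimensional identity is applied in each coordinate of `S₀`; the set `S` records where
the derivative term was chosen. Thus no direction is differentiated twice, which keeps the order at
n per group of variables. -/
lemma eq_sum_integral_cubeMeasure {P : Type*} [NormedAddCommGroup P] [NormedSpace ℝ P]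
    (e : ι → P) {f : P → ℂ} (hf : ContDiff ℝ ∞ f) (x : P) (S₀ : Finset ι) :
    f x = ∑ S ∈ S₀.powerset, ∫ t, (∏ i ∈ S, ((t i : ℂ) - 1)) *
      dirD (S.toList.map e) f (x + ∑ i ∈ S₀, t i • e i) ∂cubeMeasure ι := by
  induction S₀ using Finset.induction_on with
  | empty => simp
  | insert i S₀ hi ih =>
    rw [Finset.sum_powerset_insert hi, ← Finset.sum_add_distrib, ih]
    refine Finset.sum_congr rfl fun S hS => ?_
    have hSi : i ∉ S := fun h => hi (Finset.mem_powerset.1 hS h)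
    set G := dirD (S.toList.map e) f with hGdef
    have hG : ContDiff ℝ ∞ G := contDiff_dirD hf _
    have hGi : dirD ((insert i S).toList.map e) f = dirD [e i] G := by
      rw [dirD_perm hf ((Finset.toList_insert hSi).map e), List.map_cons, hGdef]
      rfl
    have hc1 : Continuous fun t : ι → ℝ => ∏ j ∈ S, ((t j : ℂ) - 1) := by fun_prop
    have hc2 : Continuous fun t : ι → ℝ => x + ∑ j ∈ insert i S₀, t j • e j := by fun_prop
    have hc3 : Continuous fun t : ι → ℝ => (∏ j ∈ S, ((t j : ℂ) - 1)) *
        (G (x + ∑ j ∈ insert i S₀, t j • e j)) := hc1.mul (hG.continuous.comp hc2)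
    have hc4 : Continuous fun t : ι → ℝ => (∏ j ∈ insert i S, ((t j : ℂ) - 1)) *
        (dirD [e i] G (x + ∑ j ∈ insert i S₀, t j • e j)) := by
      refine Continuous.mul (by fun_prop) ((continuous_dirD hG _).comp hc2)
    rw [hGi, ← integral_add (integrable_cubeMeasure hc3) (integrable_cubeMeasure hc4),
      -- The summands for S and for S ∪ {i} are combined, and the integral over t i is made
      -- explicit, so that the identity in the direction e i can be recognised in it.
      ← integral_update (H := fun t => (∏ j ∈ S, ((t j : ℂ) - 1)) *
        (G (x + ∑ j ∈ insert i S₀, t j • e j)) + (∏ j ∈ insert i S, ((t j : ℂ) - 1)) *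
        (dirD [e i] G (x + ∑ j ∈ insert i S₀, t j • e j))) (hc3.add hc4) i]
    refine integral_congr_ae (Filter.Eventually.of_forall fun t => ?_)
    have hs : ∀ s : ℝ, x + ∑ j ∈ insert i S₀, (Function.update t i s) j • e j
        = (x + ∑ j ∈ S₀, t j • e j) + s • e i := by
      intro s
      rw [Finset.sum_insert hi, Function.update_self, add_assoc, add_comm (s • e i)]
      congr 2
      refine Finset.sum_congr rfl fun j hj => ?_
      rw [Function.update_of_ne (fun h : j = i => hi (h ▸ hj))]
    have hp : ∀ s : ℝ, ∏ j ∈ S, (((Function.update t i s) j : ℂ) - 1) = ∏ j ∈ S, ((t j : ℂ) - 1) := by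
      intro s
      refine Finset.prod_congr rfl fun j hj => ?_
      rw [Function.update_of_ne (fun h : j = i => hSi (h ▸ hj))]
    simp only [hs, Finset.prod_insert hSi, hp, Function.update_self]
    rw [eq_integral_Icc hG (x + ∑ j ∈ S₀, t j • e j) (e i), ← integral_const_mul]
    refine integral_congr_ae (Filter.Eventually.of_forall fun s => ?_)
    simp only []
    ring

/-- The unit cube in `ℝⁿ`. -/
def cube (n : ℕ) : Set (Rn n) := {τ | ∀ i, τ i ∈ Set.Icc (0 : ℝ) 1}

lemma measurableSet_cube (n : ℕ) : MeasurableSet (cube n) := by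
  have : cube n = ⋂ i, (fun τ : Rn n => τ i) ⁻¹' Set.Icc (0 : ℝ) 1 := by ext; simp [cube]
  rw [this]
  exact MeasurableSet.iInter fun i =>
    (EuclideanSpace.proj (𝕜 := ℝ) i).continuous.measurable measurableSet_Icc

lemma integral_cube {n : ℕ} (H : Rn n → ℂ) :
    ∫ τ in cube n, H τ = ∫ t, H (WithLp.toLp 2 t) ∂cubeMeasure (Fin n) := by
  rw [cubeMeasure_eq]
  have := (EuclideanSpace.volume_preserving_symm_measurableEquiv_toLp (Fin n)).symm
  rw [← this.setIntegral_preimage_emb (MeasurableEquiv.measurableEmbedding _)]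
  congr 2
  ext t
  simp only [cube, Set.mem_preimage, Set.mem_ofPred_eq, Set.mem_univ_pi]
  rfl

instance (n : ℕ) : IsProbabilityMeasure (volume.restrict (cube n)) := by
  refine ⟨?_⟩
  have h := (EuclideanSpace.volume_preserving_symm_measurableEquiv_toLp (Fin n)).symm
  rw [Measure.restrict_apply_univ, ← h.measure_preimage_equiv]
  have : (MeasurableEquiv.toLp 2 (Fin n → ℝ)).symm.symm ⁻¹' cube n
      = Set.univ.pi fun _ => Set.Icc (0 : ℝ) 1 := by
    ext t
    simp only [cube, Set.mem_preimage, Set.mem_ofPred_eq, Set.mem_univ_pi]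
    rfl
  rw [this, volume_pi_pi]
  simp

lemma eq_sum_integral_cube {n : ℕ} {P : Type*} [NormedAddCommGroup P] [NormedSpace ℝ P]
    (L : Rn n →L[ℝ] P) {f : P → ℂ} (hf : ContDiff ℝ ∞ f) (x : P) :
    f x = ∑ S : Finset (Fin n), ∫ τ in cube n, (∏ i ∈ S, ((τ i : ℂ) - 1)) *
      dirD (S.toList.map fun i => L (EuclideanSpace.single i 1)) f (x + L τ) := by
  have h := eq_sum_integral_cubeMeasure (fun i => L (EuclideanSpace.single i (1 : ℝ))) hf x
    Finset.univ
  rw [h, Finset.powerset_univ]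
  refine Finset.sum_congr rfl fun S _ => ?_
  rw [integral_cube]
  refine integral_congr_ae (Filter.Eventually.of_forall fun t => ?_)
  have : L (WithLp.toLp 2 t) = ∑ i, t i • L (EuclideanSpace.single i (1 : ℝ)) := by
    conv_lhs => rw [← (EuclideanSpace.basisFun (Fin n) ℝ).sum_repr (WithLp.toLp 2 t)]
    simp
  simp only [this]

end Localisation

/-! ### The character `e^{2πit}` -/

/-- The character `e^{2πit}`. -/
noncomputable def ee (t : ℝ) : ℂ := Complex.exp (((2 * π * t : ℝ) : ℂ) * Complex.I)

lemma ee_add (s t : ℝ) : ee (s + t) = ee s * ee t := by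
  simp only [ee, ← Complex.exp_add]; congr 1; push_cast; ring

@[simp] lemma ee_zero : ee 0 = 1 := by simp [ee]

@[simp] lemma norm_ee (t : ℝ) : ‖ee t‖ = 1 := Complex.norm_exp_ofReal_mul_I _

@[simp] lemma enorm_ee (t : ℝ) : ‖ee t‖ₑ = 1 := by
  rw [← ofReal_norm, norm_ee, ENNReal.ofReal_one]

lemma contDiff_ee : ContDiff ℝ ∞ ee :=
  ((Complex.ofRealCLM.contDiff.comp (contDiff_const.mul contDiff_id)).mul contDiff_const).cexp

@[fun_prop] lemma continuous_ee : Continuous ee := contDiff_ee.continuous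

section Fourier

variable {V : Type*} [NormedAddCommGroup V] [InnerProductSpace ℝ V] [FiniteDimensional ℝ V]
  [MeasurableSpace V] [BorelSpace V]

lemma fourier_ee (f : V → ℂ) (w : V) : 𝓕 f w = ∫ v, ee (-inner ℝ v w) * f v := by
  rw [Real.fourier_eq']
  refine integral_congr_ae (Filter.Eventually.of_forall fun v => ?_)
  simp only [ee, smul_eq_mul]
  congr 4
  ring

lemma fourierInv_ee (f : V → ℂ) (w : V) : 𝓕⁻ f w = ∫ v, ee (inner ℝ v w) * f v := by
  rw [Real.fourierInv_eq']
  refine integral_congr_ae (Filter.Eventually.of_forall fun v => ?_)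
  simp only [ee, smul_eq_mul]

end Fourier

/-! ### Short-time Fourier transforms with windows supported in the unit cube -/

section STFT

variable {n : ℕ}

/-- The Fourier transform of `τ ↦ g(τ) v(z - τ)`. -/
noncomputable def stft (g v : Rn n → ℂ) (z ζ : Rn n) : ℂ := 𝓕 (fun τ => g τ * v (z - τ)) ζ

lemma norm_mul_comp_sub_le {g v : Rn n → ℂ} (hg1 : ∀ τ, ‖g τ‖ ≤ 1) (z τ : Rn n) :
    ‖g τ * v (z - τ)‖ ≤ ‖v (z - τ)‖ := by
  rw [norm_mul]
  exact mul_le_of_le_one_left (norm_nonneg _) (hg1 τ)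

lemma integrable_mul_comp_sub {g v : Rn n → ℂ} (hg : Measurable g) (hg1 : ∀ τ, ‖g τ‖ ≤ 1)
    (hv : Integrable v) (z : Rn n) : Integrable fun τ => g τ * v (z - τ) :=
  (hv.comp_sub_left z).mono (hg.aestronglyMeasurable.mul (hv.comp_sub_left z).aestronglyMeasurable)
    (Filter.Eventually.of_forall fun τ => norm_mul_comp_sub_le hg1 z τ)

lemma measurable_stft {g v : Rn n → ℂ} (hg : Measurable g) (hv : Measurable v) :
    Measurable fun p : Rn n × Rn n => stft g v p.1 p.2 := by
  have h1 : (fun p : Rn n × Rn n => stft g v p.1 p.2) =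
      fun p => ∫ τ, ee (-inner ℝ τ p.2) * (g τ * v (p.1 - τ)) := by
    funext p; rw [stft, fourier_ee]
  rw [h1]
  have h2 : Measurable fun r : (Rn n × Rn n) × Rn n =>
      ee (-inner ℝ r.2 r.1.2) * (g r.2 * v (r.1.1 - r.2)) := by
    refine Measurable.mul ?_ ((hg.comp measurable_snd).mul
      (hv.comp (measurable_fst.fst.sub measurable_snd)))
    exact (continuous_ee.comp (by fun_prop)).measurable
  exact (h2.stronglyMeasurable.integral_prod_right (ν := volume)).measurable

lemma measurable_stft_comp {α : Type*} [MeasurableSpace α] {g v : Rn n → ℂ} (hg : Measurable g)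
    (hv : Measurable v) {z ζ : α → Rn n} (hz : Measurable z) (hζ : Measurable ζ) :
    Measurable fun r => ‖stft g v (z r) (ζ r)‖ₑ := by
  have h := (measurable_stft hg hv).comp (hz.prodMk hζ)
  exact h.enorm

/-- Plancherel in ζ for fixed z, then Tonelli: the integral in z gives the norm of v, and that of
|g|² in τ is at most the volume 1 of the cube. -/
lemma lintegral_stft_sq_le {g v : Rn n → ℂ} (hg : Measurable g)
    (hg1 : ∀ τ, ‖g τ‖ ≤ (cube n).indicator 1 τ) (hv : Measurable v) (hvi : Integrable v)
    (hv2 : MemLp v 2) :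
    ∫⁻ z, ∫⁻ ζ, ‖stft g v z ζ‖ₑ ^ 2 ≤ ∫⁻ x, ‖v x‖ₑ ^ 2 := by
  have hg1' : ∀ τ, ‖g τ‖ ≤ 1 := fun τ =>
    (hg1 τ).trans (Set.indicator_le_self' (fun _ _ => zero_le_one) τ)
  have h1 : ∀ z, ∫⁻ ζ, ‖stft g v z ζ‖ₑ ^ 2 = ∫⁻ τ, ‖g τ * v (z - τ)‖ₑ ^ 2 := by
    intro z
    refine lintegral_fourier_sq_eq (integrable_mul_comp_sub hg hg1' hvi z) ?_
    have h2 : MemLp (fun τ => v (z - τ)) 2 :=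
      hv2.comp_measurePreserving (Measure.measurePreserving_sub_left volume z)
    exact h2.mono (hg.aestronglyMeasurable.mul h2.aestronglyMeasurable)
      (Filter.Eventually.of_forall fun τ => norm_mul_comp_sub_le hg1' z τ)
  simp only [h1]
  rw [lintegral_lintegral_swap]
  · have h3 : ∀ τ, ∫⁻ z, ‖g τ * v (z - τ)‖ₑ ^ 2 = ‖g τ‖ₑ ^ 2 * ∫⁻ x, ‖v x‖ₑ ^ 2 := by
      intro τ
      simp only [enorm_mul, mul_pow]
      rw [lintegral_const_mul _ (by fun_prop), lintegral_sub_right_eq_self (fun x => ‖v x‖ₑ ^ 2) τ]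
    simp only [h3]
    rw [lintegral_mul_const _ (by fun_prop)]
    refine mul_le_of_le_one_left zero_le ?_
    calc ∫⁻ τ, ‖g τ‖ₑ ^ 2 ≤ ∫⁻ τ, (cube n).indicator 1 τ := by
          refine lintegral_mono fun τ => ?_
          by_cases hτ : τ ∈ cube n
          · have h4 : ‖g τ‖ₑ ≤ 1 := by
              rw [← ofReal_norm]
              exact ENNReal.ofReal_le_one.2 (hg1' τ)
            simpa [hτ] using pow_le_one₀ zero_le h4
          · have h4 := hg1 τ
            rw [Set.indicator_of_notMem hτ, norm_le_zero_iff] at h4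
            simp [h4]
      _ = 1 := by
          rw [lintegral_indicator_one (measurableSet_cube n)]
          have := measure_univ (μ := volume.restrict (cube n))
          rwa [Measure.restrict_apply_univ] at this
  · refine Measurable.aemeasurable ?_
    refine Measurable.pow_const (Measurable.enorm ?_) 2
    exact (hg.comp measurable_snd).mul (hv.comp (measurable_fst.sub measurable_snd))

/-- Cauchy–Schwarz for two short-time Fourier transforms with exchanged variables. -/
lemma lintegral_stft_mul_stft_le {g₁ g₂ v U : Rn n → ℂ} (hg₁ : Measurable g₁)
    (hg₁' : ∀ τ, ‖g₁ τ‖ ≤ (cube n).indicator 1 τ) (hg₂ : Measurable g₂)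
    (hg₂' : ∀ τ, ‖g₂ τ‖ ≤ (cube n).indicator 1 τ)
    (hv : Measurable v) (hvi : Integrable v) (hv2 : MemLp v 2)
    (hU : Measurable U) (hUi : Integrable U) (hU2 : MemLp U 2) (y : Rn n) :
    ∫⁻ p : Rn n × Rn n, ‖stft g₁ v p.1 (p.2 - y)‖ₑ * ‖stft g₂ U p.2 (p.1 - y)‖ₑ ≤
      (∫⁻ x, ‖v x‖ₑ ^ 2) ^ (1 / 2 : ℝ) * (∫⁻ x, ‖U x‖ₑ ^ 2) ^ (1 / 2 : ℝ) := by
  have hm1 : Measurable fun p : Rn n × Rn n => ‖stft g₁ v p.1 (p.2 - y)‖ₑ :=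
    ((measurable_stft hg₁ hv).comp
      (measurable_fst.prodMk (measurable_snd.sub measurable_const))).enorm
  have hm2 : Measurable fun p : Rn n × Rn n => ‖stft g₂ U p.2 (p.1 - y)‖ₑ :=
    ((measurable_stft hg₂ hU).comp
      (measurable_snd.prodMk (measurable_fst.sub measurable_const))).enorm
  have hCS := ENNReal.lintegral_mul_le_Lp_mul_Lq (volume : Measure (Rn n × Rn n))
    (Real.HolderConjugate.two_two) hm1.aemeasurable hm2.aemeasurable
  refine hCS.trans ?_
  have e1 : ∫⁻ p : Rn n × Rn n, ‖stft g₁ v p.1 (p.2 - y)‖ₑ ^ (2 : ℝ) ≤ ∫⁻ x, ‖v x‖ₑ ^ 2 := by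
    simp only [ENNReal.rpow_two]
    rw [Measure.volume_eq_prod, lintegral_prod _ (hm1.pow_const 2).aemeasurable]
    refine le_trans (le_of_eq ?_) (lintegral_stft_sq_le hg₁ hg₁' hv hvi hv2)
    refine lintegral_congr fun z => ?_
    exact lintegral_sub_right_eq_self (fun ζ => ‖stft g₁ v z ζ‖ₑ ^ 2) y
  have e2 : ∫⁻ p : Rn n × Rn n, ‖stft g₂ U p.2 (p.1 - y)‖ₑ ^ (2 : ℝ) ≤ ∫⁻ x, ‖U x‖ₑ ^ 2 := by
    -- The variables play exchanged roles: for U the second variable is the position and the first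
    -- the frequency, so the product integral is taken in the other order.
    simp only [ENNReal.rpow_two]
    rw [Measure.volume_eq_prod, lintegral_prod_symm _ (hm2.pow_const 2).aemeasurable]
    refine le_trans (le_of_eq ?_) (lintegral_stft_sq_le hg₂ hg₂' hU hUi hU2)
    refine lintegral_congr fun z => ?_
    exact lintegral_sub_right_eq_self (fun ζ => ‖stft g₂ U z ζ‖ₑ ^ 2) y
  gcongr

lemma norm_le_of_mem_cube {τ : Rn n} (hτ : τ ∈ cube n) : ‖τ‖ ≤ √n := by
  rw [EuclideanSpace.norm_eq]
  refine Real.sqrt_le_sqrt ?_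
  calc ∑ i, ‖τ i‖ ^ 2 ≤ ∑ _i : Fin n, (1 : ℝ) := Finset.sum_le_sum fun i _ => by
        have h1 := (hτ i).1
        have h2 := (hτ i).2
        rw [Real.norm_of_nonneg h1]
        nlinarith
    _ = n := by simp

/-- On the unit cube `e^{2πi⟨τ, θ⟩}` is a superposition of products of functions of `τ` and of `θ`,
with a rapidly decreasing density. -/
lemma exists_schwartz_ee_inner (n : ℕ) :
    ∃ φ : 𝓢(Rn n, ℂ), ∀ τ ∈ cube n, ∀ θ ∈ cube n,
      ee (inner ℝ τ θ) = ee (-(‖τ‖ ^ 2 / 2)) * ee (-(‖θ‖ ^ 2 / 2)) *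
        ∫ y, φ y * (ee (inner ℝ τ y) * ee (inner ℝ θ y)) := by
  -- By polarisation ⟨τ,θ⟩ = (|τ+θ|² - |τ|² - |θ|²)/2, so only the chirp in τ+θ couples the
  -- variables. Points of the cube have norm at most √n, hence χ = 1 at τ+θ; the extra 1 keeps the
  -- radius positive when n = 0.
  let χ : ContDiffBump (0 : Rn n) := ⟨2 * √n + 1, 2 * √n + 2, by positivity, by linarith⟩
  have hχs : HasCompactSupport (fun u : Rn n => ((χ u : ℝ) : ℂ) * ee (‖u‖ ^ 2 / 2)) :=
    (χ.hasCompactSupport.comp_left (g := fun r : ℝ => (r : ℂ)) rfl).mul_right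
  have hχc : ContDiff ℝ ∞ (fun u : Rn n => ((χ u : ℝ) : ℂ) * ee (‖u‖ ^ 2 / 2)) :=
    (Complex.ofRealCLM.contDiff.comp χ.contDiff).mul
      (contDiff_ee.comp ((contDiff_norm_sq ℝ).div_const 2))
  let ψ : 𝓢(Rn n, ℂ) := hχs.toSchwartzMap hχc
  have hψ : ∀ u, ψ u = ((χ u : ℝ) : ℂ) * ee (‖u‖ ^ 2 / 2) := fun u => rfl
  refine ⟨𝓕 ψ, fun τ hτ θ hθ => ?_⟩
  have h1 : χ (τ + θ) = 1 := by
    refine χ.one_of_mem_closedBall ?_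
    rw [mem_closedBall_zero_iff]
    refine (norm_add_le _ _).trans ?_
    have := norm_le_of_mem_cube hτ
    have := norm_le_of_mem_cube hθ
    change _ ≤ 2 * √n + 1
    linarith
  have h2 : ψ (τ + θ) = ∫ y, (𝓕 ψ) y * (ee (inner ℝ τ y) * ee (inner ℝ θ y)) := by
    have h3 : 𝓕⁻ (𝓕 ψ) = ψ := FourierTransform.fourierInv_fourier_eq ψ
    have h4 := congrArg (fun f : 𝓢(Rn n, ℂ) => f (τ + θ)) h3
    simp only [SchwartzMap.fourierInv_coe, fourierInv_ee] at h4
    rw [← h4]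
    refine integral_congr_ae (Filter.Eventually.of_forall fun y => ?_)
    simp only []
    rw [real_inner_comm, inner_add_left, ee_add]
    ring
  rw [← h2, hψ, h1, Complex.ofReal_one, one_mul, ← ee_add, ← ee_add]
  congr 1
  rw [norm_add_sq_real]
  ring

end STFT

/-! ### A bilinear form of the Calderón–Vaillancourt theorem -/

section CalderonVaillancourt

variable {n : ℕ}

/-- The monomial weight of the localisation to the unit cube. -/
noncomputable def cubeWeight (S : Finset (Fin n)) (τ : Rn n) : ℂ := ∏ i ∈ S, ((τ i : ℂ) - 1)

@[fun_prop] lemma continuous_cubeWeight (S : Finset (Fin n)) : Continuous (cubeWeight S) := by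
  unfold cubeWeight; fun_prop

lemma norm_cubeWeight_le (S : Finset (Fin n)) {τ : Rn n} (hτ : τ ∈ cube n) :
    ‖cubeWeight S τ‖ ≤ 1 := by
  rw [cubeWeight, norm_prod]
  refine Finset.prod_le_one (fun _ _ => norm_nonneg _) fun i _ => ?_
  have h : ((τ i : ℂ) - 1) = ((τ i - 1 : ℝ) : ℂ) := by push_cast; rfl
  rw [h, Complex.norm_real, Real.norm_eq_abs, abs_le]
  have := (hτ i).1
  have := (hτ i).2
  constructor <;> linarith

/-- The window of the localisation to the unit cube, with a chirp. -/
noncomputable def cubeWindow (S : Finset (Fin n)) : Rn n → ℂ :=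
  (cube n).indicator fun τ => cubeWeight S τ * ee (-(‖τ‖ ^ 2 / 2))

lemma measurable_cubeWindow (S : Finset (Fin n)) : Measurable (cubeWindow S) := by
  refine Measurable.indicator ?_ (measurableSet_cube n)
  exact Continuous.measurable (by fun_prop)

lemma norm_cubeWindow_le (S : Finset (Fin n)) (τ : Rn n) :
    ‖cubeWindow S τ‖ ≤ (cube n).indicator 1 τ := by
  by_cases hτ : τ ∈ cube n
  · simpa [cubeWindow, hτ] using norm_cubeWeight_le S hτ
  · simp [cubeWindow, hτ]

/-- The uniform probability measure on the product of two unit cubes. -/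
noncomputable def cube2 (n : ℕ) : Measure (Rn n × Rn n) :=
  (volume.restrict (cube n)).prod (volume.restrict (cube n))

instance (n : ℕ) : IsProbabilityMeasure (cube2 n) := by unfold cube2; infer_instance

lemma cube2_eq (n : ℕ) : cube2 n = volume.restrict (cube n ×ˢ cube n) := by
  rw [cube2, Measure.prod_restrict, Measure.volume_eq_prod]

lemma ae_cube2 (n : ℕ) : ∀ᵐ t ∂cube2 n, t.1 ∈ cube n ∧ t.2 ∈ cube n := by
  rw [cube2_eq]
  exact ae_restrict_mem ((measurableSet_cube n).prod (measurableSet_cube n))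

/-- The kernel `v(x) U(η) e^{2πi⟨x, η⟩}`. -/
noncomputable def phaseKernel (v U : Rn n → ℂ) (p : Rn n × Rn n) : ℂ :=
  v p.1 * U p.2 * ee (inner ℝ p.1 p.2)

lemma integrable_phaseKernel {v U : Rn n → ℂ} (hvi : Integrable v) (hUi : Integrable U) :
    Integrable (phaseKernel v U) := by
  have h1 : Integrable (fun p : Rn n × Rn n => v p.1 * U p.2) := hvi.mul_prod hUi
  refine h1.mono (h1.aestronglyMeasurable.mul ?_) ?_
  · exact (continuous_ee.comp (by fun_prop)).aestronglyMeasurable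
  · exact Filter.Eventually.of_forall fun p => by simp [phaseKernel]

/-- Expand ⟨x-τ, η-θ⟩ = ⟨x,η⟩ - ⟨τ,η⟩ - ⟨θ,x⟩ + ⟨τ,θ⟩. The two middle terms are the Fourier
characters in τ and θ; the last one is decoupled by φ, at the price of a shift of both frequencies
by y. The chirps are absorbed in `cubeWindow`. -/
lemma integral_cube2_phaseKernel {φ : 𝓢(Rn n, ℂ)} (hφ : ∀ τ ∈ cube n, ∀ θ ∈ cube n,
      ee (inner ℝ τ θ) = ee (-(‖τ‖ ^ 2 / 2)) * ee (-(‖θ‖ ^ 2 / 2)) *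
        ∫ y, φ y * (ee (inner ℝ τ y) * ee (inner ℝ θ y)))
    (S T : Finset (Fin n)) {v U : Rn n → ℂ} (hvi : Integrable v) (hUi : Integrable U)
    (p : Rn n × Rn n) :
    ∫ t, cubeWeight S t.1 * cubeWeight T t.2 * phaseKernel v U (p - t) ∂cube2 n =
      ee (inner ℝ p.1 p.2) * ∫ y, φ y * (stft (cubeWindow S) v p.1 (p.2 - y) *
        stft (cubeWindow T) U p.2 (p.1 - y)) := by
  have hb : ∀ (S : Finset (Fin n)) τ, ‖cubeWindow S τ‖ ≤ 1 := fun S τ =>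
    (norm_cubeWindow_le S τ).trans (Set.indicator_le_self' (fun _ _ => zero_le_one) τ)
  have hA := integrable_mul_comp_sub (measurable_cubeWindow S) (hb S) hvi p.1
  have hB := integrable_mul_comp_sub (measurable_cubeWindow T) (hb T) hUi p.2
  set A : Rn n → ℂ := fun τ => cubeWindow S τ * v (p.1 - τ) with hAdef
  set B : Rn n → ℂ := fun θ => cubeWindow T θ * U (p.2 - θ) with hBdef
  have h1 : ∀ y, φ y * (stft (cubeWindow S) v p.1 (p.2 - y) *
        stft (cubeWindow T) U p.2 (p.1 - y)) =
      ∫ t : Rn n × Rn n, φ y * ((ee (-inner ℝ t.1 (p.2 - y)) * A t.1) *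
        (ee (-inner ℝ t.2 (p.1 - y)) * B t.2)) := by
    intro y
    rw [integral_const_mul, stft, stft, fourier_ee, fourier_ee, Measure.volume_eq_prod,
      integral_prod_mul (fun τ => ee (-inner ℝ τ (p.2 - y)) * A τ)
        (fun θ => ee (-inner ℝ θ (p.1 - y)) * B θ)]
  simp only [h1]
  have hint : Integrable (fun r : Rn n × (Rn n × Rn n) =>
      φ r.1 * ((ee (-inner ℝ r.2.1 (p.2 - r.1)) * A r.2.1) *
        (ee (-inner ℝ r.2.2 (p.1 - r.1)) * B r.2.2)))
      ((volume : Measure (Rn n)).prod (volume : Measure (Rn n × Rn n))) := by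
    have h2 : Integrable (fun r : Rn n × (Rn n × Rn n) => φ r.1 * (A r.2.1 * B r.2.2))
        ((volume : Measure (Rn n)).prod (volume : Measure (Rn n × Rn n))) :=
      φ.integrable.mul_prod (hA.mul_prod hB)
    have h3 : Continuous fun r : Rn n × (Rn n × Rn n) =>
        ee (-inner ℝ r.2.1 (p.2 - r.1)) * ee (-inner ℝ r.2.2 (p.1 - r.1)) := by fun_prop
    refine (h2.bdd_mul (c := 1) h3.aestronglyMeasurable
      (Filter.Eventually.of_forall fun r => by simp)).congr
      (Filter.Eventually.of_forall fun r => ?_)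
    simp only []
    ring
  rw [integral_integral_swap hint, ← integral_const_mul, cube2_eq,
    ← integral_indicator ((measurableSet_cube n).prod (measurableSet_cube n))]
  refine integral_congr_ae (Filter.Eventually.of_forall fun t => ?_)
  simp only []
  by_cases ht : t ∈ cube n ×ˢ cube n
  · rw [Set.indicator_of_mem ht]
    have h4 : ∀ y, φ y * ((ee (-inner ℝ t.1 (p.2 - y)) * A t.1) *
        (ee (-inner ℝ t.2 (p.1 - y)) * B t.2)) =
        (ee (-inner ℝ t.1 p.2) * ee (-inner ℝ t.2 p.1) * A t.1 * B t.2) *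
          (φ y * (ee (inner ℝ t.1 y) * ee (inner ℝ t.2 y))) := by
      intro y
      rw [inner_sub_right, inner_sub_right, neg_sub, neg_sub, sub_eq_add_neg, sub_eq_add_neg,
        ee_add, ee_add]
      ring
    simp only [h4]
    rw [integral_const_mul]
    have h5 := hφ t.1 ht.1 t.2 ht.2
    have h6 : inner ℝ (p - t).1 (p - t).2 =
        inner ℝ p.1 p.2 + -inner ℝ t.1 p.2 + -inner ℝ t.2 p.1 + inner ℝ t.1 t.2 := by
      simp only [Prod.fst_sub, Prod.snd_sub, inner_sub_left, inner_sub_right]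
      rw [real_inner_comm t.2 p.1]
      ring
    rw [phaseKernel, h6, ee_add, ee_add, ee_add, h5, hAdef, hBdef]
    simp only [cubeWindow, Set.indicator_of_mem ht.1, Set.indicator_of_mem ht.2, Prod.fst_sub,
      Prod.snd_sub]
    ring
  · rw [Set.indicator_of_notMem ht]
    have h4 : A t.1 * B t.2 = 0 := by
      rw [Set.mem_prod, not_and_or] at ht
      rcases ht with ht | ht
      · simp [hAdef, cubeWindow, ht]
      · simp [hBdef, cubeWindow, ht]
    have h5 : ∀ y, φ y * ((ee (-inner ℝ t.1 (p.2 - y)) * A t.1) *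
        (ee (-inner ℝ t.2 (p.1 - y)) * B t.2)) = 0 := by
      intro y
      linear_combination (φ y * ee (-inner ℝ t.1 (p.2 - y)) * ee (-inner ℝ t.2 (p.1 - y))) * h4
    simp [h5]

lemma lintegral_cube2_phaseKernel_le {φ : 𝓢(Rn n, ℂ)} (hφ : ∀ τ ∈ cube n, ∀ θ ∈ cube n,
      ee (inner ℝ τ θ) = ee (-(‖τ‖ ^ 2 / 2)) * ee (-(‖θ‖ ^ 2 / 2)) *
        ∫ y, φ y * (ee (inner ℝ τ y) * ee (inner ℝ θ y)))
    (S T : Finset (Fin n)) {v U : Rn n → ℂ}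
    (hv : Measurable v) (hvi : Integrable v) (hv2 : MemLp v 2)
    (hU : Measurable U) (hUi : Integrable U) (hU2 : MemLp U 2) :
    ∫⁻ p, ‖∫ t, cubeWeight S t.1 * cubeWeight T t.2 * phaseKernel v U (p - t) ∂cube2 n‖ₑ ≤
      (∫⁻ y, ‖φ y‖ₑ) *
        ((∫⁻ x, ‖v x‖ₑ ^ 2) ^ (1 / 2 : ℝ) * (∫⁻ x, ‖U x‖ₑ ^ 2) ^ (1 / 2 : ℝ)) := by
  have hm1 : Measurable fun r : (Rn n × Rn n) × Rn n =>
      ‖stft (cubeWindow S) v r.1.1 (r.1.2 - r.2)‖ₑ :=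
    measurable_stft_comp (measurable_cubeWindow S) hv (by fun_prop) (by fun_prop)
  have hm2 : Measurable fun r : (Rn n × Rn n) × Rn n =>
      ‖stft (cubeWindow T) U r.1.2 (r.1.1 - r.2)‖ₑ :=
    measurable_stft_comp (measurable_cubeWindow T) hU (by fun_prop) (by fun_prop)
  have hm3 : Measurable fun r : (Rn n × Rn n) × Rn n => ‖φ r.2‖ₑ :=
    (φ.continuous.measurable.comp measurable_snd).enorm
  have hm4 : ∀ y, Measurable fun p : Rn n × Rn n => ‖stft (cubeWindow S) v p.1 (p.2 - y)‖ₑ *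
      ‖stft (cubeWindow T) U p.2 (p.1 - y)‖ₑ := fun y =>
    Measurable.mul
      (measurable_stft_comp (measurable_cubeWindow S) hv (by fun_prop) (by fun_prop))
      (measurable_stft_comp (measurable_cubeWindow T) hU (by fun_prop) (by fun_prop))
  calc _ ≤ ∫⁻ p : Rn n × Rn n, ∫⁻ y, ‖φ y‖ₑ * (‖stft (cubeWindow S) v p.1 (p.2 - y)‖ₑ *
        ‖stft (cubeWindow T) U p.2 (p.1 - y)‖ₑ) := by
        refine lintegral_mono fun p => ?_
        rw [integral_cube2_phaseKernel hφ S T hvi hUi p, enorm_mul, enorm_ee, one_mul]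
        refine (enorm_integral_le_lintegral_enorm _).trans (le_of_eq ?_)
        simp only [enorm_mul]
    _ = ∫⁻ y, ∫⁻ p : Rn n × Rn n, ‖φ y‖ₑ * (‖stft (cubeWindow S) v p.1 (p.2 - y)‖ₑ *
        ‖stft (cubeWindow T) U p.2 (p.1 - y)‖ₑ) := by
        exact lintegral_lintegral_swap (hm3.mul (hm1.mul hm2)).aemeasurable
    _ ≤ ∫⁻ y, ‖φ y‖ₑ *
        ((∫⁻ x, ‖v x‖ₑ ^ 2) ^ (1 / 2 : ℝ) * (∫⁻ x, ‖U x‖ₑ ^ 2) ^ (1 / 2 : ℝ)) := by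
        refine lintegral_mono fun y => ?_
        rw [lintegral_const_mul _ (hm4 y)]
        gcongr
        exact lintegral_stft_mul_stft_le (measurable_cubeWindow S) (norm_cubeWindow_le S)
          (measurable_cubeWindow T) (norm_cubeWindow_le T) hv hvi hv2 hU hUi hU2 y
    _ = _ := lintegral_mul_const _ φ.continuous.measurable.enorm

/-- The substitution p ↦ p - t moves the averaging from the symbol to the kernel, after which the
symbol enters only through its supremum. -/
lemma integral_mul_integral_comp_add {G : Type*} [NormedAddCommGroup G] [NormedSpace ℝ G]
    [FiniteDimensional ℝ G] [MeasureSpace G] [BorelSpace G]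
    [(volume : Measure G).IsAddHaarMeasure] {κ : Measure G} [IsFiniteMeasure κ]
    {Φ m b : G → ℂ} (hΦ : Integrable Φ) (hm : Integrable m κ) (hb : Continuous b) {M : ℝ}
    (hbM : ∀ p, ‖b p‖ ≤ M) :
    ∫ p, Φ p * ∫ t, m t * b (p + t) ∂κ = ∫ p, b p * ∫ t, m t * Φ (p - t) ∂κ := by
  simp only [← integral_const_mul]
  rw [integral_integral_swap]
  · have h1 : ∀ t, ∫ p, Φ p * (m t * b (p + t)) = ∫ p, b p * (m t * Φ (p - t)) := by
      intro t
      rw [← integral_sub_right_eq_self (fun p => Φ p * (m t * b (p + t))) t]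
      refine integral_congr_ae (Filter.Eventually.of_forall fun p => ?_)
      simp only [sub_add_cancel]
      ring
    simp only [h1]
    rw [integral_integral_swap]
    have h2 := Integrable.convolution_integrand (ContinuousLinearMap.mul ℝ ℂ) hm hΦ
    have h3 : Integrable (fun r : G × G => b r.1 * (m r.2 * Φ (r.1 - r.2))) (volume.prod κ) :=
      h2.bdd_mul (c := M) (hb.comp continuous_fst).aestronglyMeasurable
        (Filter.Eventually.of_forall fun r => hbM r.1)
    exact h3.swap
  · have h2 : Integrable (fun r : G × G => Φ r.1 * m r.2) (volume.prod κ) := hΦ.mul_prod hm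
    refine (h2.bdd_mul (c := M) (hb.comp (continuous_fst.add continuous_snd)).aestronglyMeasurable
      (Filter.Eventually.of_forall fun r => hbM _)).congr (Filter.Eventually.of_forall fun r => ?_)
    simp only [Function.uncurry, Function.comp, Pi.add_apply]
    ring

/-- The word of the derivatives of the localisation to the unit cubes. -/
noncomputable def cubeWord (S T : Finset (Fin n)) : List (Fin n ⊕ Fin n) :=
  T.toList.map Sum.inr ++ S.toList.map Sum.inl

lemma length_cubeWord_le (S T : Finset (Fin n)) : (cubeWord S T).length ≤ 2 * n := by
  have h1 := Finset.card_le_univ S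
  have h2 := Finset.card_le_univ T
  simp only [Fintype.card_fin] at h1 h2
  simp [cubeWord]
  omega

lemma integrable_cubeWeight (S T : Finset (Fin n)) :
    Integrable (fun t : Rn n × Rn n => cubeWeight S t.1 * cubeWeight T t.2) (cube2 n) := by
  refine Integrable.of_bound (C := 1) (Continuous.aestronglyMeasurable (by fun_prop)) ?_
  filter_upwards [ae_cube2 n] with t ht
  rw [norm_mul]
  exact mul_le_one₀ (norm_cubeWeight_le S ht.1) (norm_nonneg _) (norm_cubeWeight_le T ht.2)

/-- The cube formula in x, followed by the cube formula in η for each derivative that appears; the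
bound M is there to justify Fubini. -/
lemma eq_sum_integral_cube2 {q : Rn n × Rn n → ℂ} (hq : ContDiff ℝ ∞ q) {M : ℝ}
    (hM : ∀ w : List (Fin n ⊕ Fin n), w.length ≤ 2 * n → ∀ p, ‖dirD (w.map (dir n)) q p‖ ≤ M)
    (p : Rn n × Rn n) :
    q p = ∑ S : Finset (Fin n), ∑ T : Finset (Fin n), ∫ t, cubeWeight S t.1 * cubeWeight T t.2 *
      dirD ((cubeWord S T).map (dir n)) q (p + t) ∂cube2 n := by
  rw [eq_sum_integral_cube (ContinuousLinearMap.inl ℝ (Rn n) (Rn n)) hq p]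
  refine Finset.sum_congr rfl fun S _ => ?_
  have hint : ∀ T : Finset (Fin n), Integrable (fun t : Rn n × Rn n =>
      cubeWeight S t.1 * cubeWeight T t.2 *
        dirD ((cubeWord S T).map (dir n)) q (p + t)) (cube2 n) := fun T =>
    (integrable_cubeWeight S T).mul_bdd (c := M)
      ((continuous_dirD hq _).comp (continuous_const.add continuous_id)).aestronglyMeasurable
      (Filter.Eventually.of_forall fun t => hM _ (length_cubeWord_le S T) _)
  have h1 : ∀ T, ∫ t, cubeWeight S t.1 * cubeWeight T t.2 *
        dirD ((cubeWord S T).map (dir n)) q (p + t) ∂cube2 n =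
      ∫ τ in cube n, ∫ θ in cube n, cubeWeight S τ * cubeWeight T θ *
        dirD ((cubeWord S T).map (dir n)) q (p + (τ, θ)) := fun T =>
    integral_prod _ (hint T)
  simp only [h1]
  rw [← integral_finsetSum _ fun T _ => (hint T).integral_prod_left]
  refine integral_congr_ae (Filter.Eventually.of_forall fun τ => ?_)
  simp only []
  have hG := contDiff_dirD hq
    (S.toList.map fun i => ContinuousLinearMap.inl ℝ (Rn n) (Rn n) (EuclideanSpace.single i 1))
  rw [eq_sum_integral_cube (ContinuousLinearMap.inr ℝ (Rn n) (Rn n)) hG, Finset.mul_sum]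
  refine Finset.sum_congr rfl fun T _ => ?_
  rw [← integral_const_mul]
  refine integral_congr_ae (Filter.Eventually.of_forall fun θ => ?_)
  simp only [← dirD_append]
  have e1 : (cubeWord S T).map (dir n) =
      (T.toList.map fun i => ContinuousLinearMap.inr ℝ (Rn n) (Rn n) (EuclideanSpace.single i 1)) ++
      (S.toList.map fun i =>
        ContinuousLinearMap.inl ℝ (Rn n) (Rn n) (EuclideanSpace.single i 1)) := by
    simp [cubeWord, Function.comp_def]
  have e2 : p + (ContinuousLinearMap.inl ℝ (Rn n) (Rn n)) τ +
      (ContinuousLinearMap.inr ℝ (Rn n) (Rn n)) θ = p + (τ, θ) := by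
    ext <;> simp
  rw [e1, e2, cubeWeight, cubeWeight, mul_assoc]

/-- The Calderón–Vaillancourt theorem, in bilinear form. -/
theorem exists_calderon_vaillancourt (n : ℕ) : ∃ A : ENNReal, A ≠ ⊤ ∧
    ∀ (q : Rn n × Rn n → ℂ) (M : ℝ), ContDiff ℝ ∞ q →
    (∀ w : List (Fin n ⊕ Fin n), w.length ≤ 2 * n → ∀ p, ‖dirD (w.map (dir n)) q p‖ ≤ M) →
    ∀ v U : Rn n → ℂ, Measurable v → Integrable v → MemLp v 2 →
      Measurable U → Integrable U → MemLp U 2 →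
    ‖∫ p, phaseKernel v U p * q p‖ₑ ≤ A * ENNReal.ofReal M *
      ((∫⁻ x, ‖v x‖ₑ ^ 2) ^ (1 / 2 : ℝ) * (∫⁻ x, ‖U x‖ₑ ^ 2) ^ (1 / 2 : ℝ)) := by
  obtain ⟨φ, hφ⟩ := exists_schwartz_ee_inner n
  set I := ∫⁻ y, ‖φ y‖ₑ with hI
  -- There are 2ⁿ · 2ⁿ pairs (S, T), and each term costs the L¹ norm I of φ.
  refine ⟨(Fintype.card (Finset (Fin n)) : ENNReal) * Fintype.card (Finset (Fin n)) * I, ?_, ?_⟩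
  · exact ENNReal.mul_ne_top (by finiteness) φ.integrable.2.ne
  intro q M hq hM v U hv hvi hv2 hU hUi hU2
  set X := (∫⁻ x, ‖v x‖ₑ ^ 2) ^ (1 / 2 : ℝ) * (∫⁻ x, ‖U x‖ₑ ^ 2) ^ (1 / 2 : ℝ) with hX
  have hΦ := integrable_phaseKernel hvi hUi
  set b : Finset (Fin n) → Finset (Fin n) → Rn n × Rn n → ℂ := fun S T =>
    dirD ((cubeWord S T).map (dir n)) q with hb
  have hbM : ∀ S T p, ‖b S T p‖ ≤ M := fun S T p => hM _ (length_cubeWord_le S T) p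
  have hbc : ∀ S T, Continuous (b S T) := fun S T => continuous_dirD hq _
  have hterm : ∀ S T, ‖∫ p, phaseKernel v U p * ∫ t, cubeWeight S t.1 * cubeWeight T t.2 *
      b S T (p + t) ∂cube2 n‖ₑ ≤ ENNReal.ofReal M * (I * X) := by
    intro S T
    have : (volume : Measure (Rn n × Rn n)).IsAddHaarMeasure := by
      rw [Measure.volume_eq_prod]; infer_instance
    rw [integral_mul_integral_comp_add hΦ (integrable_cubeWeight S T) (hbc S T) (hbM S T)]
    refine (enorm_integral_le_lintegral_enorm _).trans ?_
    calc _ ≤ ∫⁻ p, ENNReal.ofReal M * ‖∫ t, cubeWeight S t.1 * cubeWeight T t.2 *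
          phaseKernel v U (p - t) ∂cube2 n‖ₑ := by
          refine lintegral_mono fun p => ?_
          rw [enorm_mul]
          gcongr
          rw [← ofReal_norm]
          exact ENNReal.ofReal_le_ofReal (hbM S T p)
      _ = ENNReal.ofReal M * ∫⁻ p, ‖∫ t, cubeWeight S t.1 * cubeWeight T t.2 *
          phaseKernel v U (p - t) ∂cube2 n‖ₑ := lintegral_const_mul' _ _ ENNReal.ofReal_ne_top
      _ ≤ _ := by
          gcongr
          exact lintegral_cube2_phaseKernel_le hφ S T hv hvi hv2 hU hUi hU2
  have hint : ∀ S T, Integrable fun p => phaseKernel v U p *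
      ∫ t, cubeWeight S t.1 * cubeWeight T t.2 * b S T (p + t) ∂cube2 n := by
    intro S T
    refine hΦ.mul_bdd (c := M) ?_ (Filter.Eventually.of_forall fun p => ?_)
    · refine (StronglyMeasurable.integral_prod_right (f := fun (p t : Rn n × Rn n) =>
        cubeWeight S t.1 * cubeWeight T t.2 * b S T (p + t)) ?_).aestronglyMeasurable
      refine Continuous.stronglyMeasurable ?_
      have := hbc S T
      simp only [Function.uncurry_def]
      fun_prop
    · have h1 : ∀ᵐ t ∂cube2 n,
          ‖cubeWeight S t.1 * cubeWeight T t.2 * b S T (p + t)‖ ≤ M := by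
        filter_upwards [ae_cube2 n] with t ht
        have hM0 : 0 ≤ M := (norm_nonneg _).trans (hbM S T 0)
        rw [norm_mul, norm_mul]
        calc _ ≤ 1 * 1 * M := by
              gcongr
              · exact norm_cubeWeight_le S ht.1
              · exact norm_cubeWeight_le T ht.2
              · exact hbM S T _
          _ = M := by ring
      simpa using norm_integral_le_of_norm_le_const h1
  have hsum : ∫ p, phaseKernel v U p * q p = ∑ S, ∑ T, ∫ p, phaseKernel v U p *
      ∫ t, cubeWeight S t.1 * cubeWeight T t.2 * b S T (p + t) ∂cube2 n := by
    rw [← Finset.sum_product', ← integral_finsetSum _ fun s _ => hint s.1 s.2]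
    refine integral_congr_ae (Filter.Eventually.of_forall fun p => ?_)
    simp only []
    rw [eq_sum_integral_cube2 hq hM p, ← Finset.sum_product', Finset.mul_sum]
  rw [hsum]
  refine (enorm_sum_le _ _).trans ?_
  calc ∑ S, ‖∑ T, ∫ p, phaseKernel v U p *
      ∫ t, cubeWeight S t.1 * cubeWeight T t.2 * b S T (p + t) ∂cube2 n‖ₑ
      ≤ ∑ _S : Finset (Fin n), ∑ _T : Finset (Fin n), ENNReal.ofReal M * (I * X) :=
        Finset.sum_le_sum fun S _ => (enorm_sum_le _ _).trans
          (Finset.sum_le_sum fun T _ => hterm S T)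
    _ = _ := by
        simp only [Finset.sum_const, Finset.card_univ, nsmul_eq_mul]
        ring

end CalderonVaillancourt

/-! ### The operators in terms of the Fourier transform -/

section KohnNirenberg

variable {n : ℕ}

/-- The operator `F ↦ ∫ e^{2πi⟨x, η⟩} b(x, η) F(η) dη`. -/
noncomputable def knOp (b : Rn n × Rn n → ℂ) (F : Rn n → ℂ) (x : Rn n) : ℂ :=
  ∫ η, ee (inner ℝ x η) * b (x, η) * F η

/-- The symbol `a(x, -2πhη)`. -/
noncomputable def scaledSymbol (h : ℝ) (a : Rn n → Rn n → ℂ) : Rn n × Rn n → ℂ :=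
  fun p => a p.1 ((-(2 * π * h)) • p.2)

/-- The substitution ξ = -2πhη: the sign compensates the minus in the phase of `Op_h`, and the
Jacobian cancels the factor (2πh)^{-n}. -/
lemma opFun_eq_knOp {h : ℝ} (hh : 0 < h) (a : Rn n → Rn n → ℂ) (f : 𝓢(Rn n, ℂ)) (x : Rn n) :
    opFun h a f x = knOp (scaledSymbol h a) (𝓕 (f : Rn n → ℂ)) x := by
  have hL := Measure.integral_comp_smul (volume : Measure (Rn n))
    (fun ξ : Rn n => ∫ y : Rn n, Complex.exp (-(Complex.I / h) * (inner ℝ (x - y) ξ : ℝ)) *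
      a x ξ * f y) (-(2 * π * h))
  have habs : |((-(2 * π * h)) ^ Module.finrank ℝ (Rn n))⁻¹| = ((2 * π * h) ^ n)⁻¹ := by
    rw [abs_inv, abs_pow, abs_neg, abs_of_pos (by positivity), finrank_euclideanSpace_fin]
  rw [habs, Complex.real_smul, Complex.ofReal_inv] at hL
  rw [opFun, ← hL, knOp]
  refine integral_congr_ae (Filter.Eventually.of_forall fun η => ?_)
  simp only [scaledSymbol]
  rw [fourier_ee, ← integral_const_mul]
  refine integral_congr_ae (Filter.Eventually.of_forall fun y => ?_)
  have hh' : (h : ℂ) ≠ 0 := by exact_mod_cast hh.ne'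
  have he : Complex.exp (-(Complex.I / h) * (inner ℝ (x - y) (-(2 * π * h) • η) : ℝ))
      = ee (inner ℝ x η) * ee (-inner ℝ y η) := by
    rw [← ee_add, ee, inner_smul_right, inner_sub_left]
    congr 1
    push_cast
    field_simp
    ring
  simp only [he]
  ring

lemma fourier_besselS (h k : ℝ) (g : 𝓢(Rn n, ℂ)) (η : Rn n) :
    𝓕 (besselS n h k g : Rn n → ℂ) η = weight h k η * 𝓕 (g : Rn n → ℂ) η := by
  rw [← SchwartzMap.fourier_coe, besselS, SchwartzMap.fourierMultiplierCLM_apply,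
    FourierTransform.fourier_fourierInv_eq,
    SchwartzMap.smulLeftCLM_apply_apply (weight_hasTemperateGrowth h k), SchwartzMap.fourier_coe,
    smul_eq_mul]

lemma weight_eq_japPow (h k : ℝ) (η : Rn n) :
    weight h k η = japPow n k ((-(2 * π * h)) • η) := by
  simp [weight, japPow, japBr, norm_smul]

/-- A Fourier multiplier acting first simply multiplies the symbol, without remainder. Used with -k,
this trades the weight of H_h^k for a symbol of order 0. -/
lemma opFun_besselS {h : ℝ} (hh : 0 < h) (k : ℝ) (a : Rn n → Rn n → ℂ) (g : 𝓢(Rn n, ℂ))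
    (x : Rn n) :
    opFun h a (besselS n h k g) x =
      knOp (scaledSymbol h fun x ξ => a x ξ * japPow n k ξ) (𝓕 (g : Rn n → ℂ)) x := by
  rw [opFun_eq_knOp hh, knOp, knOp]
  refine integral_congr_ae (Filter.Eventually.of_forall fun η => ?_)
  simp only [fourier_besselS, weight_eq_japPow, scaledSymbol]
  ring

lemma integrable_knOp {b : Rn n × Rn n → ℂ} (hb : Continuous b) {M : ℝ} (hM : ∀ p, ‖b p‖ ≤ M)
    {F : Rn n → ℂ} (hF : Integrable F) (x : Rn n) :
    Integrable fun η => ee (inner ℝ x η) * b (x, η) * F η :=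
  hF.bdd_mul (c := M) (Continuous.aestronglyMeasurable (by fun_prop))
    (Filter.Eventually.of_forall fun η => by simpa using hM _)

lemma norm_knOp_le {b : Rn n × Rn n → ℂ} {M : ℝ} (hM : ∀ p, ‖b p‖ ≤ M)
    {F : Rn n → ℂ} (hF : Integrable F) (x : Rn n) : ‖knOp b F x‖ ≤ M * ∫ η, ‖F η‖ := by
  rw [← integral_const_mul]
  refine norm_integral_le_of_norm_le (hF.norm.const_mul M) (Filter.Eventually.of_forall fun η => ?_)
  rw [norm_mul, norm_mul, norm_ee, one_mul]
  exact mul_le_mul_of_nonneg_right (hM _) (norm_nonneg _)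

lemma measurable_knOp {b : Rn n × Rn n → ℂ} (hb : Continuous b) {F : Rn n → ℂ}
    (hF : Measurable F) : Measurable (knOp b F) := by
  have h2 : Measurable fun r : Rn n × Rn n => ee (inner ℝ r.1 r.2) * b (r.1, r.2) * F r.2 :=
    (Continuous.measurable (by fun_prop)).mul (hF.comp measurable_snd)
  exact (h2.stronglyMeasurable.integral_prod_right (ν := volume)).measurable

lemma integral_mul_knOp {b : Rn n × Rn n → ℂ} (hb : Continuous b) {M : ℝ} (hM : ∀ p, ‖b p‖ ≤ M)
    {v F : Rn n → ℂ} (hv : Integrable v) (hF : Integrable F) :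
    ∫ x, v x * knOp b F x = ∫ p, phaseKernel v F p * b p := by
  rw [Measure.volume_eq_prod, integral_prod]
  · refine integral_congr_ae (Filter.Eventually.of_forall fun x => ?_)
    simp only [knOp, phaseKernel]
    rw [← integral_const_mul]
    refine integral_congr_ae (Filter.Eventually.of_forall fun η => ?_)
    simp only []
    ring
  · exact (integrable_phaseKernel hv hF).mul_bdd (c := M) hb.aestronglyMeasurable
      (Filter.Eventually.of_forall hM)

lemma lintegral_comp_smul' {ε : ℝ} (hε : 0 < ε) (f : Rn n → ENNReal) (hf : Measurable f) :
    ∫⁻ x, f (ε • x) = ENNReal.ofReal ((ε ^ n)⁻¹) * ∫⁻ x, f x := by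
  have h1 : Measurable (fun x : Rn n => ε • x) := measurable_const_smul ε
  rw [← lintegral_map hf h1, Measure.map_addHaar_smul volume hε.ne', lintegral_smul_measure,
    finrank_euclideanSpace_fin, abs_of_pos (by positivity), smul_eq_mul]

/-- The map (x,η) ↦ (εx, η/ε) preserves both ⟨x,η⟩ and the measure dx dη. -/
lemma integral_phaseKernel_scale {ε : ℝ} (hε : 0 < ε) {b : Rn n × Rn n → ℂ} (hb : Continuous b)
    {M : ℝ} (hM : ∀ p, ‖b p‖ ≤ M) {v F : Rn n → ℂ} (hv : Integrable v) (hF : Integrable F) :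
    ∫ p, phaseKernel v F p * b p =
      ∫ p : Rn n × Rn n, phaseKernel (fun x => v (ε • x)) (fun η => F (ε⁻¹ • η)) p *
        b (ε • p.1, ε⁻¹ • p.2) := by
  have h1 : Integrable (fun x => v (ε • x)) := hv.comp_smul hε.ne'
  have h2 : Integrable (fun x => F (ε⁻¹ • x)) := hF.comp_smul (inv_pos.2 hε).ne'
  have hb' : Continuous fun p : Rn n × Rn n => b (ε • p.1, ε⁻¹ • p.2) := by fun_prop
  rw [← integral_mul_knOp hb hM hv hF,
    ← integral_mul_knOp (b := fun p => b (ε • p.1, ε⁻¹ • p.2)) hb' (fun _ => hM _) h1 h2]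
  have h3 : ∀ x, knOp (fun p => b (ε • p.1, ε⁻¹ • p.2)) (fun η => F (ε⁻¹ • η)) x =
      ((ε ^ n : ℝ) : ℂ) * knOp b F (ε • x) := by
    intro x
    have := Measure.integral_comp_smul (volume : Measure (Rn n))
      (fun η => ee (inner ℝ (ε • x) η) * b (ε • x, η) * F η) ε⁻¹
    rw [finrank_euclideanSpace_fin, abs_of_pos (by positivity), inv_pow, inv_inv,
      Complex.real_smul] at this
    rw [knOp, knOp, ← this]
    refine integral_congr_ae (Filter.Eventually.of_forall fun η => ?_)
    simp only [inner_smul_left, inner_smul_right, conj_trivial]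
    rw [inv_mul_cancel_left₀ hε.ne']
  have h4 := Measure.integral_comp_smul (volume : Measure (Rn n))
    (fun x => v x * knOp b F x) ε
  rw [finrank_euclideanSpace_fin, abs_of_pos (by positivity), Complex.real_smul] at h4
  have h5 : ∀ x, v (ε • x) * knOp (fun p => b (ε • p.1, ε⁻¹ • p.2)) (fun η => F (ε⁻¹ • η)) x =
      ((ε ^ n : ℝ) : ℂ) * (v (ε • x) * knOp b F (ε • x)) := by
    intro x; rw [h3]; ring
  simp only [h5]
  rw [integral_const_mul, h4, ← mul_assoc, ← Complex.ofReal_mul,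
    mul_inv_cancel₀ (by positivity), Complex.ofReal_one, one_mul]

/-- The semiclassical Calderón–Vaillancourt theorem in bilinear form. -/
lemma exists_calderon_vaillancourt_scaled (n : ℕ) : ∃ A : ENNReal, A ≠ ⊤ ∧
    ∀ (ε : ℝ) (b : Rn n × Rn n → ℂ) (M : ℝ), 0 < ε → ContDiff ℝ ∞ b →
    (∀ w : List (Fin n ⊕ Fin n), w.length ≤ 2 * n → ∀ p, ‖dirD (w.map (dir n))
      (fun p : Rn n × Rn n => b (ε • p.1, ε⁻¹ • p.2)) p‖ ≤ M) →
    ∀ v U : Rn n → ℂ, Measurable v → Integrable v → MemLp v 2 →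
      Measurable U → Integrable U → MemLp U 2 →
    ‖∫ p, phaseKernel v U p * b p‖ₑ ≤ A * ENNReal.ofReal M *
      ((∫⁻ x, ‖v x‖ₑ ^ 2) ^ (1 / 2 : ℝ) * (∫⁻ x, ‖U x‖ₑ ^ 2) ^ (1 / 2 : ℝ)) := by
  obtain ⟨A, hA, h⟩ := exists_calderon_vaillancourt n
  refine ⟨A, hA, fun ε b M hε hb hM v U hv hvi hv2 hU hUi hU2 => ?_⟩
  have hbM : ∀ p, ‖b p‖ ≤ M := by
    intro p
    have := hM [] (by simp) (ε⁻¹ • p.1, ε • p.2)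
    simpa [smul_smul, hε.ne'] using this
  have hscale : ContDiff ℝ ∞ (fun p : Rn n × Rn n => b (ε • p.1, ε⁻¹ • p.2)) :=
    hb.comp ((contDiff_fst.const_smul ε).prodMk (contDiff_snd.const_smul ε⁻¹))
  have hsm : ∀ {c : ℝ} (hc : 0 < c) {f : Rn n → ℂ}, Measurable f → Integrable f → MemLp f 2 →
      Measurable (fun x => f (c • x)) ∧ Integrable (fun x => f (c • x)) ∧
        MemLp (fun x => f (c • x)) 2 := by
    intro c hc f hf hfi hf2
    have hm : Measurable (fun x : Rn n => f (c • x)) := hf.comp (measurable_const_smul c)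
    refine ⟨hm, hfi.comp_smul hc.ne', hm.aestronglyMeasurable, ?_⟩
    rw [eLpNorm_lt_top_iff_lintegral_rpow_enorm_lt_top (by norm_num) (by norm_num)]
    have h2 := hf2.2
    rw [eLpNorm_lt_top_iff_lintegral_rpow_enorm_lt_top (by norm_num) (by norm_num)] at h2
    rw [lintegral_comp_smul' hc (fun x => ‖f x‖ₑ ^ ENNReal.toReal 2)
      (hf.enorm.pow_const _)]
    exact ENNReal.mul_lt_top ENNReal.ofReal_lt_top h2
  obtain ⟨a1, a2, a3⟩ := hsm hε hv hvi hv2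
  obtain ⟨b1, b2, b3⟩ := hsm (inv_pos.2 hε) hU hUi hU2
  have := h _ M hscale hM _ _ a1 a2 a3 b1 b2 b3
  rw [integral_phaseKernel_scale hε hb.continuous hbM hvi hUi]
  refine this.trans (le_of_eq ?_)
  rw [lintegral_comp_smul' hε (fun x => ‖v x‖ₑ ^ 2) (hv.enorm.pow_const _),
    lintegral_comp_smul' (inv_pos.2 hε) (fun x => ‖U x‖ₑ ^ 2) (hU.enorm.pow_const _),
    ENNReal.mul_rpow_of_nonneg _ _ (by norm_num), ENNReal.mul_rpow_of_nonneg _ _ (by norm_num)]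
  -- The dilations multiply the two L² norms by ε^{-n/2} and ε^{n/2}, so the estimate does not
  -- depend on ε.
  have hone : ENNReal.ofReal ((ε ^ n)⁻¹) ^ (1 / 2 : ℝ) * ENNReal.ofReal ((ε⁻¹ ^ n)⁻¹) ^ (1 / 2 : ℝ)
      = 1 := by
    rw [← ENNReal.mul_rpow_of_nonneg _ _ (by norm_num), ← ENNReal.ofReal_mul (by positivity),
      inv_pow, inv_inv, inv_mul_cancel₀ (by positivity), ENNReal.ofReal_one, ENNReal.one_rpow]
  congr 1
  set X := (∫⁻ x, ‖v x‖ₑ ^ 2) ^ (1 / 2 : ℝ)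
  set Y := (∫⁻ x, ‖U x‖ₑ ^ 2) ^ (1 / 2 : ℝ)
  calc _ = (ENNReal.ofReal ((ε ^ n)⁻¹) ^ (1 / 2 : ℝ) *
        ENNReal.ofReal ((ε⁻¹ ^ n)⁻¹) ^ (1 / 2 : ℝ)) * (X * Y) := by ring
    _ = X * Y := by rw [hone, one_mul]

end KohnNirenberg

/-! ### Boundedness of the operators -/

section Scaling

variable {P : Type*} [NormedAddCommGroup P] [NormedSpace ℝ P]

lemma dirD_map_smul_fun {J : Type*} (c : J → ℝ) (b : J → P) {f : P → ℂ} (hf : ContDiff ℝ ∞ f)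
    (w : List J) (p : P) :
    dirD (w.map fun j => c j • b j) f p = (((w.map c).prod : ℝ) : ℂ) * dirD (w.map b) f p := by
  induction w generalizing p with
  | nil => simp
  | cons j w ih =>
    have ih' : dirD (w.map fun j => c j • b j) f =
      fun p => (((w.map c).prod : ℝ) : ℂ) * dirD (w.map b) f p := funext ih
    simp only [List.map_cons, dirD_cons, ih']
    rw [fderiv_const_mul (differentiable_dirD hf _ p)]
    simp
    ring

lemma abs_prod_map_le {J : Type*} {c : J → ℝ} {K : ℝ} (hc : ∀ j, |c j| ≤ K) (w : List J) :
    |(w.map c).prod| ≤ K ^ w.length := by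
  induction w with
  | nil => simp
  | cons j w ih =>
    rw [List.map_cons, List.prod_cons, abs_mul, List.length_cons, pow_succ']
    exact mul_le_mul (hc j) ih (abs_nonneg _) ((abs_nonneg _).trans (hc j))

variable {n : ℕ}

/-- The dilation `(x, η) ↦ (c₁ x, c₂ η)`. -/
noncomputable def dilation (n : ℕ) (c₁ c₂ : ℝ) : Rn n × Rn n →L[ℝ] Rn n × Rn n :=
  (c₁ • ContinuousLinearMap.fst ℝ (Rn n) (Rn n)).prod (c₂ • ContinuousLinearMap.snd ℝ (Rn n) (Rn n))

lemma dilation_apply (c₁ c₂ : ℝ) (p : Rn n × Rn n) : dilation n c₁ c₂ p = (c₁ • p.1, c₂ • p.2) := rfl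

lemma norm_dirD_dilation_le {f : Rn n × Rn n → ℂ} (hf : ContDiff ℝ ∞ f) {c₁ c₂ K : ℝ}
    (h₁ : |c₁| ≤ K) (h₂ : |c₂| ≤ K) (w : List (Fin n ⊕ Fin n)) (p₀ p : Rn n × Rn n) :
    ‖dirD (w.map (dir n)) (fun p => f (dilation n c₁ c₂ p + p₀)) p‖ ≤
      K ^ w.length * ‖dirD (w.map (dir n)) f (dilation n c₁ c₂ p + p₀)‖ := by
  rw [dirD_comp_affine hf (dilation n c₁ c₂) p₀, List.map_map]
  have : (dilation n c₁ c₂ ∘ dir n : Fin n ⊕ Fin n → Rn n × Rn n) =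
      fun j => (Sum.elim (fun _ => c₁) (fun _ => c₂) j : ℝ) • dir n j := by
    funext j
    rcases j with i | i <;> simp [dilation_apply]
  rw [this]
  simp only [dirD_map_smul_fun _ _ hf]
  rw [norm_mul, Complex.norm_real, Real.norm_eq_abs]
  refine mul_le_mul_of_nonneg_right (abs_prod_map_le ?_ w) (norm_nonneg _)
  rintro (i | i) <;> simpa

end Scaling

/-! ### Cancelling the weight, and L² bounds by duality -/

section Boundedness

variable {n : ℕ}

lemma unc_mul (a b : Rn n → Rn n → ℂ) :
    unc (fun x ξ => a x ξ * b x ξ) = fun p => unc a p * unc b p := rfl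

/-- The directions are projected to the ξ component. Those in x become the zero vector, which the
estimate for `japPow` admits since it only asks for bounded directions. -/
lemma exists_norm_dirD_japPow_snd_le (n N : ℕ) (r : ℝ) :
    ∃ C : ℝ, 0 ≤ C ∧ ∀ w : List (Fin n ⊕ Fin n), w.length ≤ N → ∀ p : Rn n × Rn n,
      ‖dirD (w.map (dir n)) (fun p => japPow n r p.2) p‖ ≤ C * japBr p.2 ^ r := by
  obtain ⟨C, hC0, hC⟩ := exists_norm_dirD_japPow_le (fun j : Fin n ⊕ Fin n => (dir n j).2) (R := 1)
    (by rintro (i | i) <;> simp) N r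
  refine ⟨C, hC0, fun w hw p => ?_⟩
  have := congrFun (dirD_comp_affine (contDiff_japPow (n := n) r)
    (ContinuousLinearMap.snd ℝ (Rn n) (Rn n)) 0 (w.map (dir n))) p
  simp only [ContinuousLinearMap.coe_snd', add_zero, List.map_map] at this
  rw [this]
  exact hC w hw p.2

lemma contDiff_japPow_snd (r : ℝ) : ContDiff ℝ ∞ (fun p : Rn n × Rn n => japPow n r p.2) :=
  (contDiff_japPow r).comp contDiff_snd

/-- By Leibniz, with ⟨ξ⟩^k and ⟨ξ⟩^{-k} cancelling. Derivatives that fall on the weight bring no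
constant of a, but their factors √h can be dropped because h ≤ 1. -/
lemma exists_norm_dirD_mul_japPow_le (n N : ℕ) (k : ℝ) :
    ∃ K : ℝ, 0 ≤ K ∧ ∀ (a : Rn n → Rn n → ℂ) (C : (Fin n → ℕ) → (Fin n → ℕ) → ℝ),
      SymbolBound k a C → ∀ h : ℝ, 0 < h → h ≤ 1 → ∀ w : List (Fin n ⊕ Fin n), w.length ≤ N →
      ∀ p, √h ^ w.length *
        ‖dirD (w.map (dir n)) (unc fun x ξ => a x ξ * japPow n (-k) ξ) p‖ ≤ K * boundSum N h C := by
  obtain ⟨C', hC0, hC'⟩ := exists_norm_dirD_japPow_snd_le n N (-k)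
  refine ⟨2 ^ N * C', by positivity, fun a C ha h hh hh1 w hw p => ?_⟩
  have hs0 : 0 < √h := Real.sqrt_pos.2 hh
  have hs1 : √h ≤ 1 := Real.sqrt_le_one.2 hh1
  have hprod : ∀ s ∈ splits w, ‖dirD (s.1.map (dir n)) (unc a) p‖ *
      ‖dirD (s.2.map (dir n)) (fun p => japPow n (-k) p.2) p‖ ≤
      (√h ^ w.length)⁻¹ * (C' * boundSum N h C) := by
    intro s hs
    have hl := length_of_mem_splits hs
    have h1 := ha.norm_dirD_le s.1 p
    have h2 := hC' s.2 (by omega) p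
    have h3 := term_le_boundSum hh.le (s := N) ha.nonneg s.1 (by omega)
    have hp1 : 0 < japBr p.2 ^ k := Real.rpow_pos_of_pos (japBr_pos _) _
    have hp2 : japBr p.2 ^ k * japBr p.2 ^ (-k) = 1 := by
      rw [← Real.rpow_add (japBr_pos _)]; simp
    have hpw : √h ^ w.length ≤ √h ^ s.1.length := pow_le_pow_of_le_one hs0.le hs1 (by omega)
    have hC1 := ha.nonneg (cntXi s.1) (cntX s.1)
    calc _ ≤ (C (cntXi s.1) (cntX s.1) * japBr p.2 ^ k) * (C' * japBr p.2 ^ (-k)) :=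
          mul_le_mul h1 h2 (norm_nonneg _) (mul_nonneg hC1 hp1.le)
      _ = C' * C (cntXi s.1) (cntX s.1) := by
          linear_combination (C (cntXi s.1) (cntX s.1) * C') * hp2
      _ = (√h ^ w.length)⁻¹ * (C' * (√h ^ w.length * C (cntXi s.1) (cntX s.1))) := by
          field_simp
      _ ≤ _ := by
          gcongr
          exact (mul_le_mul_of_nonneg_right hpw hC1).trans h3
  have := norm_dirD_mul_le (dir n) ha.contDiff (contDiff_japPow_snd (-k)) w p hprod
  rw [unc_mul]
  have h2N : (2 : ℝ) ^ w.length ≤ 2 ^ N := pow_le_pow_right₀ (by norm_num) hw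
  have hB : 0 ≤ boundSum N h C := by
    have := term_le_boundSum hh.le (s := N) ha.nonneg [] (by simp)
    have h5 := ha.nonneg (cntXi []) (cntX [])
    simp only [List.length_nil, pow_zero, one_mul] at this
    exact h5.trans this
  calc _ ≤ √h ^ w.length * (2 ^ w.length * ((√h ^ w.length)⁻¹ * (C' * boundSum N h C))) :=
        mul_le_mul_of_nonneg_left this (by positivity)
    _ = 2 ^ w.length * (C' * boundSum N h C) := by field_simp
    _ ≤ 2 ^ N * (C' * boundSum N h C) := by gcongr
    _ = _ := by ring

lemma boundSum_nonneg {s : ℕ} {h : ℝ} (hh : 0 ≤ h) {C : (Fin n → ℕ) → (Fin n → ℕ) → ℝ}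
    (hC : ∀ α β, 0 ≤ C α β) : 0 ≤ boundSum s h C :=
  Finset.sum_nonneg fun _ _ => mul_nonneg (Real.rpow_nonneg hh _) (hC _ _)

/-- An `L²` bound from the bounds of the pairings with square integrable functions. -/
lemma lintegral_sq_le_of_pairing {G : Rn n → ℂ} (hG : Measurable G) {M₀ : ℝ}
    (hM₀ : ∀ x, ‖G x‖ ≤ M₀) {B : ENNReal}
    (h : ∀ v : Rn n → ℂ, Measurable v → Integrable v → MemLp v 2 →
      ‖∫ x, v x * G x‖ₑ ≤ B * (∫⁻ x, ‖v x‖ₑ ^ 2) ^ (1 / 2 : ℝ)) :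
    ∫⁻ x, ‖G x‖ₑ ^ 2 ≤ B ^ 2 := by
  have key : ∀ R : ℕ, ∫⁻ x in Metric.ball 0 R, ‖G x‖ₑ ^ 2 ≤ B ^ 2 := by
    intro R
    set s : Set (Rn n) := Metric.ball 0 R with hs
    have hsm : MeasurableSet s := measurableSet_ball
    have hfin : volume s < ⊤ := measure_ball_lt_top
    -- Testing with the conjugate of G on a ball gives X ≤ B √X for X = ∫ |G|² over the ball. The
    -- truncation makes X finite, as G is bounded, so √X may be cancelled; the balls then exhaust
    -- the space.
    set v : Rn n → ℂ := s.indicator fun x => (starRingEnd ℂ) (G x) with hv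
    have hconj : Measurable fun x => (starRingEnd ℂ) (G x) :=
      Complex.continuous_conj.measurable.comp hG
    have hvm : Measurable v := hconj.indicator hsm
    have hLp : ∀ p : ENNReal, MemLp v p := by
      intro p
      rw [hv, memLp_indicator_iff_restrict hsm]
      have : IsFiniteMeasure (volume.restrict s) := ⟨by simpa using hfin⟩
      exact MemLp.of_bound hconj.aestronglyMeasurable M₀
        (Filter.Eventually.of_forall fun x => by simpa using hM₀ x)
    have h1 := h v hvm (memLp_one_iff_integrable.1 (hLp 1)) (hLp 2)
    set X := ∫⁻ x in s, ‖G x‖ₑ ^ 2 with hX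
    have h2 : ∫⁻ x, ‖v x‖ₑ ^ 2 = X := by
      rw [hX, ← lintegral_indicator hsm]
      refine lintegral_congr fun x => ?_
      by_cases hx : x ∈ s
      · simp [hv, hx]
      · simp [hv, hx]
    have h3 : ‖∫ x, v x * G x‖ₑ = X := by
      have h4 : ∀ x, v x * G x = ((s.indicator (fun x => ‖G x‖ ^ 2) x : ℝ) : ℂ) := by
        intro x
        by_cases hx : x ∈ s
        · simp [hv, hx, Complex.conj_mul']
        · simp [hv, hx]
      simp only [h4]
      rw [integral_complex_ofReal, ← ofReal_norm, Complex.norm_real, ofReal_norm,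
        integral_indicator hsm, Real.enorm_of_nonneg (integral_nonneg fun x => by positivity),
        integral_eq_lintegral_of_nonneg_ae (Filter.Eventually.of_forall fun x => by positivity)
          (hG.norm.pow_const 2).aestronglyMeasurable]
      have h5 : ∀ x, ENNReal.ofReal (‖G x‖ ^ 2) = ‖G x‖ₑ ^ 2 := fun x => by
        rw [ENNReal.ofReal_pow (norm_nonneg _), ofReal_norm]
      simp only [h5]
      rw [ENNReal.ofReal_toReal]
      have := hLp 2
      refine ne_of_lt ?_
      rw [← hX, ← h2]
      have h6 := (eLpNorm_lt_top_iff_lintegral_rpow_enorm_lt_top (by norm_num) (by norm_num)).1 this.2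
      simpa using h6
    rw [h3, h2] at h1
    have hXt : X ≠ ⊤ := by
      rw [← h3]; exact enorm_ne_top
    rcases eq_or_ne X 0 with h0 | h0
    · rw [h0]; exact zero_le
    · have h7 : X = X ^ (1 / 2 : ℝ) * X ^ (1 / 2 : ℝ) := by
        rw [← ENNReal.rpow_add _ _ h0 hXt]; norm_num
      have h8 : X ^ (1 / 2 : ℝ) ≠ 0 := by simp [h0, hXt]
      have h9 : X ^ (1 / 2 : ℝ) ≠ ⊤ := by simp [h0, hXt]
      have h10 : X ^ (1 / 2 : ℝ) ≤ B := by
        exact (ENNReal.mul_le_mul_iff_left h8 h9).1 (h7.symm.le.trans h1)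
      calc X = X ^ (1 / 2 : ℝ) * X ^ (1 / 2 : ℝ) := h7
        _ ≤ B * B := mul_le_mul' h10 h10
        _ = B ^ 2 := (sq B).symm
  have hmono : ∫⁻ x, ‖G x‖ₑ ^ 2 = ⨆ R : ℕ, ∫⁻ x in Metric.ball 0 (R : ℝ), ‖G x‖ₑ ^ 2 := by
    rw [← setLIntegral_univ, ← Metric.iUnion_ball_nat (0 : Rn n)]
    rw [setLIntegral_iUnion_of_directed]
    exact Monotone.directed_le fun i j hij => Metric.ball_subset_ball (by exact_mod_cast hij)
  rw [hmono]
  exact iSup_le key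

end Boundedness

/-! ### Construction of the bounded operators -/

section Existence

variable {n : ℕ}

lemma eLpNorm_two_eq {V : Type*} [MeasurableSpace V] {μ : Measure V} (f : V → ℂ) :
    eLpNorm f 2 μ = (∫⁻ x, ‖f x‖ₑ ^ 2 ∂μ) ^ (1 / 2 : ℝ) := by
  rw [eLpNorm_eq_lintegral_rpow_enorm_toReal (by norm_num) (by norm_num)]
  simp

lemma knOp_add {b : Rn n × Rn n → ℂ} (hb : Continuous b) {M : ℝ} (hM : ∀ p, ‖b p‖ ≤ M)
    {F G : Rn n → ℂ} (hF : Integrable F) (hG : Integrable G) (x : Rn n) :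
    knOp b (fun η => F η + G η) x = knOp b F x + knOp b G x := by
  rw [knOp, knOp, knOp, ← integral_add (integrable_knOp hb hM hF x) (integrable_knOp hb hM hG x)]
  refine integral_congr_ae (Filter.Eventually.of_forall fun η => ?_)
  simp only []
  ring

lemma knOp_smul (b : Rn n × Rn n → ℂ) (c : ℂ) (F : Rn n → ℂ) (x : Rn n) :
    knOp b (fun η => c * F η) x = c * knOp b F x := by
  rw [knOp, knOp, ← integral_const_mul]
  refine integral_congr_ae (Filter.Eventually.of_forall fun η => ?_)
  simp only []
  ring

lemma knOp_fourier_add {b : Rn n × Rn n → ℂ} (hb : Continuous b) {M : ℝ} (hM : ∀ p, ‖b p‖ ≤ M)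
    (g₁ g₂ : 𝓢(Rn n, ℂ)) (x : Rn n) :
    knOp b (𝓕 ((g₁ + g₂ : 𝓢(Rn n, ℂ)) : Rn n → ℂ)) x =
      knOp b (𝓕 (g₁ : Rn n → ℂ)) x + knOp b (𝓕 (g₂ : Rn n → ℂ)) x := by
  have h : 𝓕 ((g₁ + g₂ : 𝓢(Rn n, ℂ)) : Rn n → ℂ) =
      fun η => (𝓕 g₁ : 𝓢(Rn n, ℂ)) η + (𝓕 g₂ : 𝓢(Rn n, ℂ)) η := by
    rw [← SchwartzMap.fourier_coe, FourierTransform.fourier_add]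
    rfl
  rw [h, knOp_add hb hM (𝓕 g₁).integrable (𝓕 g₂).integrable x, SchwartzMap.fourier_coe,
    SchwartzMap.fourier_coe]

lemma knOp_fourier_smul (b : Rn n × Rn n → ℂ) (c : ℂ) (g : 𝓢(Rn n, ℂ)) (x : Rn n) :
    knOp b (𝓕 ((c • g : 𝓢(Rn n, ℂ)) : Rn n → ℂ)) x = c * knOp b (𝓕 (g : Rn n → ℂ)) x := by
  have h : 𝓕 ((c • g : 𝓢(Rn n, ℂ)) : Rn n → ℂ) = fun η => c * (𝓕 g : 𝓢(Rn n, ℂ)) η := by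
    rw [← SchwartzMap.fourier_coe, FourierTransform.fourier_smul]
    rfl
  rw [h, knOp_smul, SchwartzMap.fourier_coe]

/-- The operator `g ↦ knOp b (𝓕 g)` from Schwartz functions to `L²`. -/
noncomputable def knOpL {b : Rn n × Rn n → ℂ} (hb : Continuous b) {M : ℝ} (hM : ∀ p, ‖b p‖ ≤ M)
    (hmem : ∀ g : 𝓢(Rn n, ℂ), MemLp (knOp b (𝓕 (g : Rn n → ℂ))) 2 volume) :
    𝓢(Rn n, ℂ) →ₗ[ℂ] L2 n where
  toFun g := (hmem g).toLp _
  map_add' g₁ g₂ := ((hmem g₁).toLp_add (hmem g₂)).symm ▸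
    MemLp.toLp_congr _ _ (Filter.Eventually.of_forall (knOp_fourier_add hb hM g₁ g₂))
  map_smul' c g := ((hmem g).toLp_const_smul c).symm ▸
    MemLp.toLp_congr _ _ (Filter.Eventually.of_forall (knOp_fourier_smul b c g))

lemma knOpL_apply {b : Rn n × Rn n → ℂ} (hb : Continuous b) {M : ℝ} (hM : ∀ p, ‖b p‖ ≤ M)
    (hmem : ∀ g : 𝓢(Rn n, ℂ), MemLp (knOp b (𝓕 (g : Rn n → ℂ))) 2 volume) (g : 𝓢(Rn n, ℂ)) :
    knOpL hb hM hmem g = (hmem g).toLp _ := rfl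

lemma exists_clm_of_norm_toLp_le (f : 𝓢(Rn n, ℂ) →ₗ[ℂ] L2 n) {K : ℝ} (hK : 0 ≤ K)
    (hf : ∀ g, ‖f g‖ ≤ K * ‖g.toLp 2 (volume : Measure (Rn n))‖) :
    ∃ T : L2 n →L[ℂ] L2 n, ‖T‖ ≤ K ∧ ∀ g : 𝓢(Rn n, ℂ), T (g.toLp 2) = f g := by
  have hd : DenseRange (SchwartzMap.toLpCLM ℂ ℂ 2 (volume : Measure (Rn n))).toLinearMap :=
    SchwartzMap.denseRange_toLpCLM (by simp)
  exact ⟨f.extendOfNorm _, ContinuousLinearMap.opNorm_le_bound _ hK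
    (LinearMap.norm_extendOfNorm_apply_le hd _ hf), LinearMap.extendOfNorm_eq hd ⟨_, hf⟩⟩

lemma memLp_knOp_fourier {b : Rn n × Rn n → ℂ} (hb : Continuous b) {A : ENNReal} (hA : A ≠ ⊤)
    (g : 𝓢(Rn n, ℂ)) (h : eLpNorm (knOp b (𝓕 (g : Rn n → ℂ))) 2 volume ≤
      A * eLpNorm g 2 volume) : MemLp (knOp b (𝓕 (g : Rn n → ℂ))) 2 volume := by
  have hmeas : Measurable (𝓕 (g : Rn n → ℂ)) := by
    rw [← SchwartzMap.fourier_coe]; exact (𝓕 g).continuous.measurable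
  have h1 : A * eLpNorm g 2 volume < ⊤ :=
    ENNReal.mul_lt_top hA.lt_top (g.eLpNorm_lt_top 2 volume)
  constructor
  · exact (measurable_knOp hb hmeas).aestronglyMeasurable
  · exact lt_of_le_of_lt h h1

lemma norm_knOpL_le {b : Rn n × Rn n → ℂ} (hb : Continuous b) {M : ℝ} (hM : ∀ p, ‖b p‖ ≤ M)
    (hmem : ∀ g : 𝓢(Rn n, ℂ), MemLp (knOp b (𝓕 (g : Rn n → ℂ))) 2 volume) {A : ENNReal}
    (hA : A ≠ ⊤) (g : 𝓢(Rn n, ℂ)) (h : eLpNorm (knOp b (𝓕 (g : Rn n → ℂ))) 2 volume ≤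
      A * eLpNorm g 2 volume) :
    ‖knOpL hb hM hmem g‖ ≤ A.toReal * ‖g.toLp 2 (volume : Measure (Rn n))‖ := by
  have h1 : A * eLpNorm g 2 volume ≠ ⊤ := ENNReal.mul_ne_top hA (g.eLpNorm_lt_top 2 volume).ne
  have h2 := ENNReal.toReal_mono h1 h
  rw [ENNReal.toReal_mul] at h2
  rw [knOpL_apply, Lp.norm_toLp, SchwartzMap.norm_toLp]
  exact h2

/-- A bounded operator `L² → L²` from a bound for `knOp b (𝓕 g)`, `g` a Schwartz function. -/
lemma exists_clm_of_knOp_bound {b : Rn n × Rn n → ℂ} (hb : Continuous b) {M : ℝ}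
    (hM : ∀ p, ‖b p‖ ≤ M) {A : ENNReal} (hA : A ≠ ⊤)
    (h : ∀ g : 𝓢(Rn n, ℂ), eLpNorm (knOp b (𝓕 (g : Rn n → ℂ))) 2 volume ≤
      A * eLpNorm g 2 volume) :
    ∃ T : L2 n →L[ℂ] L2 n, ‖T‖ ≤ A.toReal ∧
      ∀ g : 𝓢(Rn n, ℂ), T (g.toLp 2) =ᵐ[volume] knOp b (𝓕 (g : Rn n → ℂ)) := by
  have hmem := fun g => memLp_knOp_fourier hb hA g (h g)
  obtain ⟨T, hT, hTg⟩ := exists_clm_of_norm_toLp_le (knOpL hb hM hmem) (K := A.toReal)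
    ENNReal.toReal_nonneg fun g => norm_knOpL_le hb hM hmem hA g (h g)
  refine ⟨T, hT, fun g => ?_⟩
  rw [hTg g]
  exact (hmem g).coeFn_toLp

/-- The bilinear estimate is used with U = 𝓕 g; Plancherel returns the norm of g, and duality in v
the norm of the image. -/
lemma knOp_bound_of_pairing {b : Rn n × Rn n → ℂ} (hb : Continuous b) {M₀ : ℝ}
    (hM₀ : ∀ p, ‖b p‖ ≤ M₀) {A : ENNReal}
    (h : ∀ v U : Rn n → ℂ, Measurable v → Integrable v → MemLp v 2 →
      Measurable U → Integrable U → MemLp U 2 →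
    ‖∫ p, phaseKernel v U p * b p‖ₑ ≤ A *
      ((∫⁻ x, ‖v x‖ₑ ^ 2) ^ (1 / 2 : ℝ) * (∫⁻ x, ‖U x‖ₑ ^ 2) ^ (1 / 2 : ℝ)))
    (g : 𝓢(Rn n, ℂ)) :
    eLpNorm (knOp b (𝓕 (g : Rn n → ℂ))) 2 volume ≤ A * eLpNorm g 2 volume := by
  have hU : 𝓕 (g : Rn n → ℂ) = (𝓕 g : 𝓢(Rn n, ℂ)) := (SchwartzMap.fourier_coe g).symm
  have hUm : Measurable (𝓕 (g : Rn n → ℂ)) := by rw [hU]; exact (𝓕 g).continuous.measurable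
  have hUi : Integrable (𝓕 (g : Rn n → ℂ)) := by rw [hU]; exact (𝓕 g).integrable
  have hU2 : MemLp (𝓕 (g : Rn n → ℂ)) 2 := by rw [hU]; exact (𝓕 g).memLp 2
  have hPl : ∫⁻ x, ‖𝓕 (g : Rn n → ℂ) x‖ₑ ^ 2 = ∫⁻ x, ‖g x‖ₑ ^ 2 :=
    lintegral_fourier_sq_eq g.integrable (g.memLp 2)
  have h1 := lintegral_sq_le_of_pairing (G := knOp b (𝓕 (g : Rn n → ℂ)))
    (B := A * (∫⁻ x, ‖g x‖ₑ ^ 2) ^ (1 / 2 : ℝ)) (measurable_knOp hb hUm)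
    (norm_knOp_le hM₀ hUi) ?_
  · rw [eLpNorm_two_eq, eLpNorm_two_eq]
    calc _ ≤ ((A * (∫⁻ x, ‖g x‖ₑ ^ 2) ^ (1 / 2 : ℝ)) ^ 2) ^ (1 / 2 : ℝ) :=
          ENNReal.rpow_le_rpow h1 (by norm_num)
      _ = _ := by
          rw [← ENNReal.rpow_natCast, ← ENNReal.rpow_mul]
          norm_num
  · intro v hv hvi hv2
    rw [integral_mul_knOp hb hM₀ hvi hUi, ← hPl]
    refine (h v _ hv hvi hv2 hUm hUi hU2).trans (le_of_eq ?_)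
    ring

/-- The map `u ↦ Op_h(⟨ξ⟩^k) u` as a bounded operator. -/
noncomputable def toL2L (n : ℕ) (h k : ℝ) : Hsc n h k →L[ℂ] L2 n :=
  (toL2 n h k).mkContinuous 1 fun u => by rw [one_mul, norm_eq]

lemma norm_toL2L_le (n : ℕ) (h k : ℝ) : ‖toL2L n h k‖ ≤ 1 :=
  LinearMap.mkContinuous_norm_le _ zero_le_one _

lemma besselS_neg_besselS (n : ℕ) (h k : ℝ) (f : 𝓢(Rn n, ℂ)) :
    besselS n h (-k) (besselS n h k f) = f := by
  have := besselS_besselS_neg n h (-k) f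
  rwa [neg_neg] at this

lemma contDiff_scaledSymbol (h : ℝ) {a : Rn n → Rn n → ℂ} (ha : ContDiff ℝ ∞ (unc a)) :
    ContDiff ℝ ∞ (scaledSymbol h a) :=
  ha.comp (contDiff_fst.prodMk (contDiff_snd.const_smul _))

/-- Calderón–Vaillancourt with ε = √h, for the order-zero symbol a⟨ξ⟩^{-k}: in the dilated variables
each derivative carries at most a factor 2π√h, which produces exactly the powers of h in `boundSum`.
-/
theorem boundednessOrder_two_mul (n : ℕ) : BoundednessOrder n (2 * n) := by
  intro k
  obtain ⟨A, hA, hCV⟩ := exists_calderon_vaillancourt_scaled n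
  obtain ⟨K, hK0, hK⟩ := exists_norm_dirD_mul_japPow_le n (2 * n) k
  refine ⟨A.toReal * ((2 * π) ^ (2 * n) * K), fun h hh hh1 a C ha => ?_⟩
  set a' : Rn n → Rn n → ℂ := fun x ξ => a x ξ * japPow n (-k) ξ with ha'
  have ha's : ContDiff ℝ ∞ (unc a') := ha.contDiff.mul (contDiff_japPow_snd (-k))
  set b := scaledSymbol h a' with hb
  have hbs : ContDiff ℝ ∞ b := contDiff_scaledSymbol h ha's
  set M := (2 * π) ^ (2 * n) * K * boundSum (2 * n) h C with hMdef
  have hS0 : 0 ≤ boundSum (2 * n) h C := boundSum_nonneg hh.le ha.nonneg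
  have hM0 : 0 ≤ M := by positivity
  have hε : 0 < √h := Real.sqrt_pos.2 hh
  have h2π : (1 : ℝ) ≤ 2 * π := by nlinarith [Real.pi_gt_three]
  have hscale : ∀ p : Rn n × Rn n, b (√h • p.1, (√h)⁻¹ • p.2) =
      unc a' (dilation n (√h) (-(2 * π * √h)) p + 0) := by
    intro p
    rw [hb, add_zero, dilation_apply, scaledSymbol, unc]
    simp only [smul_smul]
    congr 2
    nth_rewrite 1 [← Real.mul_self_sqrt hh.le]
    field_simp
  have hbM : ∀ w : List (Fin n ⊕ Fin n), w.length ≤ 2 * n → ∀ p, ‖dirD (w.map (dir n))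
      (fun p : Rn n × Rn n => b (√h • p.1, (√h)⁻¹ • p.2)) p‖ ≤ M := by
    intro w hw p
    simp only [hscale]
    refine (norm_dirD_dilation_le ha's (K := 2 * π * √h) ?_ ?_ w 0 p).trans ?_
    · rw [abs_of_pos hε]
      nlinarith
    · rw [abs_neg, abs_of_pos (by positivity)]
    · have h1 := hK a C ha h hh hh1 w hw (dilation n (√h) (-(2 * π * √h)) p + 0)
      have h2 : (2 * π) ^ w.length ≤ (2 * π) ^ (2 * n) := pow_le_pow_right₀ h2π hw
      calc _ = (2 * π) ^ w.length * (√h ^ w.length * _) := by rw [mul_pow, mul_assoc]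
        _ ≤ (2 * π) ^ (2 * n) * (K * boundSum (2 * n) h C) :=
          mul_le_mul h2 h1 (by positivity) (by positivity)
        _ = _ := by rw [hMdef, mul_assoc]
  have hb0 : ∀ p, ‖b p‖ ≤ M := by
    intro p
    have := hbM [] (by simp) ((√h)⁻¹ • p.1, √h • p.2)
    simpa [smul_smul, hε.ne'] using this
  obtain ⟨T, hT, hTg⟩ := exists_clm_of_knOp_bound hbs.continuous hb0
    (A := A * ENNReal.ofReal M) (ENNReal.mul_ne_top hA ENNReal.ofReal_ne_top)
    (knOp_bound_of_pairing hbs.continuous hb0 (hCV (√h) b M hε hbs hbM))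
  -- T has symbol a⟨ξ⟩^{-k}; precomposing with Op_h(⟨ξ⟩^k), a contraction from H_h^k to L², restores
  -- a.
  refine ⟨T ∘L toL2L n h k, fun f => ?_, ?_⟩
  · have h1 : (T ∘L toL2L n h k) (schwartzToHsc n h k f) = T ((besselS n h k f).toLp 2) := by
      rw [← toL2_schwartzToHsc]; rfl
    rw [h1]
    refine (hTg _).trans (Filter.Eventually.of_forall fun x => ?_)
    rw [hb, ha', ← opFun_besselS hh (-k) a, besselS_neg_besselS]
  · calc ‖T ∘L toL2L n h k‖ ≤ ‖T‖ * ‖toL2L n h k‖ := ContinuousLinearMap.opNorm_comp_le _ _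
      _ ≤ (A * ENNReal.ofReal M).toReal * 1 :=
          mul_le_mul hT (norm_toL2L_le n h k) (norm_nonneg _) ENNReal.toReal_nonneg
      _ = _ := by
          rw [ENNReal.toReal_mul, ENNReal.toReal_ofReal hM0, hMdef]
          ring

end Existence

/-! ### Powers of `1 - Δ` -/

section Words

variable {P : Type*} [NormedAddCommGroup P] [NormedSpace ℝ P]

/-- Leibniz rule over a finite index type, so that it can be integrated term by term and indexed by
`ExpIdx`. -/
lemma dirD_mul_eq_sum {J : Type*} (b : J → P) {f g : P → ℂ} (hf : ContDiff ℝ ∞ f)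
    (hg : ContDiff ℝ ∞ g) (l : List J) (p : P) :
    dirD (l.map b) (fun p => f p * g p) p =
      ∑ i : Fin (splits l).length,
        dirD ((splits l)[i].1.map b) f p * dirD ((splits l)[i].2.map b) g p := by
  rw [dirD_mul hf hg, splits_map]
  simp only [List.map_map]
  exact (Fin.sum_univ_fun_getElem (splits l)
    (fun s => dirD (s.1.map b) f p * dirD (s.2.map b) g p)).symm

end Words

/-! ### Decay of Fourier transforms from (1 - Δ)^M -/

section Laplacian

variable {n : ℕ}

/-- The standard basis of `ℝⁿ`. -/
noncomputable def bas (n : ℕ) : Module.Basis (Fin n) ℝ (Rn n) :=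
  (EuclideanSpace.basisFun (Fin n) ℝ).toBasis

@[simp] lemma bas_apply (i : Fin n) : bas n i = EuclideanSpace.single i (1 : ℝ) := by
  simp [bas]

lemma integrable_fderiv_of_dirD {f : Rn n → ℂ}
    (h : ∀ i, Integrable (dirD [bas n i] f)) : Integrable (fderiv ℝ f) := by
  have h1 : fderiv ℝ f = fun p => ∑ i, (coordL (bas n) i).smulRight (dirD [bas n i] f p) :=
    funext fun p => clm_eq_sum_coord (bas n) _
  rw [h1]
  exact integrable_finsetSum (f := fun i p => (coordL (bas n) i).smulRight (dirD [bas n i] f p))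
    Finset.univ fun i _ => integrable_smulRight _ (h i)

lemma fourier_dirD_singleton {f : Rn n → ℂ} (hf : ContDiff ℝ ∞ f) (hfi : Integrable f)
    (h : ∀ i, Integrable (dirD [bas n i] f)) (i : Fin n) (z : Rn n) :
    𝓕 (dirD [bas n i] f) z = 2 * π * Complex.I * (z i : ℂ) * 𝓕 f z := by
  have h1 := integrable_fderiv_of_dirD h
  have h2 := congrFun (Real.fourier_fderiv hfi (hf.differentiable (by simp)) h1) z
  have h3 := congrArg (fun T : Rn n →L[ℝ] ℂ => T (bas n i)) h2
  simp only [VectorFourier.fourierSMulRight_apply] at h3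
  have h4 : (𝓕 (fderiv ℝ f) z) (bas n i) = 𝓕 (dirD [bas n i] f) z := by
    simp only [Real.fourier_eq]
    rw [ContinuousLinearMap.integral_apply]
    · rfl
    · exact (Real.fourierIntegral_convergent_iff z).2 h1
  have h5 : innerSL ℝ z (bas n i) = z i := by
    rw [bas_apply, innerSL_apply_apply, EuclideanSpace.inner_single_right]
    simp
  rw [← h4, h3, neg_apply, neg_apply, h5]
  simp
  ring

lemma fourier_dirD {f : Rn n → ℂ} (hf : ContDiff ℝ ∞ f)
    (h : ∀ w : List (Fin n), Integrable (dirD (w.map (bas n)) f)) (w : List (Fin n)) (z : Rn n) :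
    𝓕 (dirD (w.map (bas n)) f) z =
      (w.map fun i => 2 * π * Complex.I * (z i : ℂ)).prod * 𝓕 f z := by
  induction w with
  | nil => simp
  | cons i w ih =>
    have := fourier_dirD_singleton (contDiff_dirD hf (w.map (bas n))) (h w)
      (fun j => h (j :: w)) i z
    rw [List.map_cons, List.map_cons, List.prod_cons, mul_assoc, ← ih, ← this]
    rfl

/-- The words of the expansion of `(1 - Δ)^M`. -/
def lapWord {M : ℕ} (σ : Fin M → Option (Fin n)) : List (Fin n) :=
  (List.ofFn fun m => (σ m).elim [] fun i => [i, i]).flatten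

/-- The coefficients of the expansion of `(1 - Δ)^M`. -/
def lapCoef {M : ℕ} (σ : Fin M → Option (Fin n)) : ℂ := ∏ m, (σ m).elim 1 fun _ => -1

lemma length_lapWord_le {M : ℕ} (σ : Fin M → Option (Fin n)) : (lapWord σ).length ≤ 2 * M := by
  rw [lapWord, List.length_flatten, List.map_ofFn, List.sum_ofFn]
  calc _ ≤ ∑ _m : Fin M, 2 := Finset.sum_le_sum fun m _ => by
        rcases h : σ m <;> simp [h]
    _ = 2 * M := by simp [mul_comm]

/-- Expanding a power of a sum with n+1 terms: in each of the M factors `none` selects 1 and `some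
i` selects -X i ². -/
lemma sum_lapCoef_mul (M : ℕ) (X : Fin n → ℂ) :
    ∑ σ : Fin M → Option (Fin n), lapCoef σ * ((lapWord σ).map X).prod =
      (1 - ∑ i, X i ^ 2) ^ M := by
  have h1 : ∀ σ : Fin M → Option (Fin n), lapCoef σ * ((lapWord σ).map X).prod =
      ∏ m, (σ m).elim 1 fun i => -X i ^ 2 := by
    intro σ
    rw [lapCoef, lapWord, List.map_flatten, List.prod_flatten, List.map_ofFn, List.map_ofFn,
      List.prod_ofFn, ← Finset.prod_mul_distrib]
    refine Finset.prod_congr rfl fun m _ => ?_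
    rcases h : σ m with _ | i
    · simp [h]
    · simp [h]; ring
  simp only [h1]
  have h2 := Finset.prod_univ_sum (fun _ : Fin M => (Finset.univ : Finset (Option (Fin n))))
    (fun (_ : Fin M) (o : Option (Fin n)) => (o.elim 1 fun i => -X i ^ 2 : ℂ))
  rw [Fintype.piFinset_univ] at h2
  rw [← h2]
  simp [Fintype.sum_option, sub_eq_add_neg]

/-- The weight `⟨2πθ⟩^{-2M}`. -/
noncomputable def wt (n M : ℕ) : Rn n → ℂ := fun θ => japPow n (-(2 * M : ℝ)) ((2 * π) • θ)

lemma contDiff_wt (M : ℕ) : ContDiff ℝ ∞ (wt n M) :=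
  (contDiff_japPow _).comp (contDiff_id.const_smul _)

lemma wt_mul (M : ℕ) (θ : Rn n) : wt n M θ * ((1 + ‖(2 * π) • θ‖ ^ 2) ^ M : ℝ) = 1 := by
  have h1 : ((1 + ‖(2 * π) • θ‖ ^ 2) ^ M : ℝ) = japBr ((2 * π) • θ) ^ (2 * M : ℝ) := by
    rw [japBr, Real.sqrt_eq_rpow, ← Real.rpow_mul (by positivity)]
    rw [show (1 / 2 : ℝ) * (2 * M) = M by ring, Real.rpow_natCast]
  rw [h1, wt]
  have := japPow_mul (-(2 * M : ℝ)) (2 * M) ((2 * π) • θ)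
  rw [neg_add_cancel] at this
  rw [japPow, japPow, japPow] at this
  simpa [japPow] using this

lemma integrable_japBr_rpow {r : ℝ} (hr : (n : ℝ) < r) :
    Integrable fun θ : Rn n => japBr θ ^ (-r) := by
  have h := integrable_rpow_neg_one_add_norm_sq (E := Rn n) (μ := volume) (r := r) (by simpa using hr)
  refine h.congr (Filter.Eventually.of_forall fun θ => ?_)
  simp only [japBr]
  rw [Real.sqrt_eq_rpow, ← Real.rpow_mul (by positivity)]
  congr 1
  ring

lemma exists_norm_dirD_wt_le (n M N : ℕ) : ∃ C : ℝ, 0 ≤ C ∧ ∀ w : List (Fin n), w.length ≤ N →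
    ∀ θ, ‖dirD (w.map (bas n)) (wt n M) θ‖ ≤ C * japBr ((2 * π) • θ) ^ (-(2 * M : ℝ)) := by
  obtain ⟨C, hC0, hC⟩ := exists_norm_dirD_japPow_le (fun j : Fin n => (2 * π) • bas n j)
    (R := 2 * π) (fun j => by
      rw [norm_smul, bas_apply]; simp [abs_of_pos Real.pi_pos]) N (-(2 * M : ℝ))
  refine ⟨C, hC0, fun w hw θ => ?_⟩
  have := congrFun (dirD_comp_affine (contDiff_japPow (n := n) (-(2 * M : ℝ)))
    ((2 * π) • ContinuousLinearMap.id ℝ (Rn n)) 0 (w.map (bas n))) θ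
  simp only [add_zero, smul_apply, ContinuousLinearMap.id_apply, List.map_map] at this
  have h2 : dirD (w.map (bas n)) (wt n M) θ = _ := this
  rw [h2]
  exact hC w hw _

lemma integrable_dirD_wt {M : ℕ} (hM : n < 2 * M) (w : List (Fin n)) :
    Integrable (dirD (w.map (bas n)) (wt n M)) := by
  obtain ⟨C, hC0, hC⟩ := exists_norm_dirD_wt_le n M w.length
  have h1 := (integrable_japBr_rpow (n := n) (r := 2 * M) (by exact_mod_cast hM)).comp_smul
    (R := 2 * π) (by positivity)
  exact (h1.const_mul C).mono' (continuous_dirD (contDiff_wt M) _).aestronglyMeasurable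
    (Filter.Eventually.of_forall fun θ => hC w le_rfl θ)

/-- Derivatives become the factors X i = 2πi z i, for which 1 - ∑ X i ² = 1 + |2πz|²; the weight
divides by the M-th power of this. -/
lemma fourier_eq_wt_mul_sum {f : Rn n → ℂ} (hf : ContDiff ℝ ∞ f)
    (h : ∀ w : List (Fin n), Integrable (dirD (w.map (bas n)) f)) (M : ℕ) (z : Rn n) :
    𝓕 f z = wt n M z * ∑ σ : Fin M → Option (Fin n),
      lapCoef σ * 𝓕 (dirD ((lapWord σ).map (bas n)) f) z := by
  have h1 : ∑ σ : Fin M → Option (Fin n), lapCoef σ * 𝓕 (dirD ((lapWord σ).map (bas n)) f) z =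
      ((1 + ‖(2 * π) • z‖ ^ 2) ^ M : ℝ) * 𝓕 f z := by
    simp only [fourier_dirD hf h, ← mul_assoc]
    rw [← Finset.sum_mul, sum_lapCoef_mul]
    congr 1
    push_cast
    congr 1
    rw [norm_smul, Complex.ofReal_mul, mul_pow, ← Complex.ofReal_pow ‖z‖, EuclideanSpace.norm_sq_eq]
    push_cast
    rw [Finset.mul_sum, sub_eq_add_neg, ← Finset.sum_neg_distrib]
    congr 1
    refine Finset.sum_congr rfl fun i _ => ?_
    have h3 : ((‖z.ofLp i‖ : ℝ) : ℂ) ^ 2 = (z i : ℂ) ^ 2 := by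
      rw [← Complex.ofReal_pow, Real.norm_eq_abs, sq_abs, Complex.ofReal_pow]
    have h4 : ((‖2 * π‖ : ℝ) : ℂ) = 2 * π := by
      rw [Real.norm_of_nonneg (by positivity)]; push_cast; rfl
    rw [h3, h4, mul_pow, mul_pow, Complex.I_sq]
    ring
  rw [h1, ← mul_assoc, wt_mul, one_mul]

/-- A smooth function all of whose derivatives are bounded. -/
def BddSmooth {J : Type*} {P : Type*} [NormedAddCommGroup P] [NormedSpace ℝ P] (b : J → P)
    (f : P → ℂ) : Prop :=
  ContDiff ℝ ∞ f ∧ ∀ w : List J, ∃ C : ℝ, ∀ p, ‖dirD (w.map b) f p‖ ≤ C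

lemma integrable_dirD_mul_wt {M : ℕ} (hM : n < 2 * M) {f : Rn n → ℂ} (hf : BddSmooth (bas n) f)
    (w : List (Fin n)) : Integrable (dirD (w.map (bas n)) fun θ => f θ * wt n M θ) := by
  have h1 : dirD (w.map (bas n)) (fun θ => f θ * wt n M θ) = fun θ =>
      ∑ i : Fin (splits w).length, dirD ((splits w)[i].1.map (bas n)) f θ *
        dirD ((splits w)[i].2.map (bas n)) (wt n M) θ :=
    funext fun θ => dirD_mul_eq_sum _ hf.1 (contDiff_wt M) w θ
  rw [h1]
  refine integrable_finsetSum (f := fun (i : Fin (splits w).length) θ =>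
    dirD ((splits w)[i].1.map (bas n)) f θ * dirD ((splits w)[i].2.map (bas n)) (wt n M) θ)
    Finset.univ fun i _ => ?_
  obtain ⟨C, hC⟩ := hf.2 (splits w)[i].1
  exact (integrable_dirD_wt hM _).bdd_mul (c := C)
    (continuous_dirD hf.1 _).aestronglyMeasurable (Filter.Eventually.of_forall hC)

lemma hasCompactSupport_dirD {P : Type*} [NormedAddCommGroup P] [NormedSpace ℝ P] {f : P → ℂ}
    (hf : HasCompactSupport f) (l : List P) : HasCompactSupport (dirD l f) := by
  induction l with
  | nil => exact hf
  | cons v l ih => exact ih.fderiv_apply (𝕜 := ℝ) v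

lemma integrable_dirD_of_hasCompactSupport {f : Rn n → ℂ} (hf : ContDiff ℝ ∞ f)
    (hs : HasCompactSupport f) (l : List (Rn n)) : Integrable (dirD l f) :=
  (continuous_dirD hf l).integrable_of_hasCompactSupport (hasCompactSupport_dirD hs l)

lemma continuous_fourier_of_integrable {f : Rn n → ℂ} (hf : Integrable f) : Continuous (𝓕 f) :=
  VectorFourier.fourierIntegral_continuous Real.continuous_fourierChar (by exact continuous_inner)
    hf

lemma norm_fourier_le (f : Rn n → ℂ) (z : Rn n) : ‖𝓕 f z‖ ≤ ∫ x, ‖f x‖ :=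
  VectorFourier.norm_fourierIntegral_le_integral_norm _ _ _ _ _

/-- An integral with the Fourier transform of a test function, as an absolutely convergent double
integral. -/
lemma integral_mul_fourier_eq_sum {M : ℕ} (hM : n < 2 * M) {f g : Rn n → ℂ}
    (hf : BddSmooth (bas n) f) (hg : ContDiff ℝ ∞ g) (hgs : HasCompactSupport g) :
    ∫ θ, f θ * 𝓕 g θ = ∑ σ : Fin M → Option (Fin n), ∑ τ : Fin M → Option (Fin n),
      ∑ i : Fin (splits (lapWord τ)).length,
        ∫ z, ∫ θ, lapCoef σ * lapCoef τ * (ee (-inner ℝ θ z) * wt n M z *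
          (dirD ((splits (lapWord τ))[i].1.map (bas n)) f θ *
            dirD ((splits (lapWord τ))[i].2.map (bas n)) (wt n M) θ) *
          dirD ((lapWord σ).map (bas n)) g z) := by
  -- As f is merely bounded it has no Fourier integral of its own. A first (1-Δ)^M falls on g and
  -- its weight makes ψ = f · wt integrable; the transform is moved to ψ, and a second (1-Δ)^M, now
  -- on ψ, gives the weight in z.
  set ψ : Rn n → ℂ := fun θ => f θ * wt n M θ with hψ
  have hψs : ContDiff ℝ ∞ ψ := hf.1.mul (contDiff_wt M)
  have hψi : ∀ w : List (Fin n), Integrable (dirD (w.map (bas n)) ψ) := integrable_dirD_mul_wt hM hf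
  have hgi : ∀ w : List (Fin n), Integrable (dirD (w.map (bas n)) g) := fun w =>
    integrable_dirD_of_hasCompactSupport hg hgs _
  have hψ0 : Integrable ψ := hψi []
  have hint1 : ∀ σ : Fin M → Option (Fin n), Integrable fun θ =>
      lapCoef σ * (ψ θ * 𝓕 (dirD ((lapWord σ).map (bas n)) g) θ) := fun σ =>
    (hψ0.mul_bdd (c := ∫ x, ‖dirD ((lapWord σ).map (bas n)) g x‖)
      (continuous_fourier_of_integrable (hgi _)).aestronglyMeasurable
      (Filter.Eventually.of_forall fun θ => norm_fourier_le _ θ)).const_mul _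
  have h1 : ∫ θ, f θ * 𝓕 g θ = ∑ σ : Fin M → Option (Fin n),
      lapCoef σ * ∫ z, 𝓕 ψ z * dirD ((lapWord σ).map (bas n)) g z := by
    have : ∀ θ, f θ * 𝓕 g θ = ∑ σ : Fin M → Option (Fin n),
        lapCoef σ * (ψ θ * 𝓕 (dirD ((lapWord σ).map (bas n)) g) θ) := by
      intro θ
      rw [fourier_eq_wt_mul_sum hg hgi M θ, ← mul_assoc, Finset.mul_sum]
      refine Finset.sum_congr rfl fun σ _ => ?_
      rw [hψ]; ring
    simp only [this]
    rw [integral_finsetSum (f := fun (σ : Fin M → Option (Fin n)) θ =>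
      lapCoef σ * (ψ θ * 𝓕 (dirD ((lapWord σ).map (bas n)) g) θ)) Finset.univ fun σ _ => hint1 σ]
    refine Finset.sum_congr rfl fun σ _ => ?_
    rw [integral_const_mul, integral_fourier_mul_eq_of_integrable hψ0 (hgi _)]
  rw [h1]
  refine Finset.sum_congr rfl fun σ _ => ?_
  have hwt1 : ∃ C : ℝ, ∀ z, ‖wt n M z‖ ≤ C := by
    obtain ⟨C, hC0, hC⟩ := exists_norm_dirD_wt_le n M 0
    refine ⟨C, fun z => (hC [] (by simp) z).trans (mul_le_of_le_one_right hC0 ?_)⟩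
    exact Real.rpow_le_one_of_one_le_of_nonpos (one_le_japBr _) (by simp)
  obtain ⟨Cw, hCw⟩ := hwt1
  have hint2 : ∀ (h : Rn n → ℂ), Integrable h → Integrable fun z => lapCoef σ *
      (wt n M z * 𝓕 h z * dirD ((lapWord σ).map (bas n)) g z) := by
    intro h hh
    refine Integrable.const_mul ((hgi _).bdd_mul (c := Cw * ∫ x, ‖h x‖)
      ((contDiff_wt M).continuous.mul (continuous_fourier_of_integrable hh)).aestronglyMeasurable
      (Filter.Eventually.of_forall fun z => ?_)) _
    rw [Pi.mul_apply, norm_mul]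
    exact mul_le_mul (hCw z) (norm_fourier_le h z) (norm_nonneg _) ((norm_nonneg _).trans (hCw z))
  have hsp : ∀ (τ : Fin M → Option (Fin n)) (i : Fin (splits (lapWord τ)).length),
      Integrable fun θ => dirD ((splits (lapWord τ))[i].1.map (bas n)) f θ *
            dirD ((splits (lapWord τ))[i].2.map (bas n)) (wt n M) θ := by
    intro τ i
    obtain ⟨C, hC⟩ := hf.2 (splits (lapWord τ))[i].1
    exact (integrable_dirD_wt hM _).bdd_mul (c := C)
      (continuous_dirD hf.1 _).aestronglyMeasurable (Filter.Eventually.of_forall hC)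
  have h2 : ∀ z, 𝓕 ψ z = ∑ τ : Fin M → Option (Fin n), ∑ i : Fin (splits (lapWord τ)).length,
      lapCoef τ * (wt n M z * 𝓕 (fun θ => dirD ((splits (lapWord τ))[i].1.map (bas n)) f θ *
            dirD ((splits (lapWord τ))[i].2.map (bas n)) (wt n M) θ) z) := by
    intro z
    rw [fourier_eq_wt_mul_sum hψs hψi M z, Finset.mul_sum]
    refine Finset.sum_congr rfl fun τ _ => ?_
    have h3 : dirD ((lapWord τ).map (bas n)) ψ = fun θ => ∑ i : Fin (splits (lapWord τ)).length,
        dirD ((splits (lapWord τ))[i].1.map (bas n)) f θ *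
            dirD ((splits (lapWord τ))[i].2.map (bas n)) (wt n M) θ :=
      funext fun θ => dirD_mul_eq_sum _ hf.1 (contDiff_wt M) _ θ
    rw [h3, ← Finset.mul_sum, ← Finset.mul_sum, fourier_ee]
    simp only [fourier_ee]
    rw [← integral_finsetSum (f := fun (i : Fin (splits (lapWord τ)).length) θ =>
      ee (-inner ℝ θ z) * (dirD ((splits (lapWord τ))[i].1.map (bas n)) f θ *
            dirD ((splits (lapWord τ))[i].2.map (bas n)) (wt n M) θ)) Finset.univ fun i _ => ?_]
    · simp only [Finset.mul_sum]
      ring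
    · exact (hsp τ i).bdd_mul (c := 1) (Continuous.aestronglyMeasurable (by fun_prop))
        (Filter.Eventually.of_forall fun θ => by simp)
  simp only [h2]
  rw [← integral_const_mul]
  have h4 : ∀ z, lapCoef σ * ((∑ τ : Fin M → Option (Fin n),
      ∑ i : Fin (splits (lapWord τ)).length,
      lapCoef τ * (wt n M z * 𝓕 (fun θ => dirD ((splits (lapWord τ))[i].1.map (bas n)) f θ *
            dirD ((splits (lapWord τ))[i].2.map (bas n)) (wt n M) θ) z)) *
            dirD ((lapWord σ).map (bas n)) g z) =
      ∑ τ : Fin M → Option (Fin n), ∑ i : Fin (splits (lapWord τ)).length,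
        lapCoef τ * (lapCoef σ * (wt n M z *
          𝓕 (fun θ => dirD ((splits (lapWord τ))[i].1.map (bas n)) f θ *
            dirD ((splits (lapWord τ))[i].2.map (bas n)) (wt n M) θ) z *
            dirD ((lapWord σ).map (bas n)) g z)) := by
    intro z
    rw [Finset.sum_mul, Finset.mul_sum]
    refine Finset.sum_congr rfl fun τ _ => ?_
    rw [Finset.sum_mul, Finset.mul_sum]
    refine Finset.sum_congr rfl fun i _ => ?_
    ring
  simp only [h4]
  rw [integral_finsetSum _ fun τ _ => integrable_finsetSum _ fun i _ =>
    (hint2 _ (hsp τ i)).const_mul (lapCoef τ)]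
  refine Finset.sum_congr rfl fun τ _ => ?_
  rw [integral_finsetSum _ fun i _ => (hint2 _ (hsp τ i)).const_mul (lapCoef τ)]
  refine Finset.sum_congr rfl fun i _ => ?_
  refine integral_congr_ae (Filter.Eventually.of_forall fun z => ?_)
  simp only []
  rw [fourier_ee, ← integral_const_mul, ← integral_mul_const, ← integral_const_mul,
    ← integral_const_mul]
  refine integral_congr_ae (Filter.Eventually.of_forall fun θ => ?_)
  simp only []
  ring

end Laplacian

/-! ### The expansion of a composed symbol -/

section Expansion

variable {n : ℕ}

lemma integrable_fourier_of_hasCompactSupport {g : Rn n → ℂ} (hg : ContDiff ℝ ∞ g)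
    (hs : HasCompactSupport g) : Integrable (𝓕 g) := by
  have : 𝓕 g = (𝓕 (hs.toSchwartzMap hg) : 𝓢(Rn n, ℂ)) := by
    rw [SchwartzMap.fourier_coe]; rfl
  rw [this]
  exact SchwartzMap.integrable _

lemma integral_fourier_eq_apply_zero {g : Rn n → ℂ} (hg : ContDiff ℝ ∞ g)
    (hs : HasCompactSupport g) : ∫ θ, 𝓕 g θ = g 0 := by
  have h1 := congrFun (hg.continuous.fourierInv_fourier_eq
    (hg.continuous.integrable_of_hasCompactSupport hs)
    (integrable_fourier_of_hasCompactSupport hg hs)) 0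
  rw [fourierInv_ee] at h1
  simpa using h1

lemma sub_eq_integral_dirD {f : Rn n → ℂ} (hf : ContDiff ℝ ∞ f) (θ : Rn n) :
    f θ - f 0 = ∫ t in Set.Icc (0 : ℝ) 1, ∑ j, (θ j : ℂ) * dirD [bas n j] f (t • θ) := by
  have h1 : ∀ t : ℝ, HasDerivAt (fun t : ℝ => f (t • θ))
      (∑ j, (θ j : ℂ) * dirD [bas n j] f (t • θ)) t := by
    intro t
    have h2 : HasDerivAt (fun t : ℝ => t • θ) θ t := by
      simpa using (hasDerivAt_id t).smul_const θ
    have h3 := (hf.differentiable (by simp) (t • θ)).hasFDerivAt.comp_hasDerivAt t h2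
    refine h3.congr_deriv ?_
    rw [clm_eq_sum_coord (bas n) (fderiv ℝ f (t • θ)), sum_apply]
    refine Finset.sum_congr rfl fun j _ => ?_
    rw [ContinuousLinearMap.smulRight_apply, Complex.real_smul]
    simp [coordL, bas, dirD]
  have hc : Continuous fun t : ℝ => ∑ j, (θ j : ℂ) * dirD [bas n j] f (t • θ) :=
    continuous_finsetSum _ fun j _ => continuous_const.mul
      ((continuous_dirD hf _).comp (by fun_prop))
  have h4 := intervalIntegral.integral_eq_sub_of_hasDerivAt (fun t _ => h1 t)
    (hc.intervalIntegrable 0 1)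
  rw [integral_Icc_eq_integral_Ioc, ← intervalIntegral.integral_of_le zero_le_one, h4]
  simp

lemma bddSmooth_dirD {J P : Type*} [NormedAddCommGroup P] [NormedSpace ℝ P] {b : J → P}
    {f : P → ℂ} (hf : BddSmooth b f) (w : List J) : BddSmooth b (dirD (w.map b) f) :=
  ⟨contDiff_dirD hf.1 _, fun w' => by
    obtain ⟨C, hC⟩ := hf.2 (w' ++ w)
    exact ⟨C, fun p => by rw [← dirD_append, ← List.map_append]; exact hC p⟩⟩

lemma dirD_comp_smul {f : Rn n → ℂ} (hf : ContDiff ℝ ∞ f) (t : ℝ) (w : List (Fin n)) (θ : Rn n) :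
    dirD (w.map (bas n)) (fun θ => f (t • θ)) θ =
      (t : ℂ) ^ w.length * dirD (w.map (bas n)) f (t • θ) := by
  have h1 := congrFun (dirD_comp_affine hf (t • ContinuousLinearMap.id ℝ (Rn n)) 0
    (w.map (bas n))) θ
  simp only [add_zero, smul_apply, ContinuousLinearMap.id_apply, List.map_map] at h1
  rw [h1]
  have h2 := dirD_map_smul_fun (fun _ : Fin n => t) (bas n) hf w (t • θ)
  rw [List.map_const', List.prod_replicate] at h2
  push_cast at h2
  exact h2

lemma bddSmooth_comp_smul {f : Rn n → ℂ} (hf : BddSmooth (bas n) f) (t : ℝ) :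
    BddSmooth (bas n) fun θ => f (t • θ) :=
  ⟨hf.1.comp (contDiff_id.const_smul t), fun w => by
    obtain ⟨C, hC⟩ := hf.2 w
    refine ⟨‖(t : ℂ) ^ w.length‖ * C, fun p => ?_⟩
    rw [dirD_comp_smul hf.1, norm_mul]
    exact mul_le_mul_of_nonneg_left (hC _) (norm_nonneg _)⟩

/-- Taylor's formula of first order for f at 0. The constant term is Fourier inversion at 0, and
each factor θ j of the remainder turns into a derivative of g. Hence every remainder term contains a
derivative of f and one of g. -/
lemma integral_mul_fourier_eq_add {f g : Rn n → ℂ} (hf : BddSmooth (bas n) f)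
    (hg : ContDiff ℝ ∞ g) (hgs : HasCompactSupport g) :
    ∫ θ, f θ * 𝓕 g θ = f 0 * g 0 + ∑ j, ∫ t in Set.Icc (0 : ℝ) 1,
      ((2 * π * Complex.I)⁻¹ * ∫ θ, dirD [bas n j] f (t • θ) * 𝓕 (dirD [bas n j] g) θ) := by
  have hgi : ∀ w : List (Fin n), Integrable (dirD (w.map (bas n)) g) := fun w =>
    integrable_dirD_of_hasCompactSupport hg hgs _
  have hFi : Integrable (𝓕 g) := integrable_fourier_of_hasCompactSupport hg hgs
  have hFji : ∀ j, Integrable (𝓕 (dirD [bas n j] g)) := fun j =>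
    integrable_fourier_of_hasCompactSupport (contDiff_dirD hg _) (hasCompactSupport_dirD hgs _)
  have hc0 : (2 * π * Complex.I : ℂ) ≠ 0 := by simp [Real.pi_ne_zero]
  have hI : ∀ j, Integrable (fun p : Rn n × ℝ => (2 * π * Complex.I)⁻¹ *
      (dirD [bas n j] f (p.2 • p.1) * 𝓕 (dirD [bas n j] g) p.1))
      (volume.prod (volume.restrict (Set.Icc (0 : ℝ) 1))) := by
    intro j
    obtain ⟨C, hC⟩ := hf.2 [j]
    have h1 : Integrable (fun p : Rn n × ℝ => 𝓕 (dirD [bas n j] g) p.1)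
        (volume.prod (volume.restrict (Set.Icc (0 : ℝ) 1))) := (hFji j).comp_fst _
    refine (h1.bdd_mul (c := C) (Continuous.aestronglyMeasurable ?_)
      (Filter.Eventually.of_forall fun p => hC _)).const_mul _
    exact (continuous_dirD hf.1 _).comp (by fun_prop)
  have hpt : ∀ θ, f θ * 𝓕 g θ = f 0 * 𝓕 g θ + ∑ j, ∫ t in Set.Icc (0 : ℝ) 1,
      ((2 * π * Complex.I)⁻¹ * (dirD [bas n j] f (t • θ) * 𝓕 (dirD [bas n j] g) θ)) := by
    intro θ
    have hcj : ∀ j, Continuous fun t : ℝ => (2 * π * Complex.I)⁻¹ *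
        (dirD [bas n j] f (t • θ) * 𝓕 (dirD [bas n j] g) θ) := fun j =>
      continuous_const.mul (((continuous_dirD hf.1 _).comp (by fun_prop)).mul continuous_const)
    rw [← integral_finsetSum (f := fun j t => (2 * π * Complex.I)⁻¹ *
      (dirD [bas n j] f (t • θ) * 𝓕 (dirD [bas n j] g) θ)) Finset.univ
      fun j _ => (hcj j).integrableOn_Icc]
    have h2 := sub_eq_integral_dirD hf.1 θ
    have h3 : (f θ - f 0) * 𝓕 g θ = ∫ t in Set.Icc (0 : ℝ) 1, ∑ j, (2 * π * Complex.I)⁻¹ *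
        (dirD [bas n j] f (t • θ) * 𝓕 (dirD [bas n j] g) θ) := by
      rw [h2, ← integral_mul_const]
      refine integral_congr_ae (Filter.Eventually.of_forall fun t => ?_)
      simp only []
      rw [Finset.sum_mul]
      refine Finset.sum_congr rfl fun j _ => ?_
      rw [fourier_dirD_singleton hg (hgi []) (fun i => hgi [i])]
      field_simp
    rw [← h3]
    ring
  simp only [hpt]
  rw [integral_add (hFi.const_mul _) (integrable_finsetSum _ fun j _ => (hI j).integral_prod_left),
    integral_const_mul, integral_fourier_eq_apply_zero hg hgs,
    integral_finsetSum _ fun j _ => (hI j).integral_prod_left]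
  congr 1
  refine Finset.sum_congr rfl fun j _ => ?_
  rw [integral_integral_swap (hI j)]
  simp only [integral_const_mul]

/-- The measure `dt dz dθ` on `[0, 1] × ℝⁿ × ℝⁿ`. -/
noncomputable def mu3 (n : ℕ) : Measure (ℝ × Rn n × Rn n) :=
  (volume.restrict (Set.Icc (0 : ℝ) 1)).prod (volume.prod volume)

/-- Indices of the terms of the expansion of a composed symbol. -/
abbrev ExpIdx (n M : ℕ) : Type :=
  Fin n × (Fin M → Option (Fin n)) × (Σ τ : Fin M → Option (Fin n), Fin (splits (lapWord τ)).length)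

/-- The derivatives in the frequency variable in a term of the expansion. -/
def expWordXi {n M : ℕ} (i : ExpIdx n M) : List (Fin n ⊕ Fin n) :=
  ((splits (lapWord i.2.2.1))[i.2.2.2].1 ++ [i.1]).map Sum.inr

/-- The derivatives in the space variable in a term of the expansion. -/
def expWordX {n M : ℕ} (i : ExpIdx n M) : List (Fin n ⊕ Fin n) :=
  (lapWord i.2.1 ++ [i.1]).map Sum.inl

/-- The kernel of a term of the expansion. -/
noncomputable def expKer {n M : ℕ} (i : ExpIdx n M) (y : ℝ × Rn n × Rn n) : ℂ :=
  (2 * π * Complex.I)⁻¹ * (lapCoef i.2.1 * lapCoef i.2.2.1) * (ee (-inner ℝ y.2.2 y.2.1) *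
    ((y.1 : ℂ) ^ (splits (lapWord i.2.2.1))[i.2.2.2].1.length * (wt n M y.2.1 *
      dirD ((splits (lapWord i.2.2.1))[i.2.2.2].2.map (bas n)) (wt n M) y.2.2)))

lemma integrable_expKer {M : ℕ} (hM : n < 2 * M) (i : ExpIdx n M) :
    Integrable (expKer i) (mu3 n) := by
  have h1 : Integrable (fun t : ℝ => (t : ℂ) ^ (splits (lapWord i.2.2.1))[i.2.2.2].1.length)
      (volume.restrict (Set.Icc (0 : ℝ) 1)) :=
    Continuous.integrableOn_Icc (by fun_prop)
  have h2 := h1.mul_prod ((integrable_dirD_wt hM []).mul_prod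
    (integrable_dirD_wt hM (splits (lapWord i.2.2.1))[i.2.2.2].2))
  have h3 := h2.bdd_mul (c := 1) (f := fun y : ℝ × Rn n × Rn n => ee (-inner ℝ y.2.2 y.2.1))
    (Continuous.aestronglyMeasurable (by fun_prop)) (Filter.Eventually.of_forall fun y => by simp)
  exact h3.const_mul _

/-- The terms of the expansion of a composed symbol. -/
noncomputable def expTerm {n M : ℕ} (i : ExpIdx n M) (a g : Rn n × Rn n → ℂ) (p : Rn n × Rn n) : ℂ :=
  ∫ y, expKer i y * (dirD ((expWordXi i).map (dir n)) a (p + (0, y.1 • y.2.2)) *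
    dirD ((expWordX i).map (dir n)) g (p + (y.2.1, 0))) ∂mu3 n

lemma dirD_prodMk_left {g : Rn n × Rn n → ℂ} (hg : ContDiff ℝ ∞ g) (x η : Rn n)
    (w : List (Fin n)) (z : Rn n) :
    dirD (w.map (bas n)) (fun z => g (x + z, η)) z =
      dirD ((w.map Sum.inl).map (dir n)) g ((x, η) + (z, 0)) := by
  have h1 := congrFun (dirD_comp_affine hg (ContinuousLinearMap.inl ℝ (Rn n) (Rn n)) (x, η)
    (w.map (bas n))) z
  simp only [ContinuousLinearMap.inl_apply, Prod.mk_add_mk, zero_add, List.map_map] at h1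
  simp only [Prod.mk_add_mk, add_zero, List.map_map]
  rw [add_comm x z]
  simp only [add_comm x]
  rw [h1]
  congr 2
  funext i
  simp

lemma dirD_prodMk_right {g : Rn n × Rn n → ℂ} (hg : ContDiff ℝ ∞ g) (x η : Rn n)
    (w : List (Fin n)) (z : Rn n) :
    dirD (w.map (bas n)) (fun z => g (x, η + z)) z =
      dirD ((w.map Sum.inr).map (dir n)) g ((x, η) + (0, z)) := by
  have h1 := congrFun (dirD_comp_affine hg (ContinuousLinearMap.inr ℝ (Rn n) (Rn n)) (x, η)
    (w.map (bas n))) z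
  simp only [ContinuousLinearMap.inr_apply, Prod.mk_add_mk, zero_add, List.map_map] at h1
  simp only [Prod.mk_add_mk, add_zero, List.map_map]
  rw [add_comm η z]
  simp only [add_comm η]
  rw [h1]
  congr 2
  funext i
  simp

lemma bddSmooth_prodMk_right {a : Rn n × Rn n → ℂ} (ha : BddSmooth (dir n) a) (x η : Rn n) :
    BddSmooth (bas n) fun θ => a (x, η + θ) :=
  ⟨ha.1.comp (contDiff_const.prodMk (contDiff_const.add contDiff_id)), fun w => by
    obtain ⟨C, hC⟩ := ha.2 (w.map Sum.inr)
    exact ⟨C, fun θ => by rw [dirD_prodMk_right ha.1]; exact hC _⟩⟩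

/-- The symbol of a composition, for a second symbol with compact support in the space variable. -/
theorem integral_mul_fourier_eq_expansion {M : ℕ} (hM : n < 2 * M) {a g : Rn n × Rn n → ℂ}
    (ha : BddSmooth (dir n) a) (hg : ContDiff ℝ ∞ g)
    (hgs : ∀ x η, HasCompactSupport fun z => g (x + z, η)) (x η : Rn n) :
    ∫ θ, a (x, η + θ) * 𝓕 (fun z => g (x + z, η)) θ =
      a (x, η) * g (x, η) + ∑ i : ExpIdx n M, expTerm i a g (x, η) := by
  have hf := bddSmooth_prodMk_right ha x η
  have hφ : ContDiff ℝ ∞ fun z => g (x + z, η) :=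
    hg.comp ((contDiff_const.add contDiff_id).prodMk contDiff_const)
  rw [integral_mul_fourier_eq_add hf hφ (hgs x η)]
  simp only [add_zero]
  congr 1
  rw [Fintype.sum_prod_type]
  refine Finset.sum_congr rfl fun j _ => ?_
  have hexp : ∀ t : ℝ, (2 * π * Complex.I)⁻¹ * ∫ θ, dirD [bas n j] (fun θ => a (x, η + θ)) (t • θ) *
      𝓕 (dirD [bas n j] fun z => g (x + z, η)) θ =
      ∑ σ : Fin M → Option (Fin n), ∑ τ : (Σ τ : Fin M → Option (Fin n), Fin (splits (lapWord τ)).length),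
        ∫ z, ∫ θ, expKer (j, σ, τ) (t, z, θ) *
          (dirD ((expWordXi (j, σ, τ)).map (dir n)) a ((x, η) + (0, t • θ)) *
            dirD ((expWordX (j, σ, τ)).map (dir n)) g ((x, η) + (z, 0))) := by
    intro t
    have hj : BddSmooth (bas n) (dirD [bas n j] fun θ => a (x, η + θ)) := bddSmooth_dirD hf [j]
    rw [integral_mul_fourier_eq_sum hM (bddSmooth_comp_smul hj t) (contDiff_dirD hφ _)
      (hasCompactSupport_dirD (hgs x η) _), Finset.mul_sum]
    refine Finset.sum_congr rfl fun σ _ => ?_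
    rw [Finset.mul_sum, Fintype.sum_sigma]
    refine Finset.sum_congr rfl fun τ _ => ?_
    rw [Finset.mul_sum]
    refine Finset.sum_congr rfl fun i _ => ?_
    rw [← integral_const_mul]
    refine integral_congr_ae (Filter.Eventually.of_forall fun z => ?_)
    simp only []
    rw [← integral_const_mul]
    refine integral_congr_ae (Filter.Eventually.of_forall fun θ => ?_)
    simp only []
    have e1 := dirD_prodMk_right ha.1 x η ((splits (lapWord τ))[i].1 ++ [j]) (t • θ)
    have e2 := dirD_prodMk_left hg x η (lapWord σ ++ [j]) z
    rw [List.map_append, dirD_append] at e1 e2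
    rw [dirD_comp_smul hj.1]
    simp only [List.map_singleton] at e1 e2
    rw [e1, e2]
    simp only [expKer, expWordXi, expWordX]
    ring
  simp only [hexp]
  have hint : ∀ i : ExpIdx n M, Integrable (fun y : ℝ × Rn n × Rn n => expKer i y *
      (dirD ((expWordXi i).map (dir n)) a ((x, η) + (0, y.1 • y.2.2)) *
        dirD ((expWordX i).map (dir n)) g ((x, η) + (y.2.1, 0)))) (mu3 n) := by
    intro i
    obtain ⟨C₁, hC₁⟩ := ha.2 (expWordXi i)
    -- No global bound of g is at hand; for fixed (x, η) the compact support in z provides one.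
    have hgc : HasCompactSupport (dirD ((lapWord i.2.1 ++ [i.1]).map (bas n))
      fun z => g (x + z, η)) := hasCompactSupport_dirD (hgs x η) _
    obtain ⟨C₂, hC₂⟩ := hgc.exists_bound_of_continuous (continuous_dirD hφ _)
    refine (integrable_expKer hM i).mul_bdd (c := C₁ * C₂) ?_ (Filter.Eventually.of_forall fun y => ?_)
    · exact (((continuous_dirD ha.1 _).comp (by fun_prop)).mul
        ((continuous_dirD hg _).comp (by fun_prop))).aestronglyMeasurable
    · rw [norm_mul]
      have := hC₂ y.2.1
      rw [dirD_prodMk_left hg] at this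
      exact mul_le_mul (hC₁ _) this (norm_nonneg _) ((norm_nonneg _).trans (hC₁ 0))
  have hterm : ∀ i : ExpIdx n M, expTerm i a g (x, η) = ∫ t in Set.Icc (0 : ℝ) 1, ∫ z, ∫ θ,
      expKer i (t, z, θ) * (dirD ((expWordXi i).map (dir n)) a ((x, η) + (0, t • θ)) *
        dirD ((expWordX i).map (dir n)) g ((x, η) + (z, 0))) := by
    intro i
    rw [expTerm, mu3, integral_prod _ (hint i)]
    refine integral_congr_ae ?_
    filter_upwards [(hint i).prod_right_ae] with t ht
    rw [integral_prod _ ht]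
  have hti : ∀ i : ExpIdx n M, Integrable (fun t : ℝ => ∫ z, ∫ θ,
      expKer i (t, z, θ) * (dirD ((expWordXi i).map (dir n)) a ((x, η) + (0, t • θ)) *
        dirD ((expWordX i).map (dir n)) g ((x, η) + (z, 0))))
        (volume.restrict (Set.Icc (0 : ℝ) 1)) := by
    intro i
    refine (hint i).integral_prod_left.congr ?_
    filter_upwards [(hint i).prod_right_ae] with t ht
    rw [integral_prod _ ht]
  simp only [hterm]
  rw [Fintype.sum_prod_type, integral_finsetSum _ fun σ _ => integrable_finsetSum _ fun τ _ =>
    hti (j, σ, τ)]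
  refine Finset.sum_congr rfl fun σ _ => ?_
  rw [integral_finsetSum _ fun τ _ => hti (j, σ, τ)]

end Expansion

/-! ### Bounds for the terms of the expansion -/

section ExpansionBounds

variable {n : ℕ}

lemma dirD_comp_add_right {P : Type*} [NormedAddCommGroup P] [NormedSpace ℝ P] {f : P → ℂ}
    (hf : ContDiff ℝ ∞ f) (c : P) (l : List P) (p : P) :
    dirD l (fun p => f (p + c)) p = dirD l f (p + c) := by
  have := congrFun (dirD_comp_affine hf (ContinuousLinearMap.id ℝ P) c l) p
  simpa using this

/-- The integrand of a term of the expansion. -/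
noncomputable def expInt {M : ℕ} (i : ExpIdx n M) (a g : Rn n × Rn n → ℂ) (p : Rn n × Rn n)
    (y : ℝ × Rn n × Rn n) : ℂ :=
  expKer i y * (dirD ((expWordXi i).map (dir n)) a (p + (0, y.1 • y.2.2)) *
    dirD ((expWordX i).map (dir n)) g (p + (y.2.1, 0)))

lemma contDiff_expInt {M : ℕ} (i : ExpIdx n M) {a g : Rn n × Rn n → ℂ} (ha : ContDiff ℝ ∞ a)
    (hg : ContDiff ℝ ∞ g) (y : ℝ × Rn n × Rn n) : ContDiff ℝ ∞ fun p => expInt i a g p y :=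
  contDiff_const.mul (((contDiff_dirD ha _).comp (contDiff_id.add contDiff_const)).mul
    ((contDiff_dirD hg _).comp (contDiff_id.add contDiff_const)))

lemma dirD_expInt {M : ℕ} (i : ExpIdx n M) {a g : Rn n × Rn n → ℂ} (ha : ContDiff ℝ ∞ a)
    (hg : ContDiff ℝ ∞ g) (w : List (Fin n ⊕ Fin n)) (y : ℝ × Rn n × Rn n) (p : Rn n × Rn n) :
    dirD (w.map (dir n)) (fun p => expInt i a g p y) p = ∑ j : Fin (splits w).length,
      expKer i y * (dirD (((splits w)[j].1 ++ expWordXi i).map (dir n)) a (p + (0, y.1 • y.2.2)) *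
        dirD (((splits w)[j].2 ++ expWordX i).map (dir n)) g (p + (y.2.1, 0))) := by
  have h1 : ContDiff ℝ ∞ fun p : Rn n × Rn n =>
      dirD ((expWordXi i).map (dir n)) a (p + (0, y.1 • y.2.2)) :=
    (contDiff_dirD ha _).comp (contDiff_id.add contDiff_const)
  have h2 : ContDiff ℝ ∞ fun p : Rn n × Rn n =>
      dirD ((expWordX i).map (dir n)) g (p + (y.2.1, 0)) :=
    (contDiff_dirD hg _).comp (contDiff_id.add contDiff_const)
  simp only [expInt]
  rw [dirD_const_mul (h1.mul h2)]
  simp only []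
  rw [dirD_mul_eq_sum _ h1 h2, Finset.mul_sum]
  refine Finset.sum_congr rfl fun j _ => ?_
  rw [dirD_comp_add_right (contDiff_dirD ha _), dirD_comp_add_right (contDiff_dirD hg _),
    ← dirD_append, ← dirD_append, List.map_append, List.map_append]

/-- The weight ρ survives unchanged because g is translated only in the space variable, while a,
which is translated in frequency, has bounds without weight. No comparison of ⟨ξ⟩ at different
points is needed. -/
lemma norm_dirD_expInt_le {M : ℕ} (i : ExpIdx n M) {a g : Rn n × Rn n → ℂ} (ha : ContDiff ℝ ∞ a)
    (hg : ContDiff ℝ ∞ g) {c₁ c₂ : List (Fin n ⊕ Fin n) → ℝ} {ρ : Rn n → ℝ}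
    (h₁ : ∀ w p, ‖dirD (w.map (dir n)) a p‖ ≤ c₁ w)
    (h₂ : ∀ w p, ‖dirD (w.map (dir n)) g p‖ ≤ c₂ w * ρ p.2)
    (w : List (Fin n ⊕ Fin n)) (y : ℝ × Rn n × Rn n) (p : Rn n × Rn n) :
    ‖dirD (w.map (dir n)) (fun p => expInt i a g p y) p‖ ≤ ‖expKer i y‖ *
      ((∑ j : Fin (splits w).length, c₁ ((splits w)[j].1 ++ expWordXi i) *
        c₂ ((splits w)[j].2 ++ expWordX i)) * ρ p.2) := by
  rw [dirD_expInt i ha hg, Finset.sum_mul, Finset.mul_sum]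
  refine (norm_sum_le _ _).trans (Finset.sum_le_sum fun j _ => ?_)
  rw [norm_mul, norm_mul, mul_assoc (c₁ _)]
  refine mul_le_mul_of_nonneg_left (mul_le_mul (h₁ _ _) ?_ (norm_nonneg _)
    ((norm_nonneg _).trans (h₁ _ 0))) (norm_nonneg _)
  have := h₂ ((splits w)[j].2 ++ expWordX i) (p + (y.2.1, 0))
  simpa using this

lemma dominated_expInt {M : ℕ} (hM : n < 2 * M) (i : ExpIdx n M) {a g : Rn n × Rn n → ℂ}
    (ha : ContDiff ℝ ∞ a) (hg : ContDiff ℝ ∞ g) {c₁ c₂ : List (Fin n ⊕ Fin n) → ℝ} {ρ : Rn n → ℝ}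
    (hρ : Continuous ρ) (hρ0 : ∀ η, 0 ≤ ρ η)
    (h₁ : ∀ w p, ‖dirD (w.map (dir n)) a p‖ ≤ c₁ w)
    (h₂ : ∀ w p, ‖dirD (w.map (dir n)) g p‖ ≤ c₂ w * ρ p.2) :
    Dominated (dir n) (mu3 n) (expInt i a g) where
  smooth := contDiff_expInt i ha hg
  meas w p := by
    simp only [dirD_expInt i ha hg]
    refine Finset.aestronglyMeasurable_fun_sum _ fun j _ =>
      (integrable_expKer hM i).aestronglyMeasurable.mul (Continuous.aestronglyMeasurable ?_)
    exact ((continuous_dirD ha _).comp (by fun_prop)).mul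
      ((continuous_dirD hg _).comp (by fun_prop))
  dom w p₀ := by
    set S := ∑ j : Fin (splits w).length, c₁ ((splits w)[j].1 ++ expWordXi i) *
        c₂ ((splits w)[j].2 ++ expWordX i) with hS
    -- Domination need only be local, so the continuity of ρ suffices although ρ may be unbounded.
    refine ⟨{p | ρ p.2 < ρ p₀.2 + 1}, ?_, fun y => ‖expKer i y‖ * (|S| * (ρ p₀.2 + 1)),
      (integrable_expKer hM i).norm.mul_const _, Filter.Eventually.of_forall fun y p hp => ?_⟩
    · exact (isOpen_lt (hρ.comp continuous_snd) continuous_const).mem_nhds (by simp)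
    · refine (norm_dirD_expInt_le i ha hg h₁ h₂ w y p).trans
        (mul_le_mul_of_nonneg_left ?_ (norm_nonneg _))
      exact mul_le_mul (le_abs_self _) (le_of_lt hp) (hρ0 _) (abs_nonneg _)

lemma contDiff_expTerm {M : ℕ} (hM : n < 2 * M) (i : ExpIdx n M) {a g : Rn n × Rn n → ℂ}
    (ha : ContDiff ℝ ∞ a) (hg : ContDiff ℝ ∞ g) {c₁ c₂ : List (Fin n ⊕ Fin n) → ℝ} {ρ : Rn n → ℝ}
    (hρ : Continuous ρ) (hρ0 : ∀ η, 0 ≤ ρ η)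
    (h₁ : ∀ w p, ‖dirD (w.map (dir n)) a p‖ ≤ c₁ w)
    (h₂ : ∀ w p, ‖dirD (w.map (dir n)) g p‖ ≤ c₂ w * ρ p.2) :
    ContDiff ℝ ∞ (expTerm i a g) :=
  (dominated_expInt hM i ha hg hρ hρ0 h₁ h₂).contDiff

lemma norm_dirD_expTerm_le {M : ℕ} (hM : n < 2 * M) (i : ExpIdx n M) {a g : Rn n × Rn n → ℂ}
    (ha : ContDiff ℝ ∞ a) (hg : ContDiff ℝ ∞ g) {c₁ c₂ : List (Fin n ⊕ Fin n) → ℝ} {ρ : Rn n → ℝ}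
    (hρ : Continuous ρ) (hρ0 : ∀ η, 0 ≤ ρ η)
    (h₁ : ∀ w p, ‖dirD (w.map (dir n)) a p‖ ≤ c₁ w)
    (h₂ : ∀ w p, ‖dirD (w.map (dir n)) g p‖ ≤ c₂ w * ρ p.2)
    (w : List (Fin n ⊕ Fin n)) (p : Rn n × Rn n) :
    ‖dirD (w.map (dir n)) (expTerm i a g) p‖ ≤ (∫ y, ‖expKer i y‖ ∂mu3 n) *
      ((∑ j : Fin (splits w).length, c₁ ((splits w)[j].1 ++ expWordXi i) *
        c₂ ((splits w)[j].2 ++ expWordX i)) * ρ p.2) := by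
  have h := congrFun ((dominated_expInt hM i ha hg hρ hρ0 h₁ h₂).dirD_integral w) p
  have h' : dirD (w.map (dir n)) (expTerm i a g) p = _ := h
  rw [h', ← integral_mul_const]
  exact norm_integral_le_of_norm_le ((integrable_expKer hM i).norm.mul_const _)
    (Filter.Eventually.of_forall fun y => norm_dirD_expInt_le i ha hg h₁ h₂ w y p)

/-- Continuity of the terms of the expansion in the second symbol. -/
lemma tendsto_expTerm {M : ℕ} (hM : n < 2 * M) (i : ExpIdx n M) {a g : Rn n × Rn n → ℂ}
    {gm : ℕ → Rn n × Rn n → ℂ} (ha : ContDiff ℝ ∞ a) (hgm : ∀ m, ContDiff ℝ ∞ (gm m))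
    {c₁ c₂ : List (Fin n ⊕ Fin n) → ℝ} {ρ : Rn n → ℝ}
    (h₁ : ∀ w p, ‖dirD (w.map (dir n)) a p‖ ≤ c₁ w)
    (h₂ : ∀ m w p, ‖dirD (w.map (dir n)) (gm m) p‖ ≤ c₂ w * ρ p.2)
    (hlim : ∀ p, ∀ᶠ m in Filter.atTop, gm m =ᶠ[nhds p] g) (p : Rn n × Rn n) :
    Filter.Tendsto (fun m => expTerm i a (gm m) p) Filter.atTop (nhds (expTerm i a g p)) := by
  refine tendsto_integral_of_dominated_convergence (fun y => ‖expKer i y‖ *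
      ((∑ j : Fin (splits ([] : List (Fin n ⊕ Fin n))).length,
        c₁ ((splits [])[j].1 ++ expWordXi i) * c₂ ((splits [])[j].2 ++ expWordX i)) * ρ p.2))
    (fun m => ?_) ((integrable_expKer hM i).norm.mul_const _) (fun m =>
      Filter.Eventually.of_forall fun y => norm_dirD_expInt_le i ha (hgm m) h₁ (h₂ m) [] y p)
    (Filter.Eventually.of_forall fun y => ?_)
  · exact (integrable_expKer hM i).aestronglyMeasurable.mul (Continuous.aestronglyMeasurable
      (((continuous_dirD ha _).comp (by fun_prop)).mul
        ((continuous_dirD (hgm m) _).comp (by fun_prop))))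
  -- At a fixed point the integrand is eventually constant in m, since `gm m` agrees with g near the
  -- point where it is differentiated.
  · refine tendsto_nhds_of_eventually_eq ?_
    filter_upwards [hlim (p + (y.2.1, 0))] with m hm
    rw [(dirD_eventuallyEq hm _).eq_of_nhds]

end ExpansionBounds

/-! ### The remainder of a composition -/

section Remainder

variable {n : ℕ}

/-- The half of the number of derivatives in the weights of the expansion. -/
def halfOrder (n : ℕ) : ℕ := n / 2 + 1

lemma lt_two_mul_halfOrder (n : ℕ) : n < 2 * halfOrder n := by
  rw [halfOrder]; omega

/-- One derivative comes from Taylor's formula, and at most 2M from (1-Δ)^M. -/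
lemma length_expWordXi {M : ℕ} (i : ExpIdx n M) :
    1 ≤ (expWordXi i).length ∧ (expWordXi i).length ≤ 2 * M + 1 := by
  have h1 := length_of_mem_splits (List.getElem_mem (l := splits (lapWord i.2.2.1)) i.2.2.2.2)
  have h2 := length_lapWord_le i.2.2.1
  simp only [expWordXi, List.length_map, List.length_append, List.length_singleton,
    Fin.getElem_fin] at h1 ⊢
  omega

lemma length_expWordX {M : ℕ} (i : ExpIdx n M) :
    1 ≤ (expWordX i).length ∧ (expWordX i).length ≤ 2 * M + 1 := by
  have h2 := length_lapWord_le i.2.1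
  simp only [expWordX, List.length_map, List.length_append, List.length_singleton]
  omega

/-- The symbol `a(√h x, -2π√h η)`. -/
noncomputable def halfScaled (h : ℝ) (a : Rn n → Rn n → ℂ) : Rn n × Rn n → ℂ :=
  fun p => unc a (dilation n (√h) (-(2 * π * √h)) p + 0)

lemma halfScaled_apply (h : ℝ) (a : Rn n → Rn n → ℂ) (p : Rn n × Rn n) :
    halfScaled h a p = a (√h • p.1) ((-(2 * π * √h)) • p.2) := by
  simp [halfScaled, dilation_apply, unc]

lemma contDiff_halfScaled (h : ℝ) {a : Rn n → Rn n → ℂ} (ha : ContDiff ℝ ∞ (unc a)) :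
    ContDiff ℝ ∞ (halfScaled h a) :=
  ha.comp ((dilation n _ _).contDiff.add contDiff_const)

lemma norm_dirD_halfScaled_le {h : ℝ} {a : Rn n → Rn n → ℂ} {k : ℝ}
    {C : (Fin n → ℕ) → (Fin n → ℕ) → ℝ} (ha : SymbolBound k a C) (w : List (Fin n ⊕ Fin n))
    (p : Rn n × Rn n) :
    ‖dirD (w.map (dir n)) (halfScaled h a) p‖ ≤
      ((2 * π * √h) ^ w.length * C (cntXi w) (cntX w)) * japBr ((2 * π * √h) • p.2) ^ k := by
  have hε : 0 ≤ √h := Real.sqrt_nonneg h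
  refine (norm_dirD_dilation_le ha.contDiff (K := 2 * π * √h) ?_ ?_ w 0 p).trans ?_
  · rw [abs_of_nonneg hε]
    exact le_mul_of_one_le_left hε (by nlinarith [Real.pi_gt_three])
  · rw [abs_neg, abs_of_nonneg (by positivity)]
  · rw [mul_assoc ((2 * π * √h) ^ w.length)]
    refine mul_le_mul_of_nonneg_left ?_ (by positivity)
    have h1 := ha.norm_dirD_le w (dilation n (√h) (-(2 * π * √h)) p + 0)
    have h2 : japBr (dilation n (√h) (-(2 * π * √h)) p + 0).2 = japBr ((2 * π * √h) • p.2) := by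
      simp [dilation_apply, japBr]
    rwa [h2] at h1

lemma continuous_japBr_rpow (k : ℝ) : Continuous fun ξ : Rn n => japBr ξ ^ k := by
  refine Continuous.rpow_const ?_ fun ξ => Or.inl (japBr_pos ξ).ne'
  unfold japBr
  fun_prop

lemma continuous_japBr_smul_rpow (c k : ℝ) : Continuous fun η : Rn n => japBr (c • η) ^ k :=
  (continuous_japBr_rpow k).comp (continuous_const_smul c)

/-- The sum of the terms of the expansion, with the two symbols scaled by `√h`. -/
noncomputable def remSum (A G : Rn n × Rn n → ℂ) (p : Rn n × Rn n) : ℂ :=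
  ∑ i : ExpIdx n (halfOrder n), expTerm i A G p

/-- The symbol of `Op_h(a₁) Op_h(a₂) - Op_h(a₁a₂)`. -/
noncomputable def remainder (h : ℝ) (a₁ a₂ : Rn n → Rn n → ℂ) (x ξ : Rn n) : ℂ :=
  remSum (halfScaled h a₁) (halfScaled h a₂) ((√h)⁻¹ • x, (-(2 * π * √h)⁻¹) • ξ)

/-- The constants in the bounds for the remainder. -/
noncomputable def remBound (h : ℝ) (C₁ C₂ : (Fin n → ℕ) → (Fin n → ℕ) → ℝ)
    (w : List (Fin n ⊕ Fin n)) : ℝ :=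
  (√h)⁻¹ ^ w.length * ∑ i : ExpIdx n (halfOrder n), (∫ y, ‖expKer i y‖ ∂mu3 n) *
    ∑ j : Fin (splits w).length,
      ((2 * π * √h) ^ ((splits w)[j].1 ++ expWordXi i).length *
        C₁ (cntXi ((splits w)[j].1 ++ expWordXi i)) (cntX ((splits w)[j].1 ++ expWordXi i))) *
      ((2 * π * √h) ^ ((splits w)[j].2 ++ expWordX i).length *
        C₂ (cntXi ((splits w)[j].2 ++ expWordX i)) (cntX ((splits w)[j].2 ++ expWordX i)))

variable {h k : ℝ} {a₁ a₂ : Rn n → Rn n → ℂ} {C₁ C₂ : (Fin n → ℕ) → (Fin n → ℕ) → ℝ}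

lemma SymbolBound.norm_dirD_halfScaled_le_of_zero (h₁ : SymbolBound 0 a₁ C₁)
    (w : List (Fin n ⊕ Fin n)) (p : Rn n × Rn n) :
    ‖dirD (w.map (dir n)) (halfScaled h a₁) p‖ ≤
      (2 * π * √h) ^ w.length * C₁ (cntXi w) (cntX w) := by
  simpa using norm_dirD_halfScaled_le (h := h) h₁ w p

lemma contDiff_remSum (h₁ : SymbolBound 0 a₁ C₁) (h₂ : SymbolBound k a₂ C₂) :
    ContDiff ℝ ∞ (remSum (halfScaled h a₁) (halfScaled h a₂)) :=
  ContDiff.sum fun i _ => contDiff_expTerm (lt_two_mul_halfOrder n) i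
    (contDiff_halfScaled h h₁.contDiff) (contDiff_halfScaled h h₂.contDiff)
    (continuous_japBr_smul_rpow _ k) (fun _ => Real.rpow_nonneg (japBr_pos _).le _)
    h₁.norm_dirD_halfScaled_le_of_zero (norm_dirD_halfScaled_le h₂)

lemma unc_remainder (h : ℝ) (a₁ a₂ : Rn n → Rn n → ℂ) : unc (remainder h a₁ a₂) = fun p =>
    remSum (halfScaled h a₁) (halfScaled h a₂)
      (dilation n (√h)⁻¹ (-(2 * π * √h)⁻¹) p + 0) := by
  funext p
  rw [add_zero, dilation_apply]
  rfl

lemma contDiff_remainder (h₁ : SymbolBound 0 a₁ C₁) (h₂ : SymbolBound k a₂ C₂) :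
    ContDiff ℝ ∞ (unc (remainder h a₁ a₂)) := by
  rw [unc_remainder]
  exact (contDiff_remSum h₁ h₂).comp ((dilation n _ _).contDiff.add contDiff_const)

/-- The expansion is bounded in the dilated variables. Undoing the dilation costs at most (√h)⁻¹ per
derivative and turns the dilated weight back into ⟨ξ⟩^k. -/
lemma norm_dirD_remainder_le (hh : 0 < h) (h₁ : SymbolBound 0 a₁ C₁) (h₂ : SymbolBound k a₂ C₂)
    (w : List (Fin n ⊕ Fin n)) (p : Rn n × Rn n) :
    ‖dirD (w.map (dir n)) (unc (remainder h a₁ a₂)) p‖ ≤ remBound h C₁ C₂ w * japBr p.2 ^ k := by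
  have hε : 0 < √h := Real.sqrt_pos.2 hh
  rw [unc_remainder]
  refine (norm_dirD_dilation_le (contDiff_remSum h₁ h₂) (K := (√h)⁻¹) ?_ ?_ w 0 p).trans ?_
  · rw [abs_of_pos (by positivity)]
  · rw [abs_neg, abs_of_pos (by positivity)]
    refine inv_anti₀ hε ?_
    nlinarith [Real.pi_gt_three]
  rw [remBound, mul_assoc ((√h)⁻¹ ^ w.length)]
  refine mul_le_mul_of_nonneg_left ?_ (by positivity)
  have hρ : japBr p.2 ^ k =
      japBr ((2 * π * √h) • (dilation n (√h)⁻¹ (-(2 * π * √h)⁻¹) p + 0).2) ^ k := by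
    rw [add_zero, dilation_apply, smul_smul, mul_neg, mul_inv_cancel₀ (by positivity)]
    simp [japBr]
  rw [hρ]
  have hsm : ∀ i : ExpIdx n (halfOrder n), ContDiff ℝ ∞
      (expTerm i (halfScaled h a₁) (halfScaled h a₂)) := fun i =>
    contDiff_expTerm (lt_two_mul_halfOrder n) i
    (contDiff_halfScaled h h₁.contDiff) (contDiff_halfScaled h h₂.contDiff)
    (continuous_japBr_smul_rpow _ k) (fun _ => Real.rpow_nonneg (japBr_pos _).le _)
    h₁.norm_dirD_halfScaled_le_of_zero (norm_dirD_halfScaled_le h₂)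
  unfold remSum
  rw [dirD_sum _ fun i _ => hsm i, Finset.sum_mul]
  refine (norm_sum_le _ _).trans (Finset.sum_le_sum fun i _ => ?_)
  rw [mul_assoc (∫ y, ‖expKer i y‖ ∂mu3 n)]
  exact norm_dirD_expTerm_le (lt_two_mul_halfOrder n) i
    (contDiff_halfScaled h h₁.contDiff) (contDiff_halfScaled h h₂.contDiff)
    (continuous_japBr_smul_rpow _ k) (fun _ => Real.rpow_nonneg (japBr_pos _).le _)
    h₁.norm_dirD_halfScaled_le_of_zero (norm_dirD_halfScaled_le h₂) w _

/-- The constant that bounds the remainder in terms of `compSum`. -/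
noncomputable def remConst (n s : ℕ) : ℝ :=
  (∑ i : ExpIdx n (halfOrder n), ∫ y, ‖expKer i y‖ ∂mu3 n) * (2 ^ s * (2 * π) ^ (s + 2 * n + 6))

/-- Every product of constants that occurs is a term of `compSum`: both words are nonempty, and
together they have at most s + 2(2M+1) ≤ s + 2n + 6 letters because 2M ≤ n + 2. One unit of the
allowed order remains unused. -/
lemma remBound_le (hh : 0 < h) (hC₁ : ∀ α β, 0 ≤ C₁ α β) (hC₂ : ∀ α β, 0 ≤ C₂ α β) {s : ℕ}
    (w : List (Fin n ⊕ Fin n)) (hw : w.length ≤ s) :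
    remBound h C₁ C₂ w ≤ (√h)⁻¹ ^ w.length * (remConst n s * compSum (2 * n + 7 + s) h C₁ C₂) := by
  have hε : 0 < √h := Real.sqrt_pos.2 hh
  have h2π : (1 : ℝ) ≤ 2 * π := by nlinarith [Real.pi_gt_three]
  rw [remBound, remConst]
  refine mul_le_mul_of_nonneg_left ?_ (by positivity)
  rw [Finset.sum_mul, Finset.sum_mul]
  refine Finset.sum_le_sum fun i _ => ?_
  rw [mul_assoc (∫ y, ‖expKer i y‖ ∂mu3 n)]
  refine mul_le_mul_of_nonneg_left ?_ (integral_nonneg fun y => norm_nonneg (expKer i y))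
  have hS : 0 ≤ compSum (2 * n + 7 + s) h C₁ C₂ := Finset.sum_nonneg fun _ _ =>
    mul_nonneg (mul_nonneg (Real.rpow_nonneg hh.le _) (hC₁ _ _)) (hC₂ _ _)
  have hterm : ∀ j : Fin (splits w).length,
      ((2 * π * √h) ^ ((splits w)[j].1 ++ expWordXi i).length *
        C₁ (cntXi ((splits w)[j].1 ++ expWordXi i)) (cntX ((splits w)[j].1 ++ expWordXi i))) *
      ((2 * π * √h) ^ ((splits w)[j].2 ++ expWordX i).length *
        C₂ (cntXi ((splits w)[j].2 ++ expWordX i)) (cntX ((splits w)[j].2 ++ expWordX i))) ≤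
      (2 * π) ^ (s + 2 * n + 6) * compSum (2 * n + 7 + s) h C₁ C₂ := by
    intro j
    have hl := length_of_mem_splits (List.getElem_mem (l := splits w) j.2)
    have hl1 := length_expWordXi i
    have hl2 := length_expWordX i
    have hho : 2 * halfOrder n ≤ n + 2 := by rw [halfOrder]; omega
    simp only [Fin.getElem_fin] at hl ⊢
    set u₁ := (splits w)[(j : ℕ)].1 ++ expWordXi i with hu₁
    set u₂ := (splits w)[(j : ℕ)].2 ++ expWordX i with hu₂
    have e1 : u₁.length = (splits w)[(j : ℕ)].1.length + (expWordXi i).length := by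
      rw [hu₁, List.length_append]
    have e2 : u₂.length = (splits w)[(j : ℕ)].2.length + (expWordX i).length := by
      rw [hu₂, List.length_append]
    have h3 := term_le_compSum (s := 2 * n + 7 + s) hh.le hC₁ hC₂ u₁ u₂ (by omega) (by omega)
      (by omega)
    calc _ = (2 * π) ^ (u₁.length + u₂.length) * (√h ^ (u₁.length + u₂.length) *
          C₁ (cntXi u₁) (cntX u₁) * C₂ (cntXi u₂) (cntX u₂)) := by
          simp only [mul_pow, pow_add]; ring
      _ ≤ _ := mul_le_mul (pow_le_pow_right₀ h2π (by omega)) h3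
          (mul_nonneg (mul_nonneg (by positivity) (hC₁ _ _)) (hC₂ _ _)) (by positivity)
  calc _ ≤ ∑ _j : Fin (splits w).length,
        (2 * π) ^ (s + 2 * n + 6) * compSum (2 * n + 7 + s) h C₁ C₂ :=
        Finset.sum_le_sum fun j _ => hterm j
    _ = 2 ^ w.length * ((2 * π) ^ (s + 2 * n + 6) * compSum (2 * n + 7 + s) h C₁ C₂) := by
        rw [Finset.sum_const, Finset.card_univ, Fintype.card_fin, length_splits, nsmul_eq_mul]
        push_cast
        rfl
    _ ≤ 2 ^ s * ((2 * π) ^ (s + 2 * n + 6) * compSum (2 * n + 7 + s) h C₁ C₂) := by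
        gcongr
        norm_num
    _ = _ := by ring

/-- The constants of the remainder as a symbol of order `k`. -/
noncomputable def remSymb (s : ℕ) (h : ℝ) (C₁ C₂ : (Fin n → ℕ) → (Fin n → ℕ) → ℝ)
    (α β : Fin n → ℕ) : ℝ :=
  -- Only these indices enter `boundSum` at level s. The other branch is needed because a symbol
  -- must have constants for all multi-indices.
  if len α + len β ≤ s then
    (√h)⁻¹ ^ (len α + len β) * (remConst n s * compSum (2 * n + 7 + s) h C₁ C₂)
  else remBound h C₁ C₂ (wordOf α β)

lemma symbolBound_remainder (hh : 0 < h) (h₁ : SymbolBound 0 a₁ C₁) (h₂ : SymbolBound k a₂ C₂)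
    (s : ℕ) : SymbolBound k (remainder h a₁ a₂) (remSymb s h C₁ C₂) := by
  refine SymbolBound.of_dirD (contDiff_remainder h₁ h₂) fun α β p => ?_
  refine (norm_dirD_remainder_le hh h₁ h₂ _ p).trans ?_
  refine mul_le_mul_of_nonneg_right ?_ (Real.rpow_nonneg (japBr_pos _).le _)
  rw [remSymb]
  split_ifs with hs
  · have := remBound_le hh h₁.nonneg h₂.nonneg (s := s) (wordOf α β) (by rwa [length_wordOf])
    rwa [length_wordOf] at this
  · exact le_rfl

/-- The powers of h in `boundSum` cancel the negative powers of √h from undoing the dilation, so all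
summands are equal. -/
lemma boundSum_remSymb (hh : 0 < h) (s : ℕ) (C₁ C₂ : (Fin n → ℕ) → (Fin n → ℕ) → ℝ) :
    boundSum s h (remSymb s h C₁ C₂) =
      ((multiIdx n s ×ˢ multiIdx n s).filter (fun p => len p.1 + len p.2 ≤ s)).card *
        (remConst n s * compSum (2 * n + 7 + s) h C₁ C₂) := by
  have hε : 0 < √h := Real.sqrt_pos.2 hh
  rw [boundSum, ← nsmul_eq_mul, ← Finset.sum_const]
  refine Finset.sum_congr rfl fun p hp => ?_
  have hp' := (Finset.mem_filter.1 hp).2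
  have h1 : h ^ (((len p.1 + len p.2 : ℕ) : ℝ) / 2) = √h ^ (len p.1 + len p.2) := by
    rw [Real.sqrt_eq_rpow, ← Real.rpow_mul_natCast hh.le]
    congr 1
    ring
  rw [remSymb, if_pos hp', h1, ← mul_assoc, ← mul_pow, mul_inv_cancel₀ hε.ne', one_pow, one_mul]

lemma exists_symbolBound_mul (h₁ : SymbolBound 0 a₁ C₁) (h₂ : SymbolBound k a₂ C₂) :
    ∃ C, SymbolBound k (fun x ξ => a₁ x ξ * a₂ x ξ) C := by
  refine ⟨fun α β => ∑ j : Fin (splits (wordOf α β)).length,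
    C₁ (cntXi (splits (wordOf α β))[j].1) (cntX (splits (wordOf α β))[j].1) *
      C₂ (cntXi (splits (wordOf α β))[j].2) (cntX (splits (wordOf α β))[j].2),
    SymbolBound.of_dirD (h₁.contDiff.mul h₂.contDiff) fun α β p => ?_⟩
  rw [unc_mul, dirD_mul_eq_sum _ h₁.contDiff h₂.contDiff, Finset.sum_mul]
  refine (norm_sum_le _ _).trans (Finset.sum_le_sum fun j _ => ?_)
  rw [norm_mul, mul_assoc]
  have h3 := h₁.norm_dirD_le (splits (wordOf α β))[j].1 p
  rw [Real.rpow_zero, mul_one] at h3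
  exact mul_le_mul h3 (h₂.norm_dirD_le _ p) (norm_nonneg _) (h₁.nonneg _ _)

end Remainder

/-! ### Composition with an operator whose symbol is compactly supported in space -/

section Compose

variable {n : ℕ}

lemma dirD_ee_inner (η : Rn n) (w : List (Fin n)) (y : Rn n) :
    dirD (w.map (bas n)) (fun y => ee (inner ℝ y η)) y =
      (w.map fun i => 2 * π * Complex.I * (η i : ℂ)).prod * ee (inner ℝ y η) := by
  induction w generalizing y with
  | nil => simp
  | cons i w ih =>
    have h1 : dirD (w.map (bas n)) (fun y => ee (inner ℝ y η)) = fun y =>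
      (w.map fun i => 2 * π * Complex.I * (η i : ℂ)).prod * ee (inner ℝ y η) := funext ih
    rw [List.map_cons, dirD_cons, h1]
    have h2 : HasFDerivAt (fun y : Rn n => ((inner ℝ y η : ℝ) : ℂ))
        (Complex.ofRealCLM.comp (innerSL ℝ η)) y := by
      have := (Complex.ofRealCLM.comp (innerSL ℝ η)).hasFDerivAt (x := y)
      refine this.congr_of_eventuallyEq (Filter.Eventually.of_forall fun z => ?_)
      simp [real_inner_comm]
    have h3 : HasFDerivAt (fun y : Rn n => ee (inner ℝ y η))
        (ee (inner ℝ y η) • ((2 * π * Complex.I) • Complex.ofRealCLM.comp (innerSL ℝ η))) y := by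
      have h4 : (fun y : Rn n => ee (inner ℝ y η)) = fun y =>
          Complex.exp ((2 * π * Complex.I) * ((inner ℝ y η : ℝ) : ℂ)) := by
        funext y
        rw [ee]
        congr 1
        push_cast
        ring
      rw [h4]
      have := (h2.const_mul (2 * π * Complex.I)).cexp
      have h5 : ee (inner ℝ y η) =
          Complex.exp ((2 * π * Complex.I) * ((inner ℝ y η : ℝ) : ℂ)) := congrFun h4 y
      rw [h5]
      exact this
    beta_reduce
    rw [(h3.const_mul _).fderiv]
    have h6 : inner ℝ η (EuclideanSpace.single i (1 : ℝ)) = η i := by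
      rw [EuclideanSpace.inner_single_right]; simp
    simp [h6]
    ring

lemma norm_dirD_ee_inner_le (η : Rn n) (w : List (Fin n)) (y : Rn n) :
    ‖dirD (w.map (bas n)) (fun y => ee (inner ℝ y η)) y‖ ≤ (2 * π * ‖η‖) ^ w.length := by
  rw [dirD_ee_inner, norm_mul, norm_ee, mul_one]
  induction w with
  | nil => simp
  | cons i w ih =>
    rw [List.map_cons, List.prod_cons, norm_mul, List.length_cons, pow_succ']
    refine mul_le_mul ?_ ih (norm_nonneg _) (by positivity)
    have := PiLp.norm_apply_le η i
    simp only [norm_mul, Complex.norm_I, Complex.norm_real, mul_one, Complex.norm_ofNat]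
    rw [Real.norm_of_nonneg Real.pi_pos.le]
    exact mul_le_mul_of_nonneg_left this (by positivity)

lemma dirD_fst {g : Rn n × Rn n → ℂ} (hg : ContDiff ℝ ∞ g) (η : Rn n) (w : List (Fin n))
    (y : Rn n) : dirD (w.map (bas n)) (fun y => g (y, η)) y =
      dirD ((w.map Sum.inl).map (dir n)) g (y, η) := by
  simpa using dirD_prodMk_left hg 0 η w y

lemma contDiff_fst_section {g : Rn n × Rn n → ℂ} (hg : ContDiff ℝ ∞ g) (η : Rn n) :
    ContDiff ℝ ∞ fun y => g (y, η) := hg.comp (contDiff_id.prodMk contDiff_const)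

variable {B : Rn n × Rn n → ℂ} {ρ : Rn n → ℝ} {c : List (Fin n ⊕ Fin n) → ℝ} {F : Rn n → ℂ}

/-- Derivatives in x that fall on the exponential produce powers of η, which the decay of F absorbs.
-/
lemma contDiff_knOp (hB : ContDiff ℝ ∞ B) (hρ0 : ∀ η, 0 ≤ ρ η)
    (hc : ∀ w p, ‖dirD (w.map (dir n)) B p‖ ≤ c w * ρ p.2) (hFc : Continuous F)
    (hF : ∀ N : ℕ, Integrable fun η => ρ η * (1 + ‖η‖) ^ N * ‖F η‖) :
    ContDiff ℝ ∞ (knOp B F) := by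
  have hes : ∀ η : Rn n, ContDiff ℝ ∞ fun y : Rn n => ee (inner ℝ y η) := fun η =>
    contDiff_ee.comp (contDiff_id.inner ℝ contDiff_const)
  have hK : ∀ (w : List (Fin n)) (η y : Rn n),
      dirD (w.map (bas n)) (fun y => ee (inner ℝ y η) * B (y, η) * F η) y =
      ∑ j : Fin (splits w).length, F η * (((splits w)[j].1.map
        fun i => 2 * π * Complex.I * (η i : ℂ)).prod * ee (inner ℝ y η) *
        dirD (((splits w)[j].2.map Sum.inl).map (dir n)) B (y, η)) := by
    intro w η y
    have h1 : (fun y => ee (inner ℝ y η) * B (y, η) * F η) =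
        fun y => F η * (ee (inner ℝ y η) * B (y, η)) := by funext y; ring
    rw [h1, dirD_const_mul ((hes η).mul (contDiff_fst_section hB η))]
    simp only []
    rw [dirD_mul_eq_sum _ (hes η) (contDiff_fst_section hB η), Finset.mul_sum]
    refine Finset.sum_congr rfl fun j _ => ?_
    rw [dirD_ee_inner, dirD_fst hB]
  have hdom : Dominated (bas n) volume (fun y η => ee (inner ℝ y η) * B (y, η) * F η) := by
    refine ⟨fun η => ((hes η).mul (contDiff_fst_section hB η)).mul contDiff_const, fun w y => ?_,
      fun w y₀ => ?_⟩
    · simp only [hK]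
      refine Finset.aestronglyMeasurable_fun_sum _ fun j _ => Continuous.aestronglyMeasurable ?_
      refine hFc.mul ((Continuous.mul ?_ (by fun_prop)).mul
        ((continuous_dirD hB _).comp (by fun_prop)))
      exact continuous_list_prod _ fun i _ => by fun_prop
    · set S := ∑ j : Fin (splits w).length, (2 * π) ^ (splits w)[j].1.length *
        |c ((splits w)[j].2.map Sum.inl)| with hS
      refine ⟨Set.univ, Filter.univ_mem, _, (hF w.length).const_mul S,
        Filter.Eventually.of_forall fun η y _ => ?_⟩
      rw [hK, hS, Finset.sum_mul]
      refine (norm_sum_le _ _).trans (Finset.sum_le_sum fun j _ => ?_)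
      have hl := length_of_mem_splits (List.getElem_mem (l := splits w) j.2)
      have e1 := norm_dirD_ee_inner_le η (splits w)[j].1 y
      rw [dirD_ee_inner] at e1
      have e2 := hc ((splits w)[j].2.map Sum.inl) (y, η)
      have e3 : (2 * π * ‖η‖) ^ (splits w)[j].1.length ≤
          (2 * π) ^ (splits w)[j].1.length * (1 + ‖η‖) ^ w.length := by
        rw [mul_pow]
        refine mul_le_mul_of_nonneg_left ?_ (by positivity)
        calc ‖η‖ ^ (splits w)[j].1.length ≤ (1 + ‖η‖) ^ (splits w)[j].1.length :=
              pow_le_pow_left₀ (norm_nonneg _) (by linarith) _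
          _ ≤ _ := pow_le_pow_right₀ (by linarith [norm_nonneg η]) (by
              simp only [Fin.getElem_fin] at hl ⊢; omega)
      rw [norm_mul, norm_mul]
      calc _ ≤ ‖F η‖ * (((2 * π) ^ (splits w)[j].1.length * (1 + ‖η‖) ^ w.length) *
            (|c ((splits w)[j].2.map Sum.inl)| * ρ η)) := by
            refine mul_le_mul_of_nonneg_left (mul_le_mul (e1.trans e3) (e2.trans ?_)
              (norm_nonneg _) (by positivity)) (norm_nonneg _)
            exact mul_le_mul_of_nonneg_right (le_abs_self _) (hρ0 _)
        _ = _ := by ring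
  exact hdom.contDiff

lemma dirD_eq_zero_of_eventuallyEq {P : Type*} [NormedAddCommGroup P] [NormedSpace ℝ P] {f : P → ℂ}
    {p : P} (h : f =ᶠ[nhds p] fun _ => 0) (l : List P) : dirD l f p = 0 := by
  rw [(dirD_eventuallyEq h l).eq_of_nhds]
  have : ∀ l : List P, dirD l (fun _ : P => (0 : ℂ)) = fun _ => 0 := by
    intro l
    induction l with
    | nil => rfl
    | cons v l ih => rw [dirD_cons, ih]; simp
  rw [this]

variable {R : ℝ}

lemma hasCompactSupport_section (hR : ∀ p, R < ‖p.1‖ → B p = 0) (x η : Rn n) :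
    HasCompactSupport fun z => B (x + z, η) := by
  refine HasCompactSupport.intro (isCompact_closedBall (0 : Rn n) (R + ‖x‖)) fun z hz => hR _ ?_
  simp only [Metric.mem_closedBall, dist_zero_right, not_le] at hz
  have := norm_sub_le (x + z) x
  rw [add_sub_cancel_left] at this
  simp only
  linarith

lemma hasCompactSupport_section_zero (hR : ∀ p, R < ‖p.1‖ → B p = 0) (η : Rn n) :
    HasCompactSupport fun z => B (z, η) := by
  simpa using hasCompactSupport_section hR 0 η

/-- Decay in θ from (1-Δ)^M, with L¹ norms bounded by the volume of a ball containing the support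
times the supremum of the derivatives. The bound is uniform in η up to ρ, as needed for Fubini in
the composition. -/
lemma exists_norm_fourier_section_le (M : ℕ) (hB : ContDiff ℝ ∞ B)
    (hc : ∀ w p, ‖dirD (w.map (dir n)) B p‖ ≤ c w * ρ p.2) (hR : ∀ p, R < ‖p.1‖ → B p = 0) :
    ∃ C : ℝ, ∀ η θ, ‖𝓕 (fun z => B (z, η)) θ‖ ≤ C * ‖wt n M θ‖ * ρ η := by
  set V := (volume (Metric.closedBall (0 : Rn n) R)).toReal with hV
  refine ⟨∑ σ : Fin M → Option (Fin n), ‖lapCoef σ‖ * (V * c ((lapWord σ).map Sum.inl)),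
    fun η θ => ?_⟩
  have hs := contDiff_fst_section hB η
  have hcs := hasCompactSupport_section_zero hR η
  have hint : ∀ w : List (Fin n), ∫ z, ‖dirD (w.map (bas n)) (fun z => B (z, η)) z‖ ≤
      V * (c (w.map Sum.inl) * ρ η) := by
    intro w
    have h1 : ∀ z, ‖dirD (w.map (bas n)) (fun z => B (z, η)) z‖ ≤
        (Metric.closedBall (0 : Rn n) R).indicator (fun _ => c (w.map Sum.inl) * ρ η) z := by
      intro z
      by_cases hz : z ∈ Metric.closedBall (0 : Rn n) R
      · rw [Set.indicator_of_mem hz, dirD_fst hB]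
        exact hc _ _
      · rw [Set.indicator_of_notMem hz, dirD_eq_zero_of_eventuallyEq, norm_zero]
        filter_upwards [Metric.isClosed_closedBall.isOpen_compl.mem_nhds hz] with z' hz'
        refine hR _ ?_
        simpa using hz'
    calc _ ≤ ∫ z, (Metric.closedBall (0 : Rn n) R).indicator
          (fun _ => c (w.map Sum.inl) * ρ η) z :=
          integral_mono (integrable_dirD_of_hasCompactSupport hs hcs _).norm
            ((integrable_indicator_iff measurableSet_closedBall).2
              (integrableOn_const measure_closedBall_lt_top.ne)) h1
      _ = _ := by
          rw [integral_indicator measurableSet_closedBall, setIntegral_const, smul_eq_mul]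
          rfl
  rw [fourier_eq_wt_mul_sum hs (fun w => integrable_dirD_of_hasCompactSupport hs hcs _) M θ,
    norm_mul]
  calc _ ≤ ‖wt n M θ‖ * ∑ σ : Fin M → Option (Fin n),
        ‖lapCoef σ‖ * (V * (c ((lapWord σ).map Sum.inl) * ρ η)) := by
        refine mul_le_mul_of_nonneg_left ((norm_sum_le _ _).trans
          (Finset.sum_le_sum fun σ _ => ?_)) (norm_nonneg _)
        rw [norm_mul]
        exact mul_le_mul_of_nonneg_left ((norm_fourier_le _ _).trans (hint _)) (norm_nonneg _)
    _ = _ := by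
        rw [Finset.mul_sum, Finset.sum_mul, Finset.sum_mul]
        refine Finset.sum_congr rfl fun σ _ => ?_
        ring

lemma measurable_fourier_section (hB : Continuous B) :
    Measurable fun p : Rn n × Rn n => 𝓕 (fun z => B (z, p.1)) p.2 := by
  simp only [fourier_ee]
  have h2 : Measurable fun r : (Rn n × Rn n) × Rn n => ee (-inner ℝ r.2 r.1.2) * B (r.2, r.1.1) :=
    Continuous.measurable (by fun_prop)
  exact (h2.stronglyMeasurable.integral_prod_right (ν := volume)).measurable

/-- The Fourier transform of `knOp B F`. -/
lemma fourier_knOp (hB : ContDiff ℝ ∞ B) (hρ0 : ∀ η, 0 ≤ ρ η)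
    (hc : ∀ w p, ‖dirD (w.map (dir n)) B p‖ ≤ c w * ρ p.2) (hR : ∀ p, R < ‖p.1‖ → B p = 0)
    (hFc : Continuous F) (hF : Integrable fun η => ρ η * ‖F η‖) (ζ : Rn n) :
    𝓕 (knOp B F) ζ = ∫ η, F η * 𝓕 (fun z => B (z, η)) (ζ - η) := by
  have hint : Integrable (fun p : Rn n × Rn n =>
      ee (-inner ℝ p.1 ζ) * (ee (inner ℝ p.1 p.2) * B (p.1, p.2) * F p.2))
      (volume.prod volume) := by
    have h1 : Integrable (fun p : Rn n × Rn n =>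
        (Metric.closedBall (0 : Rn n) R).indicator (fun _ => |c []|) p.1 * (ρ p.2 * ‖F p.2‖))
        (volume.prod volume) :=
      Integrable.mul_prod ((integrable_indicator_iff measurableSet_closedBall).2
        (integrableOn_const measure_closedBall_lt_top.ne)) hF
    refine h1.mono' (Continuous.aestronglyMeasurable (by
      have := hB.continuous
      fun_prop)) (Filter.Eventually.of_forall fun p => ?_)
    rw [norm_mul, norm_mul, norm_mul, norm_ee, norm_ee, one_mul, one_mul]
    by_cases hz : p.1 ∈ Metric.closedBall (0 : Rn n) R
    · rw [Set.indicator_of_mem hz, ← mul_assoc]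
      refine mul_le_mul_of_nonneg_right ((hc [] p).trans ?_) (norm_nonneg _)
      exact mul_le_mul_of_nonneg_right (le_abs_self _) (hρ0 _)
    · rw [hR _ (by simpa using hz), norm_zero, zero_mul]
      exact mul_nonneg (Set.indicator_nonneg (fun _ _ => abs_nonneg _) _)
        (mul_nonneg (hρ0 _) (norm_nonneg _))
  rw [fourier_ee]
  simp only [knOp, ← integral_const_mul]
  rw [integral_integral_swap hint]
  refine integral_congr_ae (Filter.Eventually.of_forall fun η => ?_)
  simp only []
  rw [fourier_ee, ← integral_const_mul]
  refine integral_congr_ae (Filter.Eventually.of_forall fun y => ?_)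
  simp only []
  rw [inner_sub_right, neg_sub, sub_eq_add_neg, ee_add]
  ring

lemma ee_mul_fourier (g : Rn n → ℂ) (x θ : Rn n) :
    ee (inner ℝ x θ) * 𝓕 g θ = 𝓕 (fun z => g (x + z)) θ := by
  rw [fourier_ee, fourier_ee, ← integral_const_mul,
    ← integral_add_left_eq_self (fun y => ee (inner ℝ x θ) * (ee (-inner ℝ y θ) * g y)) x]
  refine integral_congr_ae (Filter.Eventually.of_forall fun z => ?_)
  simp only []
  rw [← mul_assoc, ← ee_add, inner_add_left]
  congr 2
  ring

/-- The symbol of the composition of two operators, the second with a symbol of compact support in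
the space variable. -/
lemma knOp_fourier_knOp (hB : ContDiff ℝ ∞ B) (hρ0 : ∀ η, 0 ≤ ρ η)
    (hc : ∀ w p, ‖dirD (w.map (dir n)) B p‖ ≤ c w * ρ p.2) (hR : ∀ p, R < ‖p.1‖ → B p = 0)
    (hFc : Continuous F) (hF : Integrable fun η => ρ η * ‖F η‖) {b : Rn n × Rn n → ℂ}
    (hb : Continuous b) {K : ℝ} (hK : ∀ p, ‖b p‖ ≤ K) (x : Rn n) :
    knOp b (𝓕 (knOp B F)) x =
      knOp (fun p => ∫ θ, b (p.1, p.2 + θ) * 𝓕 (fun z => B (p.1 + z, p.2)) θ) F x := by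
  obtain ⟨C, hC⟩ := exists_norm_fourier_section_le (halfOrder n) hB hc hR
  have hwi : Integrable (wt n (halfOrder n)) := integrable_dirD_wt (lt_two_mul_halfOrder n) []
  have hint : Integrable (fun p : Rn n × Rn n => ee (inner ℝ x p.1) * b (x, p.1) *
      (F p.2 * 𝓕 (fun z => B (z, p.2)) (p.1 - p.2))) (volume.prod volume) := by
    have h1 := (hF.convolution_integrand (ContinuousLinearMap.mul ℝ ℝ) hwi.norm (μ := volume)
      (ν := volume)).const_mul (|K| * |C|)
    refine h1.mono' ?_ (Filter.Eventually.of_forall fun p => ?_)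
    · refine (Continuous.aestronglyMeasurable (by fun_prop)).mul
        ((hFc.comp continuous_snd).aestronglyMeasurable.mul ?_)
      exact ((measurable_fourier_section hB.continuous).comp
        (measurable_snd.prodMk (measurable_fst.sub measurable_snd))).aestronglyMeasurable
    · rw [norm_mul, norm_mul, norm_mul, norm_ee, one_mul, ContinuousLinearMap.mul_apply']
      have h2 : ‖𝓕 (fun z => B (z, p.2)) (p.1 - p.2)‖ ≤
          |C| * ‖wt n (halfOrder n) (p.1 - p.2)‖ * ρ p.2 :=
        (hC _ _).trans (mul_le_mul_of_nonneg_right (mul_le_mul_of_nonneg_right (le_abs_self _)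
          (norm_nonneg _)) (hρ0 _))
      calc _ ≤ |K| * (‖F p.2‖ * (|C| * ‖wt n (halfOrder n) (p.1 - p.2)‖ * ρ p.2)) :=
            mul_le_mul ((hK _).trans (le_abs_self _))
              (mul_le_mul_of_nonneg_left h2 (norm_nonneg _)) (by positivity) (abs_nonneg _)
        _ = _ := by ring
  rw [knOp]
  simp only [fourier_knOp hB hρ0 hc hR hFc hF, ← integral_const_mul]
  rw [integral_integral_swap hint, knOp]
  refine integral_congr_ae (Filter.Eventually.of_forall fun η => ?_)
  simp only []
  -- With ζ = η + θ the character splits off e^{2πi⟨x,η⟩}, and its remaining factor e^{2πi⟨x,θ⟩}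
  -- translates B by x.
  rw [← integral_add_left_eq_self (fun ζ => ee (inner ℝ x ζ) * b (x, ζ) *
    (F η * 𝓕 (fun z => B (z, η)) (ζ - η))) η, ← integral_const_mul, ← integral_mul_const]
  refine integral_congr_ae (Filter.Eventually.of_forall fun θ => ?_)
  simp only [add_sub_cancel_left]
  rw [← ee_mul_fourier (fun z => B (z, η)), inner_add_right, ee_add]
  ring

end Compose

/-! ### Cutoffs in the space variable -/

section Cutoff

variable {n : ℕ}

/-- A bump function on `ℝⁿ`. -/
noncomputable def bump (n : ℕ) : ContDiffBump (0 : Rn n) := ⟨1, 2, one_pos, one_lt_two⟩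

/-- A cutoff in the space variable, at distance `1 / t` from the origin. -/
noncomputable def cutoff (t : ℝ) (p : Rn n × Rn n) : ℂ := ((bump n (t • p.1) : ℝ) : ℂ)

lemma contDiff_bump : ContDiff ℝ ∞ fun x : Rn n => ((bump n x : ℝ) : ℂ) :=
  Complex.ofRealCLM.contDiff.comp (bump n).contDiff

lemma contDiff_cutoff (t : ℝ) : ContDiff ℝ ∞ (cutoff t : Rn n × Rn n → ℂ) :=
  contDiff_bump.comp (contDiff_fst.const_smul t)

lemma norm_cutoff_sub_one_le (t : ℝ) (p : Rn n × Rn n) : ‖cutoff t p - 1‖ ≤ 1 := by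
  have h0 := (bump n).nonneg (x := t • p.1)
  have h1 := (bump n).le_one (x := t • p.1)
  rw [cutoff, ← Complex.ofReal_one, ← Complex.ofReal_sub, Complex.norm_real, Real.norm_eq_abs,
    abs_le]
  constructor <;> linarith

lemma cutoff_eq_zero {t : ℝ} (ht : 0 < t) {p : Rn n × Rn n} (hp : 2 / t < ‖p.1‖) :
    cutoff t p = 0 := by
  rw [cutoff, (bump n).zero_of_le_dist, Complex.ofReal_zero]
  rw [dist_zero_right, norm_smul, Real.norm_of_nonneg ht.le]
  rw [div_lt_iff₀' ht] at hp
  exact hp.le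

lemma cutoff_eventuallyEq_one {t : ℕ → ℝ} (ht : Filter.Tendsto t Filter.atTop (nhds 0))
    (p : Rn n × Rn n) : ∀ᶠ m in Filter.atTop, ∀ᶠ q in nhds p, cutoff (t m) q = 1 := by
  have h1 : Filter.Tendsto (fun m => t m • p.1) Filter.atTop (nhds 0) := by
    simpa using ht.smul_const p.1
  filter_upwards [h1.eventually (Metric.ball_mem_nhds (0 : Rn n) one_pos)] with m hm
  have h2 : Continuous fun q : Rn n × Rn n => t m • q.1 := by fun_prop
  filter_upwards [h2.continuousAt.eventually (Metric.isOpen_ball.mem_nhds hm)] with q hq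
  rw [cutoff, (bump n).one_of_mem_closedBall (Metric.ball_subset_closedBall hq),
    Complex.ofReal_one]

/-- Every derivative of the dilated bump brings at most a factor |t| ≤ 1. Uniformity in t is what
allows the cutoff to be removed by dominated convergence. -/
lemma exists_norm_dirD_cutoff_le (n : ℕ) : ∃ κ : List (Fin n ⊕ Fin n) → ℝ, ∀ t : ℝ, |t| ≤ 1 →
    ∀ w p, ‖dirD (w.map (dir n)) (cutoff t : Rn n × Rn n → ℂ) p‖ ≤ κ w := by
  have h1 : ∀ w : List (Fin n ⊕ Fin n), ∃ C, ∀ p, ‖dirD (w.map (dir n)) (cutoff 1) p‖ ≤ C := by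
    intro w
    have h2 : (cutoff 1 : Rn n × Rn n → ℂ) =
        fun p => ((bump n (ContinuousLinearMap.fst ℝ (Rn n) (Rn n) p + 0) : ℝ) : ℂ) := by
      funext p; simp [cutoff]
    have hs : HasCompactSupport fun x : Rn n => ((bump n x : ℝ) : ℂ) :=
      (bump n).hasCompactSupport.comp_left (g := fun r : ℝ => (r : ℂ)) rfl
    obtain ⟨C, hC⟩ := (hasCompactSupport_dirD hs ((w.map (dir n)).map
      (ContinuousLinearMap.fst ℝ (Rn n) (Rn n)))).exists_bound_of_continuous
      (continuous_dirD contDiff_bump _)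
    refine ⟨C, fun p => ?_⟩
    rw [h2, dirD_comp_affine contDiff_bump]
    exact hC _
  choose κ hκ using h1
  refine ⟨κ, fun t ht w p => ?_⟩
  have h3 : (cutoff t : Rn n × Rn n → ℂ) = fun p => cutoff 1 (dilation n t t p + 0) := by
    funext p; simp [cutoff, dilation_apply]
  rw [h3]
  refine (norm_dirD_dilation_le (contDiff_cutoff 1) ht ht w 0 p).trans ?_
  rw [one_pow, one_mul]
  exact hκ _ _

lemma norm_dirD_mul_weight_le {f g : Rn n × Rn n → ℂ} (hf : ContDiff ℝ ∞ f) (hg : ContDiff ℝ ∞ g)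
    {κ c : List (Fin n ⊕ Fin n) → ℝ} {ρ : Rn n → ℝ} (h₁ : ∀ w p, ‖dirD (w.map (dir n)) f p‖ ≤ κ w)
    (h₂ : ∀ w p, ‖dirD (w.map (dir n)) g p‖ ≤ c w * ρ p.2) (w : List (Fin n ⊕ Fin n))
    (p : Rn n × Rn n) : ‖dirD (w.map (dir n)) (fun p => f p * g p) p‖ ≤
      (∑ j : Fin (splits w).length, κ (splits w)[j].1 * c (splits w)[j].2) * ρ p.2 := by
  rw [dirD_mul_eq_sum _ hf hg, Finset.sum_mul]
  refine (norm_sum_le _ _).trans (Finset.sum_le_sum fun j _ => ?_)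
  rw [norm_mul, mul_assoc]
  exact mul_le_mul (h₁ _ _) (h₂ _ _) (norm_nonneg _) ((norm_nonneg _).trans (h₁ _ p))

end Cutoff

/-! ### Scaling of a composed symbol -/

section Scale

variable {n : ℕ}

lemma fourier_comp_smul {ε : ℝ} (hε : 0 < ε) (φ : Rn n → ℂ) (θ : Rn n) :
    𝓕 φ (ε⁻¹ • θ) = ((ε ^ n : ℝ) : ℂ) * 𝓕 (fun z => φ (ε • z)) θ := by
  have h := Measure.integral_comp_smul (volume : Measure (Rn n))
    (fun z => ee (-inner ℝ z (ε⁻¹ • θ)) * φ z) ε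
  rw [finrank_euclideanSpace_fin, abs_of_pos (by positivity), Complex.real_smul] at h
  rw [fourier_ee, fourier_ee]
  have h2 : ∀ z, ee (-inner ℝ z θ) * φ (ε • z) =
      ee (-inner ℝ (ε • z) (ε⁻¹ • θ)) * φ (ε • z) := by
    intro z
    rw [inner_smul_left, inner_smul_right, conj_trivial, mul_inv_cancel_left₀ hε.ne']
  simp only [h2]
  rw [h, ← mul_assoc, ← Complex.ofReal_mul, mul_inv_cancel₀ (by positivity), Complex.ofReal_one,
    one_mul]

/-- Composition of symbols commutes with the dilations (x,η) ↦ (εx, η/ε). With ε = √h the expansion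
can be applied to the half-scaled symbols, whose derivatives all gain √h. -/
lemma integral_mul_fourier_scale {ε : ℝ} (hε : 0 < ε) (b B : Rn n × Rn n → ℂ) (x η : Rn n) :
    ∫ θ, b (x, η + θ) * 𝓕 (fun z => B (x + z, η)) θ =
      ∫ θ, b (ε • (ε⁻¹ • x), ε⁻¹ • (ε • η + θ)) *
        𝓕 (fun z => B (ε • (ε⁻¹ • x + z), ε⁻¹ • (ε • η))) θ := by
  have h := Measure.integral_comp_smul (volume : Measure (Rn n))
    (fun θ => b (x, η + θ) * 𝓕 (fun z => B (x + z, η)) θ) ε⁻¹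
  rw [finrank_euclideanSpace_fin, abs_of_pos (by positivity), inv_pow, inv_inv,
    Complex.real_smul] at h
  have h2 : ∀ θ, b (x, η + ε⁻¹ • θ) * 𝓕 (fun z => B (x + z, η)) (ε⁻¹ • θ) =
      ((ε ^ n : ℝ) : ℂ) * (b (ε • (ε⁻¹ • x), ε⁻¹ • (ε • η + θ)) *
        𝓕 (fun z => B (ε • (ε⁻¹ • x + z), ε⁻¹ • (ε • η))) θ) := by
    intro θ
    rw [fourier_comp_smul hε]
    simp only [smul_add, smul_smul, mul_inv_cancel₀ hε.ne', inv_mul_cancel₀ hε.ne', one_smul]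
    ring
  simp only [h2] at h
  rw [integral_const_mul] at h
  have h3 : ((ε ^ n : ℝ) : ℂ) ≠ 0 := by
    exact_mod_cast (by positivity : (ε ^ n : ℝ) ≠ 0)
  exact (mul_left_cancel₀ h3 h).symm

lemma scaledSymbol_scale {h : ℝ} (hh : 0 < h) (a : Rn n → Rn n → ℂ) (p : Rn n × Rn n) :
    scaledSymbol h a (√h • p.1, (√h)⁻¹ • p.2) = halfScaled h a p := by
  have hε : 0 < √h := Real.sqrt_pos.2 hh
  rw [halfScaled_apply, scaledSymbol, smul_smul]
  congr 2
  nth_rewrite 1 [← Real.mul_self_sqrt hh.le]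
  field_simp

lemma exists_norm_dirD_scaledSymbol_le {h k : ℝ} (hh : 0 < h) {a : Rn n → Rn n → ℂ}
    {C : (Fin n → ℕ) → (Fin n → ℕ) → ℝ} (ha : SymbolBound k a C) :
    ∃ c : List (Fin n ⊕ Fin n) → ℝ, ∀ w p, ‖dirD (w.map (dir n)) (scaledSymbol h a) p‖ ≤
      c w * japBr ((2 * π * h) • p.2) ^ k := by
  refine ⟨fun w => (1 + 2 * π * h) ^ w.length * C (cntXi w) (cntX w), fun w p => ?_⟩
  have h0 : 0 < 2 * π * h := by positivity
  have h1 : scaledSymbol h a = fun p => unc a (dilation n 1 (-(2 * π * h)) p + 0) := by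
    funext p; simp [scaledSymbol, dilation_apply, unc]
  rw [h1]
  refine (norm_dirD_dilation_le ha.contDiff (K := 1 + 2 * π * h) ?_ ?_ w 0 p).trans ?_
  · rw [abs_one]; linarith
  · rw [abs_neg, abs_of_pos h0]; linarith
  · rw [mul_assoc ((1 + 2 * π * h) ^ w.length)]
    refine mul_le_mul_of_nonneg_left ?_ (by positivity)
    have h2 := ha.norm_dirD_le w (dilation n 1 (-(2 * π * h)) p + 0)
    have h3 : japBr (dilation n 1 (-(2 * π * h)) p + 0).2 = japBr ((2 * π * h) • p.2) := by
      simp [dilation_apply, japBr]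
    rwa [h3] at h2

/-- The weight has temperate growth, so its product with the transform of f is again a Schwartz
function. -/
lemma integrable_weight_mul_fourier (h k : ℝ) (f : 𝓢(Rn n, ℂ)) (N : ℕ) :
    Integrable fun η : Rn n => japBr ((2 * π * h) • η) ^ k * (1 + ‖η‖) ^ N *
      ‖𝓕 (f : Rn n → ℂ) η‖ := by
  set G : 𝓢(Rn n, ℂ) := SchwartzMap.smulLeftCLM ℂ (weight h k : Rn n → ℂ) (𝓕 f) with hG
  have h1 : ∀ η, ‖G η‖ = japBr ((2 * π * h) • η) ^ k * ‖𝓕 (f : Rn n → ℂ) η‖ := by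
    intro η
    rw [hG, SchwartzMap.smulLeftCLM_apply_apply (weight_hasTemperateGrowth h k),
      SchwartzMap.fourier_coe, smul_eq_mul, norm_mul, weight, Complex.norm_real,
      Real.norm_of_nonneg (Real.rpow_nonneg (japBr_pos _).le _)]
  have h2 : ∀ η, japBr ((2 * π * h) • η) ^ k * (1 + ‖η‖) ^ N * ‖𝓕 (f : Rn n → ℂ) η‖ =
      ∑ m ∈ Finset.range (N + 1), (N.choose m : ℝ) * (‖η‖ ^ m * ‖G η‖) := by
    intro η
    have h3 : japBr ((2 * π * h) • η) ^ k * (1 + ‖η‖) ^ N * ‖𝓕 (f : Rn n → ℂ) η‖ =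
        (‖η‖ + 1) ^ N * ‖G η‖ := by rw [h1, add_comm]; ring
    rw [h3, add_pow, Finset.sum_mul]
    refine Finset.sum_congr rfl fun m _ => ?_
    rw [one_pow]; ring
  simp only [h2]
  exact integrable_finsetSum (f := fun m η => (N.choose m : ℝ) * (‖η‖ ^ m * ‖G η‖)) _
    fun m _ => (G.integrable_pow_mul volume m).const_mul _

end Scale

/-! ### The composition of two operators -/

section Composition

variable {n : ℕ} {h k : ℝ} {a₁ a₂ : Rn n → Rn n → ℂ} {C₁ C₂ : (Fin n → ℕ) → (Fin n → ℕ) → ℝ}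

/-- The second symbol with a cutoff in the space variable. -/
noncomputable def cutSymbol (h : ℝ) (a : Rn n → Rn n → ℂ) (t : ℝ) (p : Rn n × Rn n) : ℂ :=
  cutoff t p * scaledSymbol h a p

lemma contDiff_cutSymbol (h t : ℝ) {a : Rn n → Rn n → ℂ} (ha : ContDiff ℝ ∞ (unc a)) :
    ContDiff ℝ ∞ (cutSymbol h a t) :=
  (contDiff_cutoff t).mul (contDiff_scaledSymbol h ha)

lemma cutSymbol_eq_zero {t : ℝ} (ht : 0 < t) (h : ℝ) (a : Rn n → Rn n → ℂ) (p : Rn n × Rn n)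
    (hp : 2 / t < ‖p.1‖) : cutSymbol h a t p = 0 := by
  rw [cutSymbol, cutoff_eq_zero ht hp, zero_mul]

lemma knOp_cutSymbol (h : ℝ) (a : Rn n → Rn n → ℂ) (t : ℝ) (F : Rn n → ℂ) (y : Rn n) :
    knOp (cutSymbol h a t) F y = cutoff t (y, 0) * knOp (scaledSymbol h a) F y := by
  rw [knOp, knOp, ← integral_const_mul]
  refine integral_congr_ae (Filter.Eventually.of_forall fun η => ?_)
  simp only [cutSymbol, cutoff]
  ring

lemma bddSmooth_halfScaled (h₁ : SymbolBound 0 a₁ C₁) : BddSmooth (dir n) (halfScaled h a₁) :=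
  ⟨contDiff_halfScaled h h₁.contDiff, fun _ => ⟨_, h₁.norm_dirD_halfScaled_le_of_zero _⟩⟩

/-- The symbol of the composition with a cutoff. -/
lemma integral_mul_fourier_cutSymbol (hh : 0 < h) (h₁ : SymbolBound 0 a₁ C₁)
    (h₂ : SymbolBound k a₂ C₂) {t : ℝ} (ht : 0 < t) (p : Rn n × Rn n) :
    ∫ θ, scaledSymbol h a₁ (p.1, p.2 + θ) * 𝓕 (fun z => cutSymbol h a₂ t (p.1 + z, p.2)) θ =
      scaledSymbol h a₁ p * cutSymbol h a₂ t p +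
        remSum (halfScaled h a₁) (fun q => cutoff (t * √h) q * halfScaled h a₂ q)
          ((√h)⁻¹ • p.1, √h • p.2) := by
  have hε : 0 < √h := Real.sqrt_pos.2 hh
  set g : Rn n × Rn n → ℂ := fun q => cutoff (t * √h) q * halfScaled h a₂ q with hg
  have hgs : ContDiff ℝ ∞ g := (contDiff_cutoff _).mul (contDiff_halfScaled h h₂.contDiff)
  have hgR : ∀ q : Rn n × Rn n, 2 / (t * √h) < ‖q.1‖ → g q = 0 := fun q hq => by
    rw [hg]; simp only; rw [cutoff_eq_zero (by positivity) hq, zero_mul]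
  have hcs : ∀ q : Rn n × Rn n, cutSymbol h a₂ t (√h • q.1, (√h)⁻¹ • q.2) = g q := by
    intro q
    rw [cutSymbol, scaledSymbol_scale hh, hg]
    simp only [cutoff, smul_smul]
  have hx := integral_mul_fourier_eq_expansion (lt_two_mul_halfOrder n)
    (bddSmooth_halfScaled (h := h) h₁) hgs (hasCompactSupport_section hgR) ((√h)⁻¹ • p.1) (√h • p.2)
  rw [integral_mul_fourier_scale hε (scaledSymbol h a₁) (cutSymbol h a₂ t)]
  have e1 := fun θ => scaledSymbol_scale hh a₁ ((√h)⁻¹ • p.1, √h • p.2 + θ)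
  have e2 := fun z => hcs ((√h)⁻¹ • p.1 + z, √h • p.2)
  simp only at e1 e2
  simp only [e1, e2]
  rw [hx]
  have hp : p = (√h • ((√h)⁻¹ • p.1, √h • p.2).1, (√h)⁻¹ • ((√h)⁻¹ • p.1, √h • p.2).2) := by
    simp only [smul_smul, mul_inv_cancel₀ hε.ne', inv_mul_cancel₀ hε.ne', one_smul]
  have e3 := scaledSymbol_scale hh a₁ ((√h)⁻¹ • p.1, √h • p.2)
  have e4 := hcs ((√h)⁻¹ • p.1, √h • p.2)
  rw [← hp] at e3 e4
  rw [e3, e4, remSum]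

lemma remSum_halfScaled (hh : 0 < h) (a₁ a₂ : Rn n → Rn n → ℂ) (p : Rn n × Rn n) :
    remSum (halfScaled h a₁) (halfScaled h a₂) ((√h)⁻¹ • p.1, √h • p.2) =
      scaledSymbol h (remainder h a₁ a₂) p := by
  have hε : 0 < √h := Real.sqrt_pos.2 hh
  rw [scaledSymbol, remainder, smul_smul]
  congr 3
  rw [neg_mul_neg]
  nth_rewrite 3 [← Real.mul_self_sqrt hh.le]
  field_simp

end Composition

/-! ### The remainder of the composition of two operators -/

section Limit

variable {n : ℕ} {h k : ℝ} {a₁ a₂ : Rn n → Rn n → ℂ} {C₁ C₂ : (Fin n → ℕ) → (Fin n → ℕ) → ℝ}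

/-- The symbol of the composition of the operators, the second with a cutoff. -/
noncomputable def cutComp (h : ℝ) (a₁ a₂ : Rn n → Rn n → ℂ) (t : ℝ) (p : Rn n × Rn n) : ℂ :=
  scaledSymbol h a₁ p * cutSymbol h a₂ t p +
    remSum (halfScaled h a₁) (fun q => cutoff (t * √h) q * halfScaled h a₂ q)
      ((√h)⁻¹ • p.1, √h • p.2)

lemma exists_norm_dirD_cutoff_mul_halfScaled_le (hh : 0 < h) (hh1 : h ≤ 1)
    (h₂ : SymbolBound k a₂ C₂) : ∃ c : List (Fin n ⊕ Fin n) → ℝ, ∀ t : ℝ, 0 < t → t ≤ 1 → ∀ w p,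
      ‖dirD (w.map (dir n)) (fun q => cutoff (t * √h) q * halfScaled h a₂ q) p‖ ≤
        c w * japBr ((2 * π * √h) • p.2) ^ k := by
  obtain ⟨κ, hκ⟩ := exists_norm_dirD_cutoff_le n
  refine ⟨_, fun t ht ht1 w p => norm_dirD_mul_weight_le (κ := κ)
    (ρ := fun η => japBr ((2 * π * √h) • η) ^ k) (contDiff_cutoff _)
    (contDiff_halfScaled h h₂.contDiff) (hκ _ ?_) (norm_dirD_halfScaled_le h₂) w p⟩
  have hε : 0 < √h := Real.sqrt_pos.2 hh
  rw [abs_of_pos (by positivity)]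
  exact mul_le_one₀ ht1 hε.le (Real.sqrt_le_one.2 hh1)

lemma exists_norm_dirD_cutSymbol_le (hh : 0 < h) (h₂ : SymbolBound k a₂ C₂) :
    ∃ c : List (Fin n ⊕ Fin n) → ℝ, ∀ t : ℝ, 0 < t → t ≤ 1 → ∀ w p,
      ‖dirD (w.map (dir n)) (cutSymbol h a₂ t) p‖ ≤ c w * japBr ((2 * π * h) • p.2) ^ k := by
  obtain ⟨κ, hκ⟩ := exists_norm_dirD_cutoff_le n
  obtain ⟨c, hc⟩ := exists_norm_dirD_scaledSymbol_le hh h₂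
  refine ⟨_, fun t ht ht1 w p => norm_dirD_mul_weight_le (κ := κ)
    (ρ := fun η => japBr ((2 * π * h) • η) ^ k) (contDiff_cutoff _)
    (contDiff_scaledSymbol h h₂.contDiff) (hκ _ ?_) hc w p⟩
  rwa [abs_of_pos ht]

lemma exists_norm_scaledSymbol_le (h : ℝ) (h₁ : SymbolBound 0 a₁ C₁) :
    ∃ K : ℝ, 0 ≤ K ∧ ∀ p, ‖scaledSymbol h a₁ p‖ ≤ K := by
  refine ⟨C₁ (cntXi []) (cntX []), h₁.nonneg _ _, fun p => ?_⟩
  simpa [unc, scaledSymbol] using h₁.norm_dirD_le [] (p.1, (-(2 * π * h)) • p.2)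

lemma continuous_cutComp (hh : 0 < h) (hh1 : h ≤ 1) (h₁ : SymbolBound 0 a₁ C₁)
    (h₂ : SymbolBound k a₂ C₂) {t : ℝ} (ht : 0 < t) (ht1 : t ≤ 1) :
    Continuous (cutComp h a₁ a₂ t) := by
  obtain ⟨c, hc⟩ := exists_norm_dirD_cutoff_mul_halfScaled_le hh hh1 h₂
  have h3 : ContDiff ℝ ∞ (remSum (halfScaled h a₁)
      (fun q => cutoff (t * √h) q * halfScaled h a₂ q)) :=
    ContDiff.sum fun i _ => contDiff_expTerm (lt_two_mul_halfOrder n) i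
      (contDiff_halfScaled h h₁.contDiff)
      ((contDiff_cutoff _).mul (contDiff_halfScaled h h₂.contDiff))
      (continuous_japBr_smul_rpow (2 * π * √h) k) (fun _ => Real.rpow_nonneg (japBr_pos _).le _)
      h₁.norm_dirD_halfScaled_le_of_zero (hc t ht ht1)
  exact ((contDiff_scaledSymbol h h₁.contDiff).continuous.mul
    (contDiff_cutSymbol h t h₂.contDiff).continuous).add (h3.continuous.comp (by fun_prop))

/-- The constant K may depend on h but not on t: it only supplies the dominating function for t → 0
and does not enter the final estimate. -/
lemma exists_norm_cutComp_le (hh : 0 < h) (hh1 : h ≤ 1) (h₁ : SymbolBound 0 a₁ C₁)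
    (h₂ : SymbolBound k a₂ C₂) : ∃ K : ℝ, ∀ t : ℝ, 0 < t → t ≤ 1 → ∀ p,
      ‖cutComp h a₁ a₂ t p‖ ≤ K * japBr ((2 * π * h) • p.2) ^ k := by
  obtain ⟨c, hc⟩ := exists_norm_dirD_cutoff_mul_halfScaled_le hh hh1 h₂
  obtain ⟨c', hc'⟩ := exists_norm_dirD_cutSymbol_le hh h₂
  obtain ⟨K₁, hK₁0, hK₁⟩ := exists_norm_scaledSymbol_le h h₁
  have hrem : ∀ i : ExpIdx n (halfOrder n), ∃ c, ∀ t : ℝ, 0 < t → t ≤ 1 → ∀ p : Rn n × Rn n,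
      ‖expTerm i (halfScaled h a₁) (fun q => cutoff (t * √h) q * halfScaled h a₂ q) p‖ ≤
        c * japBr ((2 * π * √h) • p.2) ^ k := fun i =>
    ⟨_, fun t ht ht1 p => (norm_dirD_expTerm_le (lt_two_mul_halfOrder n) i
      (contDiff_halfScaled h h₁.contDiff)
      ((contDiff_cutoff _).mul (contDiff_halfScaled h h₂.contDiff))
      (continuous_japBr_smul_rpow (2 * π * √h) k) (fun _ => Real.rpow_nonneg (japBr_pos _).le _)
      h₁.norm_dirD_halfScaled_le_of_zero (hc t ht ht1) [] p).trans_eq (mul_assoc _ _ _).symm⟩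
  choose cr hcr using hrem
  refine ⟨K₁ * c' [] + ∑ i : ExpIdx n (halfOrder n), cr i, fun t ht ht1 p => ?_⟩
  rw [cutComp, add_mul]
  refine (norm_add_le _ _).trans (add_le_add ?_ ?_)
  · rw [norm_mul, mul_assoc]
    exact mul_le_mul (hK₁ p) (hc' t ht ht1 [] p) (norm_nonneg _) hK₁0
  · rw [remSum, Finset.sum_mul]
    refine (norm_sum_le _ _).trans (Finset.sum_le_sum fun i _ => ?_)
    have h3 := hcr i t ht ht1 ((√h)⁻¹ • p.1, √h • p.2)
    have h4 : (2 * π * √h) • √h • p.2 = (2 * π * h) • p.2 := by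
      rw [smul_smul, mul_assoc (2 * π), Real.mul_self_sqrt hh.le]
    simp only [h4] at h3
    exact h3

lemma tendsto_cutComp (hh : 0 < h) (hh1 : h ≤ 1) (h₁ : SymbolBound 0 a₁ C₁)
    (h₂ : SymbolBound k a₂ C₂) {t : ℕ → ℝ} (ht0 : ∀ m, 0 < t m) (ht1 : ∀ m, t m ≤ 1)
    (ht : Filter.Tendsto t Filter.atTop (nhds 0)) (p : Rn n × Rn n) :
    Filter.Tendsto (fun m => cutComp h a₁ a₂ (t m) p) Filter.atTop
      (nhds (scaledSymbol h a₁ p * scaledSymbol h a₂ p + scaledSymbol h (remainder h a₁ a₂) p)) := by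
  obtain ⟨c, hc⟩ := exists_norm_dirD_cutoff_mul_halfScaled_le hh hh1 h₂
  refine Filter.Tendsto.add (Filter.Tendsto.const_mul _ (tendsto_nhds_of_eventually_eq ?_)) ?_
  · filter_upwards [cutoff_eventuallyEq_one ht p] with m hm
    rw [cutSymbol, hm.self_of_nhds, one_mul]
  · rw [← remSum_halfScaled hh]
    refine tendsto_finsetSum _ fun i _ => tendsto_expTerm (lt_two_mul_halfOrder n) i
      (ρ := fun η => japBr ((2 * π * √h) • η) ^ k)
      (contDiff_halfScaled h h₁.contDiff)
      (fun m => (contDiff_cutoff _).mul (contDiff_halfScaled h h₂.contDiff))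
      h₁.norm_dirD_halfScaled_le_of_zero (fun m => hc (t m) (ht0 m) (ht1 m)) (fun q => ?_) _
    have ht' : Filter.Tendsto (fun m => t m * √h) Filter.atTop (nhds 0) := by
      simpa using ht.mul_const (√h)
    -- The cutoff is eventually 1 on a neighbourhood, not just at the point, so the derivatives in
    -- the expansion also agree.
    filter_upwards [cutoff_eventuallyEq_one ht' q] with m hm
    filter_upwards [hm] with q' hq'
    rw [hq', one_mul]

lemma tendsto_knOp_cutComp (hh : 0 < h) (hh1 : h ≤ 1) (h₁ : SymbolBound 0 a₁ C₁)
    (h₂ : SymbolBound k a₂ C₂) {t : ℕ → ℝ} (ht0 : ∀ m, 0 < t m) (ht1 : ∀ m, t m ≤ 1)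
    (ht : Filter.Tendsto t Filter.atTop (nhds 0)) (f : 𝓢(Rn n, ℂ)) (x : Rn n) :
    Filter.Tendsto (fun m => knOp (cutComp h a₁ a₂ (t m)) (𝓕 (f : Rn n → ℂ)) x) Filter.atTop
      (nhds (opFun h (fun x ξ => a₁ x ξ * a₂ x ξ) f x + opFun h (remainder h a₁ a₂) f x)) := by
  obtain ⟨K, hK⟩ := exists_norm_cutComp_le hh hh1 h₁ h₂
  have hFc : Continuous (𝓕 (f : Rn n → ℂ)) := by
    rw [← SchwartzMap.fourier_coe]; exact (𝓕 f).continuous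
  have hi := fun N => integrable_weight_mul_fourier h k f N
  have hi0 : Integrable fun η : Rn n => japBr ((2 * π * h) • η) ^ k * ‖𝓕 (f : Rn n → ℂ) η‖ := by
    simpa using hi 0
  have hcs : ∀ {a : Rn n → Rn n → ℂ} {C : (Fin n → ℕ) → (Fin n → ℕ) → ℝ}, SymbolBound k a C →
      Integrable fun η => ee (inner ℝ x η) * scaledSymbol h a (x, η) * 𝓕 (f : Rn n → ℂ) η := by
    intro a C ha
    obtain ⟨c, hc⟩ := exists_norm_dirD_scaledSymbol_le hh ha
    refine (hi0.const_mul (c [])).mono' (Continuous.aestronglyMeasurable ?_)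
      (Filter.Eventually.of_forall fun η => ?_)
    · have := (contDiff_scaledSymbol h ha.contDiff).continuous
      fun_prop
    · rw [norm_mul, norm_mul, norm_ee, one_mul, ← mul_assoc]
      exact mul_le_mul_of_nonneg_right (hc [] (x, η)) (norm_nonneg _)
  obtain ⟨C, hC⟩ := exists_symbolBound_mul h₁ h₂
  have hlim : opFun h (fun x ξ => a₁ x ξ * a₂ x ξ) f x + opFun h (remainder h a₁ a₂) f x =
      ∫ η, ee (inner ℝ x η) * (scaledSymbol h a₁ (x, η) * scaledSymbol h a₂ (x, η) +
        scaledSymbol h (remainder h a₁ a₂) (x, η)) * 𝓕 (f : Rn n → ℂ) η := by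
    rw [opFun_eq_knOp hh, opFun_eq_knOp hh, knOp, knOp,
      ← integral_add (hcs hC) (hcs (symbolBound_remainder hh h₁ h₂ 0))]
    refine integral_congr_ae (Filter.Eventually.of_forall fun η => ?_)
    simp only [scaledSymbol]
    ring
  rw [hlim]
  refine tendsto_integral_of_dominated_convergence
    (fun η => K * (japBr ((2 * π * h) • η) ^ k * ‖𝓕 (f : Rn n → ℂ) η‖)) (fun m => ?_)
    (hi0.const_mul K) (fun m => Filter.Eventually.of_forall fun η => ?_)
    (Filter.Eventually.of_forall fun η => ?_)
  · have := continuous_cutComp hh hh1 h₁ h₂ (ht0 m) (ht1 m)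
    exact Continuous.aestronglyMeasurable (by fun_prop)
  · rw [norm_mul, norm_mul, norm_ee, one_mul, ← mul_assoc]
    exact mul_le_mul_of_nonneg_right (hK (t m) (ht0 m) (ht1 m) (x, η)) (norm_nonneg _)
  · exact ((tendsto_cutComp hh hh1 h₁ h₂ ht0 ht1 ht (x, η)).const_mul _).mul_const _

/-- The image of a Schwartz function under `Op_h(a)`, with a cutoff. -/
lemma exists_schwartz_cutoff_mul_opFun (hh : 0 < h) (h₂ : SymbolBound k a₂ C₂) {t : ℝ}
    (ht : 0 < t) (ht1 : t ≤ 1) (f : 𝓢(Rn n, ℂ)) :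
    ∃ u : 𝓢(Rn n, ℂ), (u : Rn n → ℂ) = knOp (cutSymbol h a₂ t) (𝓕 (f : Rn n → ℂ)) := by
  obtain ⟨c, hc⟩ := exists_norm_dirD_cutSymbol_le hh h₂
  have hFc : Continuous (𝓕 (f : Rn n → ℂ)) := by
    rw [← SchwartzMap.fourier_coe]; exact (𝓕 f).continuous
  have h3 : ContDiff ℝ ∞ (knOp (cutSymbol h a₂ t) (𝓕 (f : Rn n → ℂ))) :=
    contDiff_knOp (ρ := fun η => japBr ((2 * π * h) • η) ^ k) (contDiff_cutSymbol h t h₂.contDiff)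
      (fun _ => Real.rpow_nonneg (japBr_pos _).le _) (hc t ht ht1) hFc
      (integrable_weight_mul_fourier h k f)
  have h4 : HasCompactSupport (knOp (cutSymbol h a₂ t) (𝓕 (f : Rn n → ℂ))) := by
    refine HasCompactSupport.intro (isCompact_closedBall (0 : Rn n) (2 / t)) fun y hy => ?_
    rw [knOp_cutSymbol, cutoff_eq_zero ht (by simpa using hy), zero_mul]
  exact ⟨h4.toSchwartzMap h3, rfl⟩

lemma opFun_eq_knOp_cutComp (hh : 0 < h) (h₁ : SymbolBound 0 a₁ C₁)
    (h₂ : SymbolBound k a₂ C₂) {t : ℝ} (ht : 0 < t) (ht1 : t ≤ 1) (f u : 𝓢(Rn n, ℂ))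
    (hu : (u : Rn n → ℂ) = knOp (cutSymbol h a₂ t) (𝓕 (f : Rn n → ℂ))) (x : Rn n) :
    opFun h a₁ u x = knOp (cutComp h a₁ a₂ t) (𝓕 (f : Rn n → ℂ)) x := by
  obtain ⟨c, hc⟩ := exists_norm_dirD_cutSymbol_le hh h₂
  obtain ⟨K₁, hK₁0, hK₁⟩ := exists_norm_scaledSymbol_le h h₁
  have hFc : Continuous (𝓕 (f : Rn n → ℂ)) := by
    rw [← SchwartzMap.fourier_coe]; exact (𝓕 f).continuous
  have hi0 : Integrable fun η : Rn n => japBr ((2 * π * h) • η) ^ k * ‖𝓕 (f : Rn n → ℂ) η‖ := by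
    simpa using integrable_weight_mul_fourier h k f 0
  rw [opFun_eq_knOp hh, hu, knOp_fourier_knOp (ρ := fun η => japBr ((2 * π * h) • η) ^ k)
    (contDiff_cutSymbol h t h₂.contDiff)
    (fun _ => Real.rpow_nonneg (japBr_pos _).le _) (hc t ht ht1) (cutSymbol_eq_zero ht h a₂) hFc hi0
    (contDiff_scaledSymbol h h₁.contDiff).continuous hK₁]
  congr 1
  funext p
  exact integral_mul_fourier_cutSymbol hh h₁ h₂ ht p

lemma tendsto_eLpNorm_cutoff_mul_sub {g : Rn n → ℂ} (hg : MemLp g 2) {t : ℕ → ℝ}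
    (ht : Filter.Tendsto t Filter.atTop (nhds 0)) :
    Filter.Tendsto (fun m => eLpNorm (fun y => cutoff (t m) (y, 0) * g y - g y) 2 volume)
      Filter.atTop (nhds 0) := by
  have h1 : Filter.Tendsto (fun m => ∫⁻ y, ‖cutoff (t m) (y, 0) * g y - g y‖ₑ ^ 2) Filter.atTop
      (nhds (∫⁻ _y : Rn n, 0)) := by
    refine tendsto_lintegral_of_dominated_convergence' (fun y => ‖g y‖ₑ ^ 2) (fun m => ?_)
      (fun m => Filter.Eventually.of_forall fun y => ?_) ?_ (Filter.Eventually.of_forall fun y => ?_)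
    · have := (contDiff_cutoff (n := n) (t m)).continuous
      have h3 : Continuous fun y : Rn n => cutoff (t m) (y, (0 : Rn n)) := by fun_prop
      exact ((h3.aestronglyMeasurable.mul hg.1).sub hg.1).enorm.pow_const 2
    · have h3 : cutoff (t m) (y, (0 : Rn n)) * g y - g y = (cutoff (t m) (y, 0) - 1) * g y := by ring
      beta_reduce
      rw [h3]
      gcongr
      rw [enorm_mul]
      refine mul_le_of_le_one_left zero_le ?_
      rw [← ofReal_norm]
      exact ENNReal.ofReal_le_one.2 (norm_cutoff_sub_one_le _ _)
    · have := (eLpNorm_lt_top_iff_lintegral_rpow_enorm_lt_top (by norm_num) (by norm_num)).1 hg.2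
      simpa using this.ne
    · refine tendsto_nhds_of_eventually_eq ?_
      filter_upwards [cutoff_eventuallyEq_one ht (y, 0)] with m hm
      rw [hm.self_of_nhds, one_mul, sub_self]
      simp
  simp only [eLpNorm_two_eq]
  have h2 := h1.ennrpow_const (1 / 2 : ℝ)
  simpa using h2

/-- The composition of two operators on Schwartz functions. -/
lemma comp_ae_eq (hh : 0 < h) (hh1 : h ≤ 1) (h₁ : SymbolBound 0 a₁ C₁)
    (h₂ : SymbolBound k a₂ C₂) {T₁ : L2 n →L[ℂ] L2 n} {T₂ : Hsc n h k →L[ℂ] L2 n}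
    (hT₁ : IsOpL2 h a₁ T₁) (hT₂ : IsOp h k a₂ T₂) (f : 𝓢(Rn n, ℂ)) :
    T₁ (T₂ (schwartzToHsc n h k f)) =ᵐ[volume] fun x =>
      opFun h (fun x ξ => a₁ x ξ * a₂ x ξ) f x + opFun h (remainder h a₁ a₂) f x := by
  -- Op_h(a₂) f need not be a Schwartz function, so the integral formula for Op_h(a₁) is not
  -- directly available. Cutting off at distance 1/t m gives Schwartz functions u m converging to it
  -- in L².
  set t : ℕ → ℝ := fun m => 1 / ((m : ℝ) + 1) with htd
  have ht0 : ∀ m, 0 < t m := fun m => by positivity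
  have ht1 : ∀ m, t m ≤ 1 := fun m => by
    rw [htd]
    exact (div_le_one (by positivity)).2 (by linarith [(Nat.cast_nonneg m : (0 : ℝ) ≤ m)])
  have ht : Filter.Tendsto t Filter.atTop (nhds 0) := tendsto_one_div_add_atTop_nhds_zero_nat
  choose u hu using fun m => exists_schwartz_cutoff_mul_opFun hh h₂ (ht0 m) (ht1 m) f
  set g : L2 n := T₂ (schwartzToHsc n h k f) with hg
  have hgk : g =ᵐ[volume] knOp (scaledSymbol h a₂) (𝓕 (f : Rn n → ℂ)) :=
    (hT₂ f).trans (Filter.Eventually.of_forall (opFun_eq_knOp hh a₂ f))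
  have hconv : Filter.Tendsto (fun m => (u m).toLp 2 (volume : Measure (Rn n))) Filter.atTop
      (nhds g) := by
    rw [Lp.tendsto_Lp_iff_tendsto_eLpNorm']
    refine (tendsto_eLpNorm_cutoff_mul_sub (Lp.memLp g) ht).congr fun m => eLpNorm_congr_ae ?_
    filter_upwards [hgk, (u m).coeFn_toLp 2 volume] with y hy hy'
    rw [Pi.sub_apply, hy', hu m, knOp_cutSymbol, hy]
  have hconv' := (T₁.continuous.tendsto g).comp hconv
  -- L² convergence of T₁ (u m) gives almost everywhere convergence along a subsequence, where the
  -- limit is identified with the pointwise limit of the explicit formulas.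
  obtain ⟨ns, hns, hae⟩ := (tendstoInMeasure_of_tendsto_Lp hconv').exists_seq_tendsto_ae
  have hall : ∀ᵐ x, ∀ m, T₁ ((u m).toLp 2) x = opFun h a₁ (u m) x :=
    ae_all_iff.2 fun m => hT₁ (u m)
  filter_upwards [hae, hall] with x hx hx'
  refine tendsto_nhds_unique hx ?_
  have hlim := (tendsto_knOp_cutComp hh hh1 h₁ h₂ ht0 ht1 ht f x).comp hns.tendsto_atTop
  refine hlim.congr fun j => ?_
  simp only [Function.comp]
  rw [hx', opFun_eq_knOp_cutComp hh h₁ h₂ (ht0 _) (ht1 _) f (u (ns j)) (hu _)]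

end Limit

/-! ### Admissibility applied to the remainder -/

section Final

variable {n : ℕ}

lemma besselS_zero (n : ℕ) (h : ℝ) (f : 𝓢(Rn n, ℂ)) : besselS n h 0 f = f := by
  have h1 : (weight h 0 : Rn n → ℂ) = fun _ => 1 := by
    funext η; simp [weight]
  simp [besselS, h1]

lemma norm_schwartzToHsc_zero (h : ℝ) (f : 𝓢(Rn n, ℂ)) :
    ‖schwartzToHsc n h 0 f‖ = ‖f.toLp 2 (volume : Measure (Rn n))‖ := by
  rw [norm_eq, toL2_schwartzToHsc, besselS_zero]

/-- The inclusion of the Schwartz functions in `H_h^k`, as a linear map. -/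
noncomputable def schwartzToHscL (n : ℕ) (h k : ℝ) : 𝓢(Rn n, ℂ) →ₗ[ℂ] Hsc n h k where
  toFun := schwartzToHsc n h k
  map_add' f g := toL2_injective n h k (by
    rw [map_add, toL2_schwartzToHsc, toL2_schwartzToHsc, toL2_schwartzToHsc, map_add]; rfl)
  map_smul' c f := toL2_injective n h k (by
    rw [RingHom.id_apply, map_smul, toL2_schwartzToHsc, toL2_schwartzToHsc, map_smul]; rfl)

/-- On Schwartz functions the norms of H_h^0 and L² coincide, so the case k = 0 of the boundedness
theorem extends by density to an operator on L². -/
lemma exists_isOpL2 {s : ℕ} (hs : BoundednessOrder n s) {h : ℝ} (hh : 0 < h) (hh1 : h ≤ 1)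
    {a : Rn n → Rn n → ℂ} {C : (Fin n → ℕ) → (Fin n → ℕ) → ℝ} (ha : SymbolBound 0 a C) :
    ∃ T : L2 n →L[ℂ] L2 n, IsOpL2 h a T := by
  obtain ⟨A, hA⟩ := hs 0
  obtain ⟨T, hT, -⟩ := hA h hh hh1 a C ha
  obtain ⟨T', -, hT'⟩ := exists_clm_of_norm_toLp_le (T.toLinearMap ∘ₗ schwartzToHscL n h 0)
    (norm_nonneg T) fun f => by
      have := T.le_opNorm (schwartzToHsc n h 0 f)
      rwa [norm_schwartzToHsc_zero] at this
  refine ⟨T', fun f => ?_⟩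
  rw [hT' f]
  exact hT f

/-- The difference of the operators is itself the operator with symbol `remainder`, of order k, so
the assumed boundedness theorem applies to it. The norms of the individual operators play no role.
-/
theorem exists_composition_bound {s : ℕ} (hs : BoundednessOrder n s) (k : ℝ) :
    ∃ A : ℝ, ∀ h : ℝ, 0 < h → h ≤ 1 → ∀ (a₁ a₂ : Rn n → Rn n → ℂ)
      (C₁ C₂ : (Fin n → ℕ) → (Fin n → ℕ) → ℝ), SymbolBound 0 a₁ C₁ → SymbolBound k a₂ C₂ →
      ∃ (T₁ : L2 n →L[ℂ] L2 n) (T₂ T₁₂ : Hsc n h k →L[ℂ] L2 n),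
        IsOpL2 h a₁ T₁ ∧ IsOp h k a₂ T₂ ∧ IsOp h k (fun x ξ => a₁ x ξ * a₂ x ξ) T₁₂ ∧
        ‖T₁ ∘L T₂ - T₁₂‖ ≤ A * compSum (2 * n + 7 + s) h C₁ C₂ := by
  obtain ⟨A, hA⟩ := hs k
  refine ⟨A * (((multiIdx n s ×ˢ multiIdx n s).filter (fun p => len p.1 + len p.2 ≤ s)).card *
    remConst n s), fun h hh hh1 a₁ a₂ C₁ C₂ h₁ h₂ => ?_⟩
  obtain ⟨T₁, hT₁⟩ := exists_isOpL2 hs hh hh1 h₁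
  obtain ⟨T₂, hT₂, -⟩ := hA h hh hh1 a₂ C₂ h₂
  obtain ⟨C, hC⟩ := exists_symbolBound_mul h₁ h₂
  obtain ⟨T₁₂, hT₁₂, -⟩ := hA h hh hh1 _ C hC
  obtain ⟨Tr, hTr, hTrn⟩ := hA h hh hh1 _ _ (symbolBound_remainder hh h₁ h₂ s)
  refine ⟨T₁, T₂, T₁₂, hT₁, hT₂, hT₁₂, ?_⟩
  -- Both sides act on Schwartz functions by the integral with the symbol `remainder`, and these
  -- functions are dense.
  have heq : T₁ ∘L T₂ - T₁₂ = Tr := by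
    refine IsOp.unique (a := remainder h a₁ a₂) (fun f => ?_) hTr
    have h3 : (T₁ ∘L T₂ - T₁₂) (schwartzToHsc n h k f) =
      T₁ (T₂ (schwartzToHsc n h k f)) - T₁₂ (schwartzToHsc n h k f) := rfl
    rw [h3]
    filter_upwards [comp_ae_eq hh hh1 h₁ h₂ hT₁ hT₂ f, hT₁₂ f,
      Lp.coeFn_sub (T₁ (T₂ (schwartzToHsc n h k f))) (T₁₂ (schwartzToHsc n h k f))] with x e1 e2 e3
    rw [e3, Pi.sub_apply, e1, e2, add_sub_cancel_left]
  rw [heq]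
  refine hTrn.trans (le_of_eq ?_)
  rw [boundSum_remSymb hh]
  ring

end Final

end SemiclassicalPDO

theorem proposition2p2 (d : ℕ) (hd : 2 ≤ d) :
    (∃ s : ℕ, BoundednessOrder (d - 1) s) ∧
    ∀ s : ℕ, BoundednessOrder (d - 1) s → ∀ k : ℝ, ∃ A : ℝ,
      ∀ h : ℝ, 0 < h → h ≤ 1 →
      ∀ (a₁ a₂ : Rn (d - 1) → Rn (d - 1) → ℂ)
        (C₁ C₂ : (Fin (d - 1) → ℕ) → (Fin (d - 1) → ℕ) → ℝ),
        SymbolBound 0 a₁ C₁ → SymbolBound k a₂ C₂ →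
        ∃ (T₁ : L2 (d - 1) →L[ℂ] L2 (d - 1)) (T₂ T₁₂ : Hsc (d - 1) h k →L[ℂ] L2 (d - 1)),
          IsOpL2 h a₁ T₁ ∧ IsOp h k a₂ T₂ ∧ IsOp h k (fun x ξ => a₁ x ξ * a₂ x ξ) T₁₂ ∧
          ‖T₁ ∘L T₂ - T₁₂‖ ≤ A * compSum (2 * d + 5 + s) h C₁ C₂ := by
  refine ⟨⟨2 * (d - 1), boundednessOrder_two_mul _⟩, fun s hs k => ?_⟩
  -- The dimension is n = d - 1, a truncated subtraction, so this uses d ≥ 1.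
  have h1 : 2 * d + 5 + s = 2 * (d - 1) + 7 + s := by omega
  rw [h1]
  exact exists_composition_bound hs k
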